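/- An alternating-sign matrix (ASM) is a square matrix with entries $0,1,-1$ such that in every row and every column there are nonzero entries, they alternate, and the first and the last of them are $1$. It is half-turn symmetric if $M_{n+1-i,\,n+1-j}=M_{ij}$. The first column of an ASM contains exactly one $1$ and otherwise zeros. For $n\ge 1$ put $$\mathcal A(n;t,x)=\sum_{M} x^{k(M)}t^{r(M)-1},\qquad \mathcal A_{\mathrm{HT}}(n;t,x)=\sum_{M\ \text{half-turn symmetric}} x^{k(M)/2}t^{r(M)-1},$$ where $M$ runs over the $n\times n$ ASMs, respectively the half-turn symmetric ones, $k(M)$ is the number of entries $-1$ of $M$, and $r(M)$ is the row of the $1$ in its first column. Here $t$ and $\sqrt x$ are independent variables. For $m\ge1$ put $\mathcal A^{(2)}_{\mathrm{HT}}(2m;t,x)=\mathcal A_{\mathrm{HT}}(2m;t,x)/\mathcal A(m;t,x)$. Let $$\mathcal A^{(+)}_{\mathrm{HT}}(2m+1;t,x)=\sum_{M_{m+1,m+1}=1}x^{k(M)/2}t^{r(M)-1},\qquad \mathcal A^{(-)}_{\mathrm{HT}}(2m+1;t,x)=\sum_{M_{m+1,m+1}=-1}x^{(k(M)-1)/2}t^{r(M)-1},$$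 the sums being over the half-turn symmetric ASMs of order $2m+1$ with central entry $1$, respectively $-1$ (for which $k(M)$ is even, respectively odd), and let $\mathcal A^{\mathrm R}_{\mathrm{HT}}(2m+1;t,x)=\sum_M x^{l(M)}t^{r(M)-1}$ over all half-turn symmetric ASMs of order $2m+1$, where $l(M)$ is the number of orbits of the entries $-1$ under the half-turn. Then $\mathcal A(m;t,x)\neq0$ and $\mathcal A^{(2)}_{\mathrm{HT}}(2m;t,x)$ is a polynomial in $t$ and $x$ for every $m\ge1$, and for every $m\ge 1$ the following identities of rational functions in $t$ and $\sqrt x$ hold: $$\mathcal A_{\mathrm{HT}}(2m+1;t,x)=\frac{\sqrt x\,\mathcal A(m+1;t,x)\,\mathcal A^{(2)}_{\mathrm{HT}}(2m;t,x)+\mathcal A(m;t,x)\,\mathcal A^{(2)}_{\mathrm{HT}}(2m+2;t,x)}{\sqrt x+2},$$ $$\mathcal A_{\mathrm{HT}}(2m+1;t,x)=\mathcal A^{(+)}_{\mathrm{HT}}(2m+1;t,x)+\sqrt x\,\mathcal A^{(-)}_{\mathrm{HT}}(2m+1;t,x),$$ $$\mathcal A^{(+)}_{\mathrm{HT}}(2m+1;t,x)=\frac{-x\,\mathcal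 A(m+1;t,x)\,\mathcal A^{(2)}_{\mathrm{HT}}(2m;t,x)+2\,\mathcal A(m;t,x)\,\mathcal A^{(2)}_{\mathrm{HT}}(2m+2;t,x)}{4-x},$$ $$\mathcal A^{(-)}_{\mathrm{HT}}(2m+1;t,x)=\frac{2\,\mathcal A(m+1;t,x)\,\mathcal A^{(2)}_{\mathrm{HT}}(2m;t,x)-\mathcal A(m;t,x)\,\mathcal A^{(2)}_{\mathrm{HT}}(2m+2;t,x)}{4-x},$$ $$\mathcal A^{\mathrm R}_{\mathrm{HT}}(2m+1;t,x)=\mathcal A^{(+)}_{\mathrm{HT}}(2m+1;t,x)+x\,\mathcal A^{(-)}_{\mathrm{HT}}(2m+1;t,x)$$ $$=\frac{x\,\mathcal A(m+1;t,x)\,\mathcal A^{(2)}_{\mathrm{HT}}(2m;t,x)+(2-x)\,\mathcal A(m;t,x)\,\mathcal A^{(2)}_{\mathrm{HT}}(2m+2;t,x)}{4-x}.$$ -/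

import Mathlib

namespace HTASM

/-- A row or column of an alternating-sign matrix: its nonzero entries (there is at least one)
alternate in sign, and the first and the last nonzero entries are `1`. -/
def IsAlternating {n : ℕ} (v : Fin n → SignType) : Prop :=
  (∃ i, v i ≠ 0) ∧
  (∀ i, v i ≠ 0 → (∀ k, k < i → v k = 0) → v i = 1) ∧
  (∀ i, v i ≠ 0 → (∀ k, i < k → v k = 0) → v i = 1) ∧
  (∀ i j, i < j → v i ≠ 0 → v j ≠ 0 → (∀ k, i < k → k < j → v k = 0) → v j = -v i)

/-- Alternating-sign matrices; the entries `0, 1, -1` are the elements of `SignType`. -/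
def IsASM {n : ℕ} (M : Matrix (Fin n) (Fin n) SignType) : Prop :=
  (∀ i, IsAlternating fun j => M i j) ∧ (∀ j, IsAlternating fun i => M i j)

/-- The half-turn `(i, j) ↦ (n + 1 - i, n + 1 - j)` of the positions. -/
def halfTurn {n : ℕ} (p : Fin n × Fin n) : Fin n × Fin n := (p.1.rev, p.2.rev)

/-- Half-turn symmetric alternating-sign matrices. -/
def IsHTASM {n : ℕ} (M : Matrix (Fin n) (Fin n) SignType) : Prop :=
  IsASM M ∧ ∀ i j, M i.rev j.rev = M i j

/-- The set of positions of the entries `-1`. -/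
def negPos {n : ℕ} (M : Matrix (Fin n) (Fin n) SignType) : Finset (Fin n × Fin n) :=
  Finset.univ.filter fun p => M p.1 p.2 = -1

/-- The number of entries `-1`. -/
def negCount {n : ℕ} (M : Matrix (Fin n) (Fin n) SignType) : ℕ := (negPos M).card

/-- The number of orbits `{p, halfTurn p}` of entries `-1` under the half-turn. -/
def negOrbitCount {n : ℕ} (M : Matrix (Fin n) (Fin n) SignType) : ℕ :=
  ((negPos M).image fun p => ({p, halfTurn p} : Finset (Fin n × Fin n))).card

open Classical in
/-- The `n × n` alternating-sign matrices with `1` in row `r` of the first column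
(rows are numbered from `0`). -/
noncomputable def asms (n : ℕ) (r : Fin n) : Finset (Matrix (Fin n) (Fin n) SignType) :=
  Finset.univ.filter fun M => IsASM M ∧ M r ⟨0, r.pos⟩ = 1

open Classical in
/-- The `n × n` half-turn symmetric alternating-sign matrices with `1` in row `r` of the first
column (rows are numbered from `0`). -/
noncomputable def htasms (n : ℕ) (r : Fin n) : Finset (Matrix (Fin n) (Fin n) SignType) :=
  Finset.univ.filter fun M => IsHTASM M ∧ M r ⟨0, r.pos⟩ = 1

/-- The central entry of a matrix of odd order. -/
def center {m : ℕ} (M : Matrix (Fin (2 * m + 1)) (Fin (2 * m + 1)) SignType) : SignType :=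
  M ⟨m, by omega⟩ ⟨m, by omega⟩

section GeneratingFunctions

variable {R : Type*} [CommSemiring R]

/-- `𝒜(n; t, x)`: the weight is `x ^ k`, where `k` is the number of entries `-1`. -/
noncomputable def A (n : ℕ) (t x : R) : R :=
  ∑ r : Fin n, (∑ M ∈ asms n r, x ^ negCount M) * t ^ (r : ℕ)

/-- `𝒜_HT(n; t, x)` for `x = s ^ 2`, that is, `s = √x`: the weight is `x ^ (k / 2) = s ^ k`, where
`k` is the number of entries `-1`. -/
noncomputable def AHT (n : ℕ) (t s : R) : R :=
  ∑ r : Fin n, (∑ M ∈ htasms n r, s ^ negCount M) * t ^ (r : ℕ)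

/-- `𝒜_HT⁽⁺⁾(2m+1; t, x)`: only matrices with central entry `1`; their number `k` of entries `-1`
is even and the weight is `x ^ (k / 2)`. -/
noncomputable def AHTplus (m : ℕ) (t x : R) : R :=
  ∑ r : Fin (2 * m + 1),
    (∑ M ∈ (htasms (2 * m + 1) r).filter (fun M => center M = 1), x ^ (negCount M / 2)) *
      t ^ (r : ℕ)

/-- `𝒜_HT⁽⁻⁾(2m+1; t, x)`: only matrices with central entry `-1`; their number `k` of entries `-1`
is odd and the weight is `x ^ ((k - 1) / 2)`. -/
noncomputable def AHTminus (m : ℕ) (t x : R) : R :=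
  ∑ r : Fin (2 * m + 1),
    (∑ M ∈ (htasms (2 * m + 1) r).filter (fun M => center M = -1),
      x ^ ((negCount M - 1) / 2)) * t ^ (r : ℕ)

/-- Robbins' enumeration `𝒜_HT^R(n; t, x)`: the weight is `x ^ l`, where `l` is the number of
half-turn orbits of entries `-1`. -/
noncomputable def AHTRobbins (n : ℕ) (t x : R) : R :=
  ∑ r : Fin n, (∑ M ∈ htasms n r, x ^ negOrbitCount M) * t ^ (r : ℕ)

end GeneratingFunctions

/-- `𝒜_HT⁽²⁾(2m; t, x) = 𝒜_HT(2m; t, x) / 𝒜(m; t, x)` for `x = s ^ 2`. -/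
noncomputable def AHT2 {K : Type*} [Field K] (m : ℕ) (t s : K) : K :=
  AHT (2 * m) t s / A m t (s ^ 2)

/-- The field `ℚ(t, √x)` of rational functions in two independent variables `t` and `√x`. -/
abbrev RatField : Type := FractionRing (MvPolynomial (Fin 2) ℚ)

/-- The variable `t`. -/
noncomputable def tVar : RatField :=
  algebraMap (MvPolynomial (Fin 2) ℚ) RatField (MvPolynomial.X 0)

/-- The variable `√x`. -/
noncomputable def sqrtX : RatField :=
  algebraMap (MvPolynomial (Fin 2) ℚ) RatField (MvPolynomial.X 1)

/-- The variable `x = (√x) ^ 2`. -/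
noncomputable def xVar : RatField := sqrtX ^ 2

end HTASM

/-!
# Half-turn symmetric alternating-sign matrices of odd order

Alternating-sign matrices are states of the six-vertex model with domain wall boundary: an edge of
the square grid is in state `true` when the entries before it, in its row or column, sum to `1`. The
vertex weights are parametrised rationally by a fixed `w`, a row parameter `x` and a column
parameter `y` (`vertexWt`). At `x = y = 1` an entry `0` has weight `w`, an entry `1` has weight `1`
and an entry `-1` has weight `w ^ 3`; up to a power of `w` this is the enumeration in which `w`
plays the part of the variable `x` of the theorem, and the parameter `t` in the first column records
the position of the `1` there. The partition function `Zdw` then becomes `A`, and the partition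
functions `Zht`, `Zodd` of half of a half-turn symmetric state become the generating functions of
even order and, with central weights `p` and `r`, of odd order (`Zdw_eq_A`, `Zht_eq_htGen`,
`Zodd_eq_AHT`). So the theorem follows from identities between partition functions with free
parameters, which are specialised at the end.

Two forms of the Yang–Baxter equation (`rowT_rtt`, `vertexWt_col`) make the partition functions
symmetric in the row parameters (`dwProd_perm`, `nest_perm`) and in the column parameters
(`Zdw_comp_perm`, `Zht_comp_perm`, `Zodd_comp_perm`). They are polynomials of small degree in a
column parameter, and where the weight of one kind of entry `0` vanishes at a corner vertex, the row
and the column through it freeze and the size drops by one (`Zdw_eq_of_wtB_eq_zero`,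
`Zht_eq_of_wtB_eq_zero`, `Zodd_eq_of_wtB_eq_zero`). Interpolation at these freezing points gives the
factorisation `Zht_eq`: up to a Vandermonde determinant and a power of `w`, the quotient `Zht / Zdw`
is the determinant `newtonDet`.

In odd order let `e`, `n` be the weights of the two kinds of entry `0` at the centre, and write `γ`,
`γ'` for the values of `gam` at the central row and column parameters. The claim is that `Zodd` with
the central weights `1` and `e + n`, and `Zodd'` with the central weights `e + n` and `w * γ * γ'`,
factor: `Zdw_N * Zodd = Zdw_{N+1} * Zht_N` and `Zdw_{N+1} * Zodd' = Zdw_N * Zht_{N+1}`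
(`Zdw_mul_Zodd`, `Zdw_mul_Zodd'`). Here the freezing points are one too few for the degree. The
missing value is taken at a root `y0` of `gam`, and moving one column after another there reduces
the claim to the case in which all columns are at `y0` (`column_induction`). In that case the row
operators depend on the row parameter in a trivial way (`rowT_diag_root`, `rowT_false_true_root`),
so that the defect of the identity has low degree in the parameter `z` of the central row, and
enough zeros: at the two values of `z` at which `e` or `n` vanishes at the centre, the central row
slides through the other rows (`slice_nest_of_wtE_eq_zero`, `slice_nest_of_wtN_eq_zero`), and `Zodd`
reduces to `Zht`; in the second identity both sides vanish moreover when `z` equals another row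
parameter.

Letting all row parameters tend to `1` (`homogeneous_identities`) gives
`A(m+1) * AHT2(m) = A⁺ + 2 * A⁻` and `A(m) * AHT2(m+1) = 2 * A⁺ + x * A⁻` (`A_mul_central`), where
`A⁺` and `A⁻` count the matrices with central entry `1` and `-1`. These two linear equations have
determinant `x - 4`, and all the formulas of the theorem are consequences of them and of the
parity of the number of entries `-1` (`AHT_odd_eq`, `AHTRobbins_odd_eq`). That `AHT2` is a
polynomial follows from `Zht_eq` too, because `newtonDet` is divisible by the Vandermonde
determinant (`exists_Zht_eq`), and because the prime `x` does not divide `A` (`exists_htGen_eq`).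
-/

namespace HTASM
namespace SixVertex
open Matrix

/-! ### Vertex weights and the Yang–Baxter equation -/

section Weights
variable {R : Type*} [CommRing R]

/-- The weight of an entry `0` whose horizontal and vertical edges are in the same state, in a row
with parameter `x` and a column with parameter `y`. -/
def wtE (w x y : R) : R := 1 - x + (w - 1) * y + x * y

/-- The weight of an entry `0` whose horizontal and vertical edges are in different states. -/
def wtN (w x y : R) : R := 1 - y + (w - 1) * x + x * y

/-- The factor that a row or column with parameter `x` contributes to the weight of an entry
`-1`. -/
def gam (w x : R) : R := 1 + (w - 2) * x + x ^ 2

/-- The weight of the `R`-matrix on equal states; `braidF w x x = gam w x`. -/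
def braidF (w x x' : R) : R := 1 + (w - 2) * x + x * x'

/-- The weight of a vertex with left, right, upper and lower edges in the states `a`, `b`, `v`,
`u`. An edge is in the state `true` if the entries before it, in its row or column, sum to `1`; so
the entry at the vertex is `b - a = u - v`, and all other configurations have weight `0`. -/
def vertexWt (w x y : R) : Bool → Bool → Bool → Bool → R
  | false, false, false, false => wtE w x y
  | true, true, true, true => wtE w x y
  | false, false, true, true => wtN w x y
  | true, true, false, false => wtN w x y
  | false, true, false, true => 1
  | true, false, true, false => w * gam w x * gam w y
  | _, _, _, _ => 0

/-- The `R`-matrix that exchanges two rows or two columns with parameters `x` and `x'`. -/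
def braidWt (w x x' : R) : Bool → Bool → Bool → Bool → R
  | false, false, false, false => braidF w x x'
  | true, true, true, true => braidF w x x'
  | false, true, false, true => gam w x
  | true, false, true, false => gam w x'
  | false, true, true, false => x' - x
  | true, false, false, true => x' - x
  | _, _, _, _ => 0

set_option maxHeartbeats 1000000 in
/-- The Yang–Baxter equation for two rows crossing one column. -/
theorem vertexWt_rtt (w x x' y : R) (a b e f v u : Bool) :
    ∑ c, ∑ d, braidWt w x x' a b c d *
        ∑ m, vertexWt w x y c e v m * vertexWt w x' y d f m u =
      ∑ c, ∑ d, braidWt w x x' c d e f *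
        ∑ m, vertexWt w x' y a c v m * vertexWt w x y b d m u := by
  simp only [Fintype.sum_bool]
  cases a <;> cases b <;> cases e <;> cases f <;> cases v <;> cases u <;>
  simp only [vertexWt, braidWt, mul_zero, zero_mul, add_zero, zero_add, mul_one, one_mul] <;>
  simp only [braidF, gam, wtE, wtN] <;> ring

set_option maxHeartbeats 1000000 in
/-- The Yang–Baxter equation for one row crossing two columns. -/
theorem vertexWt_col (w x y y' : R) (a b v1 v2 u1 u2 : Bool) :
    ∑ h, ∑ m1, ∑ m2, vertexWt w x y a h v1 m1 * vertexWt w x y' h b v2 m2 *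
        braidWt w y y' m2 m1 u2 u1 =
      ∑ h, ∑ m1, ∑ m2, braidWt w y y' v2 v1 m2 m1 *
        (vertexWt w x y' a h m1 u1 * vertexWt w x y h b m2 u2) := by
  simp only [Fintype.sum_bool]
  cases a <;> cases b <;> cases v1 <;> cases v2 <;> cases u1 <;> cases u2 <;>
  simp only [vertexWt, braidWt, mul_zero, zero_mul, add_zero, zero_add, mul_one, one_mul] <;>
  simp only [braidF, gam, wtE, wtN] <;> ring
end Weights

/-! ### Row operators -/

section RowTransfer
variable {R : Type*} [CommRing R]

/-- The vertex weights as an operator on the state of the vertical edge, from top to bottom. -/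
def vertexMat (w x y : R) (a b : Bool) : Matrix Bool Bool R := Matrix.of (vertexWt w x y a b)

/-- The operator of a row with parameter `x` and column parameters `y`, from the states of the
vertical edges above the row to those below it, when the row enters on the left in the state `a` and
leaves on the right in the state `b`. -/
def rowT (w x : R) : {n : ℕ} → (Fin n → R) → Bool → Bool →
    Matrix (Fin n → Bool) (Fin n → Bool) R
  | 0, _, a, b => if a = b then 1 else 0
  | _ + 1, y, a, b => Matrix.of fun v u => ∑ h, vertexWt w x (y 0) a h (v 0) (u 0) *
      rowT w x (Fin.tail y) h b (Fin.tail v) (Fin.tail u)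

theorem rowT_zero (w x : R) (y : Fin 0 → R) (a b : Bool) :
    rowT w x y a b = if a = b then 1 else 0 := rfl

theorem rowT_apply_succ (w x : R) {n : ℕ} (y : Fin (n + 1) → R) (a b : Bool)
    (v u : Fin (n + 1) → Bool) :
    rowT w x y a b v u = ∑ h, vertexWt w x (y 0) a h (v 0) (u 0) *
      rowT w x (Fin.tail y) h b (Fin.tail v) (Fin.tail u) := rfl

/-- The operator acting by `A` on the first site and by `B` on the others. -/
def consTensor {n : ℕ} : Matrix Bool Bool R →ₗ[R]
    Matrix (Fin n → Bool) (Fin n → Bool) R →ₗ[R]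
    Matrix (Fin (n + 1) → Bool) (Fin (n + 1) → Bool) R :=
  LinearMap.mk₂ R (fun A B => Matrix.of fun v u => A (v 0) (u 0) * B (Fin.tail v) (Fin.tail u))
    (fun _ _ _ => by ext; simp [add_mul]) (fun _ _ _ => by ext; simp [mul_assoc])
    (fun _ _ _ => by ext; simp [mul_add]) (fun _ _ _ => by ext; simp [mul_left_comm])

theorem consTensor_apply {n : ℕ} (A : Matrix Bool Bool R)
    (B : Matrix (Fin n → Bool) (Fin n → Bool) R) (v u : Fin (n + 1) → Bool) :
    consTensor A B v u = A (v 0) (u 0) * B (Fin.tail v) (Fin.tail u) := rfl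

theorem sum_cons {α M : Type*} [Fintype α] [AddCommMonoid M] {n : ℕ}
    (f : (Fin (n + 1) → α) → M) : ∑ v, f v = ∑ b, ∑ v' : Fin n → α, f (Fin.cons b v') := by
  rw [← (Fin.consEquiv fun _ : Fin (n + 1) => α).sum_comp, Fintype.sum_prod_type]
  rfl

theorem sum_snoc {α M : Type*} [Fintype α] [AddCommMonoid M] {n : ℕ}
    (f : (Fin (n + 1) → α) → M) : ∑ v, f v = ∑ v' : Fin n → α, ∑ b, f (Fin.snoc v' b) := by
  rw [← (Fin.snocEquiv fun _ : Fin (n + 1) => α).sum_comp, Fintype.sum_prod_type,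
    Finset.sum_comm]
  rfl

theorem consTensor_mul {n : ℕ} (A C : Matrix Bool Bool R)
    (B D : Matrix (Fin n → Bool) (Fin n → Bool) R) :
    consTensor A B * consTensor C D = consTensor (A * C) (B * D) := by
  ext v u
  simp only [Matrix.mul_apply, consTensor_apply, sum_cons, Fin.cons_zero, Fin.tail_cons,
    Finset.sum_mul_sum]
  exact Finset.sum_congr rfl fun _ _ => Finset.sum_congr rfl fun _ _ => by ring

theorem rowT_succ (w x : R) {n : ℕ} (y : Fin (n + 1) → R) (a b : Bool) :
    rowT w x y a b = ∑ h, consTensor (vertexMat w x (y 0) a h) (rowT w x (Fin.tail y) h b) := by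
  ext v u
  rw [rowT_apply_succ, Matrix.sum_apply]
  rfl

theorem vertexMat_rtt (w x x' y : R) (a b e f : Bool) :
    ∑ c, ∑ d, braidWt w x x' a b c d • (vertexMat w x y c e * vertexMat w x' y d f) =
      ∑ c, ∑ d, braidWt w x x' c d e f • (vertexMat w x' y a c * vertexMat w x y b d) := by
  ext v u
  simpa [Matrix.sum_apply, Matrix.mul_apply, vertexMat] using vertexWt_rtt w x x' y a b e f v u

/-- The Yang–Baxter equation for two rows of any length. -/
theorem rowT_rtt (w x x' : R) {n : ℕ} (y : Fin n → R) (a b e f : Bool) :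
    ∑ c, ∑ d, braidWt w x x' a b c d • (rowT w x y c e * rowT w x' y d f) =
      ∑ c, ∑ d, braidWt w x x' c d e f • (rowT w x' y a c * rowT w x y b d) := by
  induction n generalizing a b e f with
  | zero =>
    cases a <;> cases b <;> cases e <;> cases f <;> simp [braidWt, rowT_zero]
  | succ n ih =>
    have key : ∀ (x x' : R) (c d e f : Bool), rowT w x y c e * rowT w x' y d f =
        ∑ h, ∑ k, consTensor (vertexMat w x (y 0) c h * vertexMat w x' (y 0) d k)
          (rowT w x (Fin.tail y) h e * rowT w x' (Fin.tail y) k f) := by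
      intro x x' c d e f
      rw [rowT_succ, rowT_succ, Finset.sum_mul_sum]
      simp only [consTensor_mul]
    calc _ = ∑ h, ∑ k, consTensor (∑ c, ∑ d, braidWt w x x' a b c d •
              (vertexMat w x (y 0) c h * vertexMat w x' (y 0) d k))
              (rowT w x (Fin.tail y) h e * rowT w x' (Fin.tail y) k f) := by
            simp only [key, map_add, map_smul, LinearMap.add_apply, LinearMap.smul_apply,
              Fintype.sum_bool, smul_add]
            abel
      _ = ∑ c, ∑ d, consTensor (vertexMat w x' (y 0) a c * vertexMat w x (y 0) b d)
              (∑ h, ∑ k, braidWt w x x' c d h k •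
                (rowT w x (Fin.tail y) h e * rowT w x' (Fin.tail y) k f)) := by
            simp only [vertexMat_rtt]
            simp only [map_add, map_smul, LinearMap.add_apply, LinearMap.smul_apply,
              Fintype.sum_bool]
            abel
      _ = _ := by
            simp only [ih]
            simp only [key, map_add, map_smul, LinearMap.add_apply, LinearMap.smul_apply,
              Fintype.sum_bool, smul_add]
            abel

theorem vertexWt_map {S : Type*} [CommRing S] (φ : R →+* S) (w x y : R) (a b v u : Bool) :
    φ (vertexWt w x y a b v u) = vertexWt (φ w) (φ x) (φ y) a b v u := by
  have h2 : φ 2 = 2 := map_ofNat φ 2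
  cases a <;> cases b <;> cases v <;> cases u <;> simp [vertexWt, wtE, wtN, gam, h2]

theorem rowT_map {S : Type*} [CommRing S] (φ : R →+* S) (w x : R) {n : ℕ} (y : Fin n → R)
    (a b : Bool) : (rowT w x y a b).map φ = rowT (φ w) (φ x) (φ ∘ y) a b := by
  induction n generalizing a b with
  | zero => simp only [rowT_zero]; split_ifs <;> simp
  | succ n ih =>
    ext v u
    rw [Matrix.map_apply, rowT_apply_succ, rowT_apply_succ]
    simp only [map_sum, map_mul, vertexWt_map]
    refine Finset.sum_congr rfl fun h _ => ?_
    have := congrFun (congrFun (ih (Fin.tail y) h b) (Fin.tail v)) (Fin.tail u)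
    rw [Matrix.map_apply] at this
    rw [this]; rfl

theorem tail_snoc {α : Type*} {n : ℕ} (y : Fin (n + 1) → α) (z : α) :
    Fin.tail (Fin.snoc y z : Fin (n + 2) → α) = (Fin.snoc (Fin.tail y) z : Fin (n + 1) → α) := by
  conv_lhs => rw [← Fin.cons_self_tail y, ← Fin.cons_snoc_eq_snoc_cons]
  rw [Fin.tail_cons]

theorem snoc_apply_zero' {α : Type*} {n : ℕ} (y : Fin (n + 1) → α) (z : α) :
    (Fin.snoc y z : Fin (n + 2) → α) 0 = y 0 := by
  conv_lhs => rw [← Fin.cons_self_tail y, ← Fin.cons_snoc_eq_snoc_cons]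
  rw [Fin.cons_zero]

/-- The recursion for row operators that splits off the last column instead of the first. -/
theorem rowT_snoc (w x : R) {n : ℕ} (y : Fin n → R) (z : R) (a b : Bool) (v u : Fin n → Bool)
    (s t : Bool) : rowT w x (Fin.snoc y z : Fin (n + 1) → R) a b
      (Fin.snoc v s : Fin (n + 1) → Bool) (Fin.snoc u t : Fin (n + 1) → Bool) =
      ∑ h, rowT w x y a h v u * vertexWt w x z h b s t := by
  induction n generalizing a with
  | zero =>
    rw [rowT_apply_succ, Fin.snoc_zero, Fin.snoc_zero, Fin.snoc_zero]
    have hvu : v = u := Subsingleton.elim _ _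
    subst hvu
    have ht : ∀ p q : Fin 1 → Bool, Fin.tail p = Fin.tail q := fun _ _ => Subsingleton.elim _ _
    simp only [rowT_zero, Fintype.sum_bool, ht _ (fun _ => s)]
    cases a <;> cases b <;> simp [Matrix.one_apply]
  | succ n ih =>
    rw [rowT_apply_succ]
    simp only [tail_snoc, snoc_apply_zero', ih, rowT_apply_succ, Finset.mul_sum, Finset.sum_mul]
    rw [Finset.sum_comm]
    simp only [mul_assoc]
end RowTransfer

/-! ### Half-turn folded products of row operators -/

section Nest
variable {R : Type*} [CommRing R]
variable {κ ι : Type*} [Fintype κ] [Fintype ι]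

/-- The operator of the left half of a half-turn symmetric state, folded around the base `B`. The
row `x`, counted from the outside, consists of an upper half with operator `t' x` and of a lower
half with operator `t x`. Both enter on the left in the state `false`. The right half of the upper
row is the lower half row turned around, so the two halves leave in opposite states. -/
def nest (t' : R → Bool → Bool → Matrix κ κ R) (t : R → Bool → Bool → Matrix ι ι R)
    (B : Matrix κ ι R) : List R → Matrix κ ι R
  | [] => B
  | x :: xs => ∑ ε, t' x false ε * nest t' t B xs * t x false (!ε)

/-- The exchange relations that the Yang–Baxter equation gives for operators of rows entering in the
state `false`; the field names are the two states in which the rows leave. -/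
structure Exchange (w x x' : R) (t : R → Bool → Bool → Matrix ι ι R) : Prop where
  ff : braidF w x x' • (t x false false * t x' false false) =
    braidF w x x' • (t x' false false * t x false false)
  tt : braidF w x x' • (t x false true * t x' false true) =
    braidF w x x' • (t x' false true * t x false true)
  ft : braidF w x x' • (t x false false * t x' false true) =
    gam w x • (t x' false false * t x false true) + (x' - x) • (t x' false true * t x false false)
  tf : braidF w x x' • (t x false true * t x' false false) =
    (x' - x) • (t x' false false * t x false true) + gam w x' • (t x' false true * t x false false)

theorem rowT_exchange (w x x' : R) {n : ℕ} (y : Fin n → R) :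
    Exchange w x x' (fun x => rowT w x y) := by
  have h := rowT_rtt w x x' y false false
  constructor
  · simpa [braidWt] using h false false
  · simpa [braidWt] using h true true
  · simpa [braidWt, add_comm] using h false true
  · simpa [braidWt, add_comm] using h true false

/-- Two neighbouring rows of a nested product may be exchanged: the exchange relations for the upper
and the lower half rows produce the same cross terms, because the two halves leave in opposite
states. -/
theorem smul_nest_swap {w x x' : R} {t' : R → Bool → Bool → Matrix κ κ R}
    {t : R → Bool → Bool → Matrix ι ι R} (h' : Exchange w x x' t') (h : Exchange w x x' t)
    (B : Matrix κ ι R) (xs : List R) :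
    braidF w x x' • nest t' t B (x :: x' :: xs) = braidF w x x' • nest t' t B (x' :: x :: xs) := by
  set F := braidF w x x'
  set N := nest t' t B xs
  have e1 : ∀ x x', nest t' t B (x :: x' :: xs) =
      (t' x false false * t' x' false false) * N * (t x' false true * t x false true) +
      (t' x false true * t' x' false true) * N * (t x' false false * t x false false) +
      ((t' x false false * t' x' false true) * N * (t x' false false * t x false true) +
      (t' x false true * t' x' false false) * N * (t x' false true * t x false false)) := by
    intro x x'
    simp only [nest, Fintype.sum_bool, Bool.not_true, Bool.not_false, Matrix.add_mul,
      Matrix.mul_add, Matrix.mul_assoc, N]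
    abel
  have a1 : ∀ (p q r : Matrix κ κ R) (s : Matrix ι ι R), F • p = F • q →
      F • (p * N * s) = F • (q * N * s) := by
    intro p q r s hpq
    rw [← Matrix.smul_mul, ← Matrix.smul_mul, hpq, Matrix.smul_mul, Matrix.smul_mul]
  have l : ∀ (p : Matrix κ κ R) (s : Matrix ι ι R), F • (p * N * s) = (F • p) * N * s := by
    intro p s; rw [Matrix.smul_mul, Matrix.smul_mul]
  have r : ∀ (p : Matrix κ κ R) (s : Matrix ι ι R), F • (p * N * s) = p * N * (F • s) := by
    intro p s; rw [Matrix.mul_smul]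
  rw [e1, e1]
  simp only [smul_add]
  congr 1
  · congr 1
    · rw [l, h'.ff, ← l, r, ← h.tt, ← r]
    · rw [l, h'.tt, ← l, r, ← h.ff, ← r]
  · rw [l, l, h'.ft, h'.tf, r, r, h.ft, h.tf]
    simp only [Matrix.add_mul, Matrix.mul_add, Matrix.smul_mul, Matrix.mul_smul]
    abel

theorem nest_map {S : Type*} [CommRing S] (φ : R →+* S)
    (t' : R → Bool → Bool → Matrix κ κ R) (t : R → Bool → Bool → Matrix ι ι R)
    (s' : S → Bool → Bool → Matrix κ κ S) (s : S → Bool → Bool → Matrix ι ι S)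
    (ht' : ∀ x a b, (t' x a b).map φ = s' (φ x) a b) (ht : ∀ x a b, (t x a b).map φ = s (φ x) a b)
    (B : Matrix κ ι R) (xs : List R) :
    (nest t' t B xs).map φ = nest s' s (B.map φ) (xs.map φ) := by
  induction xs with
  | nil => rfl
  | cons x xs ih =>
    simp only [nest, List.map_cons, Fintype.sum_bool]
    rw [Matrix.map_add _ (map_add φ), Matrix.map_mul, Matrix.map_mul, Matrix.map_mul,
      Matrix.map_mul, ht', ht', ht, ht, ih]

/-- The product of the operators of domain-wall rows, top row first. -/
def dwProd (w : R) {n : ℕ} (y : Fin n → R) (xs : List R) :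
    Matrix (Fin n → Bool) (Fin n → Bool) R :=
  (xs.map fun x => rowT w x y false true).prod

end Nest

/-! ### Symmetry in the row parameters -/

section Symmetry
variable {K : Type*} [Field K]
open Polynomial

theorem braidF_C_X_ne_zero (w x : K) : braidF (C w) (C x) (X : K[X]) ≠ 0 := by
  intro h
  have h2 : (C 2 : K[X]) = 2 := map_ofNat C 2
  have e : braidF (C w) (C x) (X : K[X]) = C (1 + (w - 2) * x) + C x * X := by
    simp [braidF, h2]
  rw [e] at h
  have h0 : (C (1 + (w - 2) * x) + C x * X : K[X]).coeff 0 = 0 := by rw [h]; rfl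
  have h1 : (C (1 + (w - 2) * x) + C x * X : K[X]).coeff 1 = 0 := by rw [h]; rfl
  simp only [coeff_add, coeff_C_mul, coeff_C_zero, coeff_X_zero, coeff_X_one, coeff_C_succ,
    mul_zero, mul_one, add_zero, zero_add] at h0 h1
  simp [h1] at h0

theorem rowT_map_C_eval (w x' : K) {n : ℕ} (y : Fin n → K) (p : K[X]) (a b : Bool) :
    (rowT (C w) p (fun i => C (y i)) a b).map (evalRingHom x') = rowT w (p.eval x') y a b := by
  rw [rowT_map]
  simp [Function.comp_def]

/-- The factor `braidF` is cancelled with an indeterminate in place of `x'`, where it is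
nonzero. -/
theorem nest_swap (w x x' : K) {m n : ℕ} (y' : Fin m → K) (y : Fin n → K)
    (B : Matrix (Fin m → Bool) (Fin n → Bool) K) (xs : List K) :
    nest (fun x => rowT w x y') (fun x => rowT w x y) B (x :: x' :: xs) =
      nest (fun x => rowT w x y') (fun x => rowT w x y) B (x' :: x :: xs) := by
  have h := smul_nest_swap (rowT_exchange (C w) (C x) X fun i => C (y' i))
    (rowT_exchange (C w) (C x) X fun i => C (y i)) (B.map C) (xs.map C)
  have h2 := smul_right_injective _ (braidF_C_X_ne_zero w x) h
  have e := nest_map (evalRingHom x') (fun x => rowT (C w) x fun i => C (y' i))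
    (fun x => rowT (C w) x fun i => C (y i)) (fun x => rowT w x y') (fun x => rowT w x y)
    (fun p a b => rowT_map_C_eval w x' y' p a b) (fun p a b => rowT_map_C_eval w x' y p a b)
    (B.map C)
  have hB : (B.map C).map (evalRingHom x') = B := by ext; simp
  have hl : (xs.map C).map (evalRingHom x') = xs := by
    rw [List.map_map]; convert List.map_id xs using 2; ext; simp
  have hC : (evalRingHom x') (C x) = x := by simp
  have hX : (evalRingHom x') (X : K[X]) = x' := by simp
  have e1 := e (C x :: X :: xs.map C)
  have e2 := e (X :: C x :: xs.map C)
  rw [hB, List.map_cons, List.map_cons, hl, hC, hX] at e1 e2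
  rw [← e1, ← e2, h2]

theorem nest_perm (w : K) {m n : ℕ} (y' : Fin m → K) (y : Fin n → K)
    (B : Matrix (Fin m → Bool) (Fin n → Bool) K) {xs xs' : List K} (h : xs.Perm xs') :
    nest (fun x => rowT w x y') (fun x => rowT w x y) B xs =
      nest (fun x => rowT w x y') (fun x => rowT w x y) B xs' := by
  induction h with
  | nil => rfl
  | cons x _ ih => simp only [nest, ih]
  | swap x x' xs => exact nest_swap ..
  | trans _ _ ih ih' => exact ih.trans ih'

theorem rowT_comm (w x x' : K) {n : ℕ} (y : Fin n → K) :
    rowT w x y false true * rowT w x' y false true =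
      rowT w x' y false true * rowT w x y false true := by
  have h := (rowT_exchange (C w) (C x) X fun i => C (y i)).tt
  have h2 := congrArg (fun M => M.map (evalRingHom x'))
    (smul_right_injective _ (braidF_C_X_ne_zero w x) h)
  simpa only [Matrix.map_mul, rowT_map_C_eval, eval_C, eval_X] using h2

theorem dwProd_perm (w : K) {n : ℕ} (y : Fin n → K) {xs xs' : List K} (h : xs.Perm xs') :
    dwProd w y xs = dwProd w y xs' :=
  (h.map _).prod_eq' (List.pairwise_map.2 (List.pairwise_of_forall fun _ _ => rowT_comm ..))

end Symmetry

/-! ### Partition functions -/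

section Partition
variable {R : Type*} [CommRing R]

/-- All vertical edges in the state `false`, as at the upper boundary. -/
abbrev bot {n : ℕ} : Fin n → Bool := fun _ => false

/-- All vertical edges in the state `true`, as at the lower boundary. -/
abbrev top {n : ℕ} : Fin n → Bool := fun _ => true

/-- The partition function with domain wall boundary. -/
def Zdw (w : R) (xs : List R) {n : ℕ} (y : Fin n → R) : R := dwProd w y xs bot top

/-- The partition function of the half-turn symmetric states of even order, with row parameters `xs`
in the upper half and column parameters `y` in the left half. -/
def Zht (w : R) (xs : List R) {n : ℕ} (y : Fin n → R) : R :=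
  nest (fun x => rowT w x y) (fun x => rowT w x y) 1 xs bot top

/-- The left half of the central row, with parameter `z`, of a half-turn symmetric state of odd
order. The upper half of the central column, which is the last coordinate of the upper states, and
the left half of the central row end in the same state; it is `false` if the central entry is `1`
and `true` if it is `-1`. These entries have the weights `p` and `r`. -/
def oddBase (w p r z : R) {n : ℕ} (y : Fin n → R) :
    Matrix (Fin (n + 1) → Bool) (Fin n → Bool) R :=
  Matrix.of fun v u => bif v (Fin.last n) then r * rowT w z y false true (Fin.init v) u
    else p * rowT w z y false false (Fin.init v) u

/-- The partition function of the half-turn symmetric states of odd order with central row and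
column parameters `z`, `z'` and with the weights `p`, `r` of the central entries `1`, `-1`. -/
def Zodd (w p r z z' : R) (xs : List R) {n : ℕ} (y : Fin n → R) : R :=
  nest (fun x => rowT w x (Fin.snoc y z' : Fin (n + 1) → R)) (fun x => rowT w x y)
    (oddBase w p r z y) xs bot top

theorem nestHT_map {S : Type*} [CommRing S] (φ : R →+* S) (w : R) {m n : ℕ} (y' : Fin m → R)
    (y : Fin n → R) (B : Matrix (Fin m → Bool) (Fin n → Bool) R) (xs : List R) :
    (nest (fun x => rowT w x y') (fun x => rowT w x y) B xs).map φ =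
      nest (fun x => rowT (φ w) x (φ ∘ y')) (fun x => rowT (φ w) x (φ ∘ y)) (B.map φ)
        (xs.map φ) :=
  nest_map φ _ _ _ _ (fun _ _ _ => rowT_map ..) (fun _ _ _ => rowT_map ..) _ _

theorem Zdw_map {S : Type*} [CommRing S] (φ : R →+* S) (w : R) (xs : List R) {n : ℕ}
    (y : Fin n → R) : φ (Zdw w xs y) = Zdw (φ w) (xs.map φ) (φ ∘ y) := by
  have : (dwProd w y xs).map φ = dwProd (φ w) (φ ∘ y) (xs.map φ) := by
    unfold dwProd
    induction xs with
    | nil => simp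
    | cons x xs ih =>
      simp only [List.map_cons, List.prod_cons, Matrix.map_mul, ih, rowT_map]
  exact congrFun (congrFun this bot) top

theorem Zht_map {S : Type*} [CommRing S] (φ : R →+* S) (w : R) (xs : List R) {n : ℕ}
    (y : Fin n → R) : φ (Zht w xs y) = Zht (φ w) (xs.map φ) (φ ∘ y) := by
  have := congrFun (congrFun (nestHT_map φ w y y 1 xs) bot) top
  rw [Matrix.map_one _ (map_zero φ) (map_one φ)] at this
  exact this

theorem oddBase_map {S : Type*} [CommRing S] (φ : R →+* S) (w p r z : R) {n : ℕ}
    (y : Fin n → R) : (oddBase w p r z y).map φ = oddBase (φ w) (φ p) (φ r) (φ z) (φ ∘ y) := by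
  ext v u
  have h : ∀ b a c, φ (rowT w z y b a c u) = rowT (φ w) (φ z) (φ ∘ y) b a c u :=
    fun b a c => congrFun (congrFun (rowT_map φ w z y b a) c) u
  simp only [oddBase, Matrix.map_apply, Matrix.of_apply]
  cases v (Fin.last n) <;> simp [h]

omit [CommRing R] in
theorem comp_snoc {S : Type*} (φ : R → S) {n : ℕ} (y : Fin n → R) (z : R) :
    φ ∘ (Fin.snoc y z : Fin (n + 1) → R) = (Fin.snoc (φ ∘ y) (φ z) : Fin (n + 1) → S) := by
  ext i; refine Fin.lastCases ?_ (fun i => ?_) i <;> simp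

theorem Zodd_map {S : Type*} [CommRing S] (φ : R →+* S) (w p r z z' : R) (xs : List R) {n : ℕ}
    (y : Fin n → R) :
    φ (Zodd w p r z z' xs y) =
      Zodd (φ w) (φ p) (φ r) (φ z) (φ z') (xs.map φ) (φ ∘ y) := by
  have := congrFun (congrFun (nestHT_map φ w (Fin.snoc y z' : Fin (n + 1) → R) y
    (oddBase w p r z y) xs) bot) top
  rw [oddBase_map, comp_snoc] at this
  exact this

end Partition

/-! ### Intertwiners of neighbouring columns -/

section ColumnSymmetry
variable {R : Type*} [CommRing R]

theorem bot_snoc {n : ℕ} : (bot : Fin (n + 1) → Bool) = Fin.snoc (bot : Fin n → Bool) false := by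
  ext i; refine Fin.lastCases ?_ (fun i => ?_) i <;> simp

theorem top_snoc {n : ℕ} : (top : Fin (n + 1) → Bool) = Fin.snoc (top : Fin n → Bool) true := by
  ext i; refine Fin.lastCases ?_ (fun i => ?_) i <;> simp

theorem bot_cons {n : ℕ} : (bot : Fin (n + 1) → Bool) = Fin.cons false (bot : Fin n → Bool) := by
  ext i; refine Fin.cases ?_ (fun i => ?_) i <;> simp

theorem top_cons {n : ℕ} : (top : Fin (n + 1) → Bool) = Fin.cons true (top : Fin n → Bool) := by
  ext i; refine Fin.cases ?_ (fun i => ?_) i <;> simp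

/-- `P` intertwines the rows with column parameters `y` and `y'`, and acts on both boundary states
as the scalar `f`. -/
structure ColBraid (w : R) {n : ℕ} (y y' : Fin n → R) (f : R)
    (P : Matrix (Fin n → Bool) (Fin n → Bool) R) : Prop where
  comm : ∀ x a b, rowT w x y a b * P = P * rowT w x y' a b
  bot_bot : P bot bot = f
  bot_ne : ∀ u, u ≠ bot → P bot u = 0
  top_top : P top top = f
  ne_top : ∀ v, v ≠ top → P v top = 0

theorem ColBraid.cons {w : R} {n : ℕ} {y y' : Fin n → R} {f : R}
    {P : Matrix (Fin n → Bool) (Fin n → Bool) R} (h : ColBraid w y y' f P) (z : R) :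
    ColBraid w (Fin.cons z y : Fin (n + 1) → R) (Fin.cons z y' : Fin (n + 1) → R) f
      (consTensor 1 P) where
  comm x a b := by
    simp only [rowT_succ, Finset.sum_mul, Finset.mul_sum, consTensor_mul, Fin.cons_zero,
      Fin.tail_cons, h.comm, mul_one, one_mul]
  bot_bot := by
    rw [consTensor_apply, bot_cons, Fin.tail_cons, Fin.cons_zero, h.bot_bot, Matrix.one_apply_eq,
      one_mul]
  top_top := by
    rw [consTensor_apply, top_cons, Fin.tail_cons, Fin.cons_zero, h.top_top, Matrix.one_apply_eq,
      one_mul]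
  bot_ne u hu := by
    rw [← Fin.cons_self_tail u, bot_cons, Ne, Fin.cons_inj, not_and_or] at hu
    rw [consTensor_apply, bot_cons, Fin.tail_cons, Fin.cons_zero]
    rcases hu with hu | hu
    · rw [Matrix.one_apply_ne (Ne.symm hu), zero_mul]
    · rw [h.bot_ne _ hu, mul_zero]
  ne_top u hu := by
    rw [← Fin.cons_self_tail u, top_cons, Ne, Fin.cons_inj, not_and_or] at hu
    rw [consTensor_apply, top_cons, Fin.tail_cons, Fin.cons_zero]
    rcases hu with hu | hu
    · rw [Matrix.one_apply_ne hu, zero_mul]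
    · rw [h.ne_top _ hu, mul_zero]

/-- The operator acting by `P` on all columns but the last and by the identity on the last. -/
def snocTensor {n : ℕ} (P : Matrix (Fin n → Bool) (Fin n → Bool) R) :
    Matrix (Fin (n + 1) → Bool) (Fin (n + 1) → Bool) R :=
  Matrix.of fun v u => P (Fin.init v) (Fin.init u) *
    if v (Fin.last n) = u (Fin.last n) then 1 else 0

theorem snocTensor_snoc {n : ℕ} (P : Matrix (Fin n → Bool) (Fin n → Bool) R)
    (v u : Fin n → Bool) (s t : Bool) : snocTensor P (Fin.snoc v s : Fin (n + 1) → Bool)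
      (Fin.snoc u t : Fin (n + 1) → Bool) = P v u * if s = t then 1 else 0 := by
  simp [snocTensor]

theorem ColBraid.snoc {w : R} {n : ℕ} {y y' : Fin n → R} {f : R}
    {P : Matrix (Fin n → Bool) (Fin n → Bool) R} (h : ColBraid w y y' f P) (z : R) :
    ColBraid w (Fin.snoc y z : Fin (n + 1) → R) (Fin.snoc y' z : Fin (n + 1) → R) f
      (snocTensor P) where
  comm x a b := by
    ext v u
    have hc := fun a b v u => congrFun (congrFun (h.comm x a b) v) u
    simp only [Matrix.mul_apply] at hc
    rw [← Fin.snoc_init_self v, ← Fin.snoc_init_self u]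
    simp only [Matrix.mul_apply, sum_snoc, rowT_snoc, snocTensor_snoc]
    simp only [mul_ite, mul_one, mul_zero, ite_mul, zero_mul, Finset.sum_ite_eq,
      Finset.sum_ite_eq', Finset.mem_univ, if_true]
    generalize Fin.init v = v', Fin.init u = u'
    trans ∑ k, (∑ m, rowT w x y a k v' m * P m u') * vertexWt w x z k b (v (Fin.last n))
      (u (Fin.last n))
    · simp only [Finset.sum_mul]
      rw [Finset.sum_comm]
      exact Finset.sum_congr rfl fun _ _ => Finset.sum_congr rfl fun _ _ => by ring
    · simp only [hc, Finset.sum_mul, Finset.mul_sum]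
      rw [Finset.sum_comm]
      exact Finset.sum_congr rfl fun _ _ => Finset.sum_congr rfl fun _ _ => by ring
  bot_bot := by rw [bot_snoc, snocTensor_snoc, h.bot_bot, if_pos rfl, mul_one]
  top_top := by rw [top_snoc, snocTensor_snoc, h.top_top, if_pos rfl, mul_one]
  bot_ne u hu := by
    rw [← Fin.snoc_init_self u, bot_snoc, Ne, Fin.snoc_inj, not_and_or] at hu
    rw [← Fin.snoc_init_self u, bot_snoc, snocTensor_snoc]
    rcases hu with hu | hu
    · rw [h.bot_ne _ hu, zero_mul]
    · rw [if_neg (Ne.symm hu), mul_zero]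
  ne_top u hu := by
    rw [← Fin.snoc_init_self u, top_snoc, Ne, Fin.snoc_inj, not_and_or] at hu
    rw [← Fin.snoc_init_self u, top_snoc, snocTensor_snoc]
    rcases hu with hu | hu
    · rw [h.ne_top _ hu, zero_mul]
    · rw [if_neg hu, mul_zero]

theorem rowT_cons_cons (w x : R) {n : ℕ} (y : Fin n → R) (y1 y2 : R) (a b v1 v2 u1 u2 : Bool)
    (v u : Fin n → Bool) :
    rowT w x (Fin.cons y1 (Fin.cons y2 y : Fin (n + 1) → R) : Fin (n + 2) → R) a b
      (Fin.cons v1 (Fin.cons v2 v : Fin (n + 1) → Bool) : Fin (n + 2) → Bool)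
      (Fin.cons u1 (Fin.cons u2 u : Fin (n + 1) → Bool) : Fin (n + 2) → Bool) =
    ∑ k, (∑ h, vertexWt w x y1 a h v1 u1 * vertexWt w x y2 h k v2 u2) * rowT w x y k b v u := by
  simp only [rowT_apply_succ, Fin.cons_zero, Fin.tail_cons, Finset.mul_sum, Finset.sum_mul]
  rw [Finset.sum_comm]
  simp only [mul_assoc]

/-- The `R`-matrix acting on the first two columns. -/
def braidMat (w y1 y2 : R) (n : ℕ) : Matrix (Fin (n + 2) → Bool) (Fin (n + 2) → Bool) R :=
  Matrix.of fun v u => braidWt w y1 y2 (v 1) (v 0) (u 1) (u 0) *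
    if Fin.tail (Fin.tail v) = Fin.tail (Fin.tail u) then 1 else 0

theorem braidMat_cons (w y1 y2 : R) {n : ℕ} (v1 v2 u1 u2 : Bool) (v u : Fin n → Bool) :
    braidMat w y1 y2 n (Fin.cons v1 (Fin.cons v2 v : Fin (n + 1) → Bool) : Fin (n + 2) → Bool)
      (Fin.cons u1 (Fin.cons u2 u : Fin (n + 1) → Bool) : Fin (n + 2) → Bool) =
    braidWt w y1 y2 v2 v1 u2 u1 * if v = u then 1 else 0 := by
  rw [braidMat, Matrix.of_apply]
  rfl

theorem exists_cons_cons {α : Type*} {n : ℕ} (v : Fin (n + 2) → α) :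
    ∃ a b v', v = Fin.cons a (Fin.cons b v' : Fin (n + 1) → α) :=
  ⟨v 0, v 1, Fin.tail (Fin.tail v), by
    have : v 1 = Fin.tail v 0 := rfl
    rw [this, Fin.cons_self_tail, Fin.cons_self_tail]⟩

theorem colBraid_zero (w : R) {n : ℕ} (y : Fin n → R) (y1 y2 : R) :
    ColBraid w (Fin.cons y1 (Fin.cons y2 y : Fin (n + 1) → R) : Fin (n + 2) → R)
      (Fin.cons y2 (Fin.cons y1 y : Fin (n + 1) → R) : Fin (n + 2) → R) (braidF w y1 y2)
      (braidMat w y1 y2 n) where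
  comm x a b := by
    ext v u
    obtain ⟨v1, v2, v, rfl⟩ := exists_cons_cons v
    obtain ⟨u1, u2, u, rfl⟩ := exists_cons_cons u
    simp only [Matrix.mul_apply, sum_cons, rowT_cons_cons, braidMat_cons]
    simp only [mul_ite, mul_one, mul_zero, ite_mul, zero_mul, Finset.sum_ite_eq,
      Finset.sum_ite_eq', Finset.mem_univ, if_true]
    trans ∑ k, (∑ h, ∑ m1, ∑ m2, vertexWt w x y1 a h v1 m1 * vertexWt w x y2 h k v2 m2 *
        braidWt w y1 y2 m2 m1 u2 u1) * rowT w x y k b v u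
    · simp only [Fintype.sum_bool]; ring
    · simp only [vertexWt_col]
      simp only [Fintype.sum_bool]; ring
  bot_bot := by
    rw [bot_cons, bot_cons, braidMat_cons, if_pos rfl, mul_one]; rfl
  top_top := by
    rw [top_cons, top_cons, braidMat_cons, if_pos rfl, mul_one]; rfl
  bot_ne u hu := by
    obtain ⟨u1, u2, u, rfl⟩ := exists_cons_cons u
    rw [bot_cons, bot_cons, Ne, Fin.cons_inj, Fin.cons_inj] at hu
    rw [bot_cons, bot_cons, braidMat_cons]
    by_cases h : bot = u
    · subst h
      cases u1 <;> cases u2 <;> simp_all [braidWt]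
    · rw [if_neg h, mul_zero]
  ne_top u hu := by
    obtain ⟨u1, u2, u, rfl⟩ := exists_cons_cons u
    rw [top_cons, top_cons, Ne, Fin.cons_inj, Fin.cons_inj] at hu
    rw [top_cons, top_cons, braidMat_cons]
    by_cases h : u = top
    · subst h
      cases u1 <;> cases u2 <;> simp_all [braidWt]
    · rw [if_neg h, mul_zero]

theorem exists_colBraid (w : R) {n : ℕ} (i : Fin n) (y : Fin (n + 1) → R) :
    ∃ P, ColBraid w y (y ∘ Equiv.swap i.castSucc i.succ)
      (braidF w (y i.castSucc) (y i.succ)) P := by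
  induction n with
  | zero => exact i.elim0
  | succ n ih =>
    refine Fin.cases ?_ (fun i => ?_) i
    · obtain ⟨y1, y2, y, rfl⟩ := exists_cons_cons y
      refine ⟨braidMat w y1 y2 n, ?_⟩
      have h : (Fin.cons y1 (Fin.cons y2 y : Fin (n + 1) → R) : Fin (n + 2) → R) ∘
          Equiv.swap (0 : Fin (n + 1)).castSucc (0 : Fin (n + 1)).succ =
          Fin.cons y2 (Fin.cons y1 y : Fin (n + 1) → R) := by
        ext j
        refine Fin.cases ?_ (fun j => ?_) j
        · simp
        · refine Fin.cases ?_ (fun j => ?_) j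
          · simp
          · have h1 : j.succ.succ ≠ (0 : Fin (n + 1)).castSucc := by simp [Fin.ext_iff]
            have h2 : j.succ.succ ≠ (0 : Fin (n + 1)).succ := by simp [Fin.ext_iff]
            rw [Function.comp_apply, Equiv.swap_apply_of_ne_of_ne h1 h2]
            simp
      rw [h]
      exact colBraid_zero w y y1 y2
    · obtain ⟨P, hP⟩ := ih i (Fin.tail y)
      refine ⟨consTensor 1 P, ?_⟩
      have h := hP.cons (y 0)
      rw [Fin.cons_self_tail] at h
      convert h using 1
      swap
      · rfl
      ext j
      refine Fin.cases ?_ (fun j => ?_) j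
      · have h1 : (0 : Fin (n + 2)) ≠ i.succ.castSucc := by simp [Fin.ext_iff]
        have h2 : (0 : Fin (n + 2)) ≠ i.succ.succ := by simp [Fin.ext_iff]
        rw [Function.comp_apply, Equiv.swap_apply_of_ne_of_ne h1 h2]
        simp
      · simp only [Function.comp_apply, Fin.cons_succ, Fin.tail]
        congr 1
        rw [Fin.castSucc_succ]
        exact (Fin.succ_injective _).swap_apply _ _ _

/-- An operator and its intertwined partner have proportional entries between the boundary
states. -/
theorem ColBraid.mul_entry {w : R} {m n : ℕ} {y y' : Fin n → R} {z z' : Fin m → R} {f g : R}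
    {P : Matrix (Fin n → Bool) (Fin n → Bool) R} {Q : Matrix (Fin m → Bool) (Fin m → Bool) R}
    (h : ColBraid w y y' f P) (h' : ColBraid w z z' g Q)
    {N N' : Matrix (Fin m → Bool) (Fin n → Bool) R} (hN : N * P = Q * N') :
    f * N bot top = g * N' bot top := by
  have e := congrFun (congrFun hN bot) top
  rw [Matrix.mul_apply, Matrix.mul_apply, Finset.sum_eq_single top, Finset.sum_eq_single bot,
    h.top_top, h'.bot_bot] at e
  · rw [mul_comm, e]
  · intro u _ hu; rw [h'.bot_ne u hu, zero_mul]
  · simp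
  · intro u _ hu; rw [h.ne_top u hu, mul_zero]
  · simp

theorem ColBraid.Zdw {w : R} {n : ℕ} {y y' : Fin n → R} {f : R}
    {P : Matrix (Fin n → Bool) (Fin n → Bool) R} (h : ColBraid w y y' f P) (xs : List R) :
    f * Zdw w xs y = f * Zdw w xs y' := by
  refine h.mul_entry h ?_
  induction xs with
  | nil => simp [dwProd]
  | cons x xs ih =>
    simp only [dwProd, List.map_cons, List.prod_cons] at ih ⊢
    rw [Matrix.mul_assoc, ih, ← Matrix.mul_assoc, h.comm, Matrix.mul_assoc]

theorem ColBraid.nest {w : R} {m n : ℕ} {y y' : Fin n → R} {z z' : Fin m → R} {f g : R}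
    {P : Matrix (Fin n → Bool) (Fin n → Bool) R} {Q : Matrix (Fin m → Bool) (Fin m → Bool) R}
    (h : ColBraid w y y' f P) (h' : ColBraid w z z' g Q)
    {B B' : Matrix (Fin m → Bool) (Fin n → Bool) R} (hB : B * P = Q * B') (xs : List R) :
    nest (fun x => rowT w x z) (fun x => rowT w x y) B xs * P =
      Q * nest (fun x => rowT w x z') (fun x => rowT w x y') B' xs := by
  induction xs with
  | nil => exact hB
  | cons x xs ih =>
    simp only [SixVertex.nest, Matrix.sum_mul, Matrix.mul_sum]
    refine Finset.sum_congr rfl fun ε _ => ?_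
    rw [Matrix.mul_assoc, h.comm, ← Matrix.mul_assoc, Matrix.mul_assoc _ _ P, ih,
      ← Matrix.mul_assoc, h'.comm, Matrix.mul_assoc, Matrix.mul_assoc, Matrix.mul_assoc]

theorem ColBraid.Zht {w : R} {n : ℕ} {y y' : Fin n → R} {f : R}
    {P : Matrix (Fin n → Bool) (Fin n → Bool) R} (h : ColBraid w y y' f P) (xs : List R) :
    f * Zht w xs y = f * Zht w xs y' :=
  h.mul_entry h (h.nest h (by simp) xs)

theorem ColBraid.oddBase {w : R} {n : ℕ} {y y' : Fin n → R} {f : R}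
    {P : Matrix (Fin n → Bool) (Fin n → Bool) R} (h : ColBraid w y y' f P) (p r z : R) :
    oddBase w p r z y * P = snocTensor P * oddBase w p r z y' := by
  ext v u
  have hc := fun b v u => congrFun (congrFun (h.comm z false b) v) u
  simp only [Matrix.mul_apply] at hc
  rw [← Fin.snoc_init_self v]
  generalize Fin.init v = v', v (Fin.last n) = s
  simp only [Matrix.mul_apply, sum_snoc, snocTensor_snoc, SixVertex.oddBase, Matrix.of_apply,
    Fin.snoc_last, Fin.init_snoc]
  simp only [mul_ite, mul_one, mul_zero, ite_mul, zero_mul, Finset.sum_ite_eq,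
    Finset.sum_ite_eq', Finset.mem_univ, if_true]
  cases s
  · simp only [cond_false, mul_assoc, ← Finset.mul_sum, hc, mul_left_comm _ p]
  · simp only [cond_true, mul_assoc, ← Finset.mul_sum, hc, mul_left_comm _ r]

theorem ColBraid.Zodd {w : R} {n : ℕ} {y y' : Fin n → R} {f : R}
    {P : Matrix (Fin n → Bool) (Fin n → Bool) R} (h : ColBraid w y y' f P) (p r z z' : R)
    (xs : List R) : f * Zodd w p r z z' xs y = f * Zodd w p r z z' xs y' :=
  h.mul_entry (h.snoc z') (h.nest (h.snoc z') (h.oddBase p r z) xs)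

end ColumnSymmetry

/-! ### Symmetry in the column parameters -/

section ColumnPermutation
variable {K : Type*} [Field K]
open Polynomial

theorem comp_perm_eq_of_swap {α β : Type*} {n : ℕ} (G : (Fin (n + 1) → α) → β)
    (h : ∀ (i : Fin n) (y : Fin (n + 1) → α), G (y ∘ Equiv.swap i.castSucc i.succ) = G y)
    (σ : Equiv.Perm (Fin (n + 1))) (y : Fin (n + 1) → α) : G (y ∘ σ) = G y := by
  have hσ : σ ∈ Submonoid.closure
      (Set.range fun i : Fin n => Equiv.swap i.castSucc i.succ) := by
    rw [Equiv.Perm.mclosure_swap_castSucc_succ]; trivial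
  induction hσ using Submonoid.closure_induction generalizing y with
  | mem σ hm => obtain ⟨i, rfl⟩ := hm; exact h i y
  | one => rfl
  | mul a b _ _ ha hb =>
    rw [Equiv.Perm.coe_mul, ← Function.comp_assoc, hb, ha]

/-- A function of the column variables that is unchanged, up to a factor `f`, whenever two
neighbouring columns are exchanged by an intertwiner is a symmetric function: `f` is cancelled
over the polynomial ring, where it is nonzero. -/
theorem symmetric_of_colBraid (w : K) {n : ℕ} (G : (Fin n → K) → K) (G' : (Fin n → K[X]) → K[X])
    (hmap : ∀ a Y, evalRingHom a (G' Y) = G (evalRingHom a ∘ Y))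
    (hG : ∀ Y Y' f P, ColBraid (C w) Y Y' f P → f * G' Y = f * G' Y')
    (σ : Equiv.Perm (Fin n)) (y : Fin n → K) : G (y ∘ σ) = G y := by
  obtain _ | n := n
  · congr 1; exact Subsingleton.elim _ _
  have key : ∀ (i : Fin n) (y : Fin (n + 1) → K),
      G (y ∘ Equiv.swap i.castSucc i.succ) = G y := by
    intro i y
    -- One of the two column variables becomes an indeterminate, to be evaluated at the end.
    set Y : Fin (n + 1) → K[X] := fun j => if j = i.succ then X else C (y j) with hY
    have hne : i.castSucc ≠ i.succ := by simp [Fin.ext_iff]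
    obtain ⟨P, hP⟩ := exists_colBraid (C w) i Y
    have h := hG _ _ _ _ hP
    have h1 : Y i.castSucc = C (y i.castSucc) := if_neg hne
    have h2 : Y i.succ = X := if_pos rfl
    rw [h1, h2] at h
    have h3 := congrArg (evalRingHom (y i.succ))
      (mul_left_cancel₀ (braidF_C_X_ne_zero w (y i.castSucc)) h)
    rw [hmap, hmap] at h3
    have h4 : (evalRingHom (y i.succ)) ∘ Y = y := by
      ext j
      simp only [Function.comp_apply, hY]
      split_ifs with hj
      · simp [hj]
      · simp
    rw [← Function.comp_assoc, h4] at h3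
    exact h3.symm
  exact comp_perm_eq_of_swap G key σ y

theorem map_eval_map_C (a : K) (xs : List K) : (xs.map C).map (evalRingHom a) = xs := by
  rw [List.map_map]; convert List.map_id xs using 2; ext; simp

theorem Zdw_comp_perm (w : K) (xs : List K) {n : ℕ} (y : Fin n → K) (σ : Equiv.Perm (Fin n)) :
    Zdw w xs (y ∘ σ) = Zdw w xs y := by
  refine symmetric_of_colBraid w (Zdw w xs) (Zdw (C w) (xs.map C)) (fun a Y => ?_)
    (fun _ _ _ _ h => h.Zdw _) σ y
  rw [Zdw_map, map_eval_map_C]; simp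

theorem Zdw_snoc_comp_perm (w : K) (xs : List K) {n : ℕ} (y : Fin n → K) (z : K)
    (σ : Equiv.Perm (Fin n)) :
    Zdw w xs (Fin.snoc (y ∘ σ) z : Fin (n + 1) → K) =
      Zdw w xs (Fin.snoc y z : Fin (n + 1) → K) := by
  refine symmetric_of_colBraid w (fun y => Zdw w xs (Fin.snoc y z : Fin (n + 1) → K))
    (fun Y => Zdw (C w) (xs.map C) (Fin.snoc Y (C z) : Fin (n + 1) → K[X])) (fun a Y => ?_)
    (fun _ _ _ _ h => (h.snoc _).Zdw _) σ y
  rw [Zdw_map, map_eval_map_C, comp_snoc]; simp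

theorem Zht_comp_perm (w : K) (xs : List K) {n : ℕ} (y : Fin n → K) (σ : Equiv.Perm (Fin n)) :
    Zht w xs (y ∘ σ) = Zht w xs y := by
  refine symmetric_of_colBraid w (Zht w xs) (Zht (C w) (xs.map C)) (fun a Y => ?_)
    (fun _ _ _ _ h => h.Zht _) σ y
  rw [Zht_map, map_eval_map_C]; simp

theorem Zodd_comp_perm (w p r z z' : K) (xs : List K) {n : ℕ} (y : Fin n → K)
    (σ : Equiv.Perm (Fin n)) : Zodd w p r z z' xs (y ∘ σ) = Zodd w p r z z' xs y := by
  refine symmetric_of_colBraid w (Zodd w p r z z' xs)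
    (Zodd (C w) (C p) (C r) (C z) (C z') (xs.map C)) (fun a Y => ?_)
    (fun _ _ _ _ h => h.Zodd _ _ _ _ _) σ y
  rw [Zodd_map, map_eval_map_C]; simp

end ColumnPermutation

/-! ### Freezing of a corner vertex -/

section Freezing
variable {R : Type*} [CommRing R]

/-- The weight of a vertex whose horizontal edges are empty and whose vertical edges are both in
state `b`. -/
def wtB (w : R) (b : Bool) (x y : R) : R := bif b then wtN w x y else wtE w x y

theorem rowT_true_bot (w x : R) {n : ℕ} (y : Fin n → R) (b : Bool) (u : Fin n → Bool) :
    rowT w x y true b bot u = if b = true ∧ u = bot then ∏ k, wtB w true x (y k) else 0 := by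
  induction n with
  | zero => cases b <;> simp [rowT_zero, Subsingleton.elim u bot]
  | succ n ih =>
    rw [← Fin.cons_self_tail u]
    generalize u 0 = a, Fin.tail u = u'
    rw [rowT_apply_succ, bot_cons, Fin.cons_zero, Fin.tail_cons, Fin.cons_zero, Fin.tail_cons,
      Fin.prod_univ_succ]
    simp only [Fin.cons_inj, Fintype.sum_bool, ih, Fin.tail]
    cases a <;> simp [vertexWt, wtB, Fin.tail]

theorem rowT_true_top (w x : R) {n : ℕ} (y : Fin n → R) (b : Bool) (v : Fin n → Bool) :
    rowT w x y true b v top = if b = true ∧ v = top then ∏ k, wtB w false x (y k) else 0 := by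
  induction n with
  | zero => cases b <;> simp [rowT_zero, Subsingleton.elim v top]
  | succ n ih =>
    rw [← Fin.cons_self_tail v]
    generalize v 0 = a, Fin.tail v = v'
    rw [rowT_apply_succ, top_cons, Fin.cons_zero, Fin.tail_cons, Fin.cons_zero, Fin.tail_cons,
      Fin.prod_univ_succ]
    simp only [Fin.cons_inj, Fintype.sum_bool, ih, Fin.tail]
    cases a <;> simp [vertexWt, wtB, Fin.tail]

theorem rowT_false_false_bot (w x : R) {n : ℕ} (y : Fin n → R) (u : Fin n → Bool) :
    rowT w x y false false bot u = if u = bot then ∏ k, wtB w false x (y k) else 0 := by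
  induction n with
  | zero => simp [rowT_zero, Subsingleton.elim u bot]
  | succ n ih =>
    rw [← Fin.cons_self_tail u]
    generalize u 0 = a, Fin.tail u = u'
    rw [rowT_apply_succ, bot_cons, Fin.cons_zero, Fin.tail_cons, Fin.cons_zero, Fin.tail_cons,
      Fin.prod_univ_succ]
    simp only [Fin.cons_inj, Fintype.sum_bool, ih, rowT_true_bot, Fin.tail]
    cases a <;> simp [vertexWt, wtB, Fin.tail]

theorem rowT_false_false_top (w x : R) {n : ℕ} (y : Fin n → R) (v : Fin n → Bool) :
    rowT w x y false false v top = if v = top then ∏ k, wtB w true x (y k) else 0 := by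
  induction n with
  | zero => simp [rowT_zero, Subsingleton.elim v top]
  | succ n ih =>
    rw [← Fin.cons_self_tail v]
    generalize v 0 = a, Fin.tail v = v'
    rw [rowT_apply_succ, top_cons, Fin.cons_zero, Fin.tail_cons, Fin.cons_zero, Fin.tail_cons,
      Fin.prod_univ_succ]
    simp only [Fin.cons_inj, Fintype.sum_bool, ih, rowT_true_top, Fin.tail]
    cases a <;> simp [vertexWt, wtB, Fin.tail]

theorem rowT_bot_of_wtE_eq_zero {w x y1 : R} (h : wtB w false x y1 = 0) {n : ℕ} (y : Fin n → R)
    (b : Bool) (u : Fin (n + 1) → Bool) :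
    rowT w x (Fin.cons y1 y : Fin (n + 1) → R) false b bot u =
      if b = true ∧ u = Fin.cons true (bot : Fin n → Bool) then ∏ k, wtB w true x (y k) else 0 := by
  rw [← Fin.cons_self_tail u]
  generalize u 0 = a, Fin.tail u = u'
  rw [rowT_apply_succ, bot_cons, Fin.cons_zero, Fin.tail_cons, Fin.cons_zero, Fin.tail_cons,
    Fin.cons_zero, Fin.tail_cons]
  simp only [Fin.cons_inj, Fintype.sum_bool, rowT_true_bot]
  simp only [wtB, cond_false] at h
  cases a <;> simp [vertexWt, wtB, h]

theorem rowT_top_of_wtN_eq_zero {w x y1 : R} (h : wtB w true x y1 = 0) {n : ℕ} (y : Fin n → R)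
    (b : Bool) (v : Fin (n + 1) → Bool) :
    rowT w x (Fin.cons y1 y : Fin (n + 1) → R) false b v top =
      if b = true ∧ v = Fin.cons false (top : Fin n → Bool) then ∏ k, wtB w false x (y k)
      else 0 := by
  rw [← Fin.cons_self_tail v]
  generalize v 0 = a, Fin.tail v = v'
  rw [rowT_apply_succ, top_cons, Fin.cons_zero, Fin.tail_cons, Fin.cons_zero, Fin.tail_cons,
    Fin.cons_zero, Fin.tail_cons]
  simp only [Fin.cons_inj, Fintype.sum_bool, rowT_true_top]
  simp only [wtB, cond_true] at h
  cases a <;> simp [vertexWt, wtB, h]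

/-- On the configurations with first column in state `b`, the matrix `M` acts as `c • M'` on the
remaining columns; the first column cannot pass from `true` to `false`. -/
def FrozenCol (b : Bool) {m n : ℕ} (M : Matrix (Fin (m + 1) → Bool) (Fin (n + 1) → Bool) R) (c : R)
    (M' : Matrix (Fin m → Bool) (Fin n → Bool) R) : Prop :=
  ∀ (v : Fin m → Bool) (u : Fin n → Bool),
    M (Fin.cons b v : Fin (m + 1) → Bool) (Fin.cons b u : Fin (n + 1) → Bool) = c * M' v u ∧
    M (Fin.cons true v : Fin (m + 1) → Bool) (Fin.cons false u : Fin (n + 1) → Bool) = 0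

theorem FrozenCol.mul {b : Bool} {l m n : ℕ}
    {M : Matrix (Fin (l + 1) → Bool) (Fin (m + 1) → Bool) R} {c : R}
    {M' : Matrix (Fin l → Bool) (Fin m → Bool) R} (hM : FrozenCol b M c M')
    {N : Matrix (Fin (m + 1) → Bool) (Fin (n + 1) → Bool) R} {d : R}
    {N' : Matrix (Fin m → Bool) (Fin n → Bool) R} (hN : FrozenCol b N d N') :
    FrozenCol b (M * N) (c * d) (M' * N') := by
  have hM0 := fun v u => (hM v u).2
  have hN0 := fun v u => (hN v u).2
  have hM1 := fun v u => (hM v u).1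
  have hN1 := fun v u => (hN v u).1
  intro v u
  simp only [Matrix.mul_apply, sum_cons, Fintype.sum_bool]
  constructor
  · cases b
    · simp only [hM1, hN1, hN0, mul_zero, Finset.sum_const_zero, zero_add, Finset.mul_sum]
      exact Finset.sum_congr rfl fun _ _ => by ring
    · simp only [hM1, hN1, hM0, zero_mul, Finset.sum_const_zero, add_zero, Finset.mul_sum]
      exact Finset.sum_congr rfl fun _ _ => by ring
  · simp only [hM0, hN0, mul_zero, zero_mul, Finset.sum_const_zero, add_zero]

theorem FrozenCol.add {b : Bool} {m n : ℕ}
    {M : Matrix (Fin (m + 1) → Bool) (Fin (n + 1) → Bool) R} {c : R}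
    {M' : Matrix (Fin m → Bool) (Fin n → Bool) R} (hM : FrozenCol b M c M')
    {N : Matrix (Fin (m + 1) → Bool) (Fin (n + 1) → Bool) R}
    {N' : Matrix (Fin m → Bool) (Fin n → Bool) R} (hN : FrozenCol b N c N') :
    FrozenCol b (M + N) c (M' + N') := by
  intro v u
  simp only [Matrix.add_apply, (hM v u).1, (hN v u).1, (hM v u).2, (hN v u).2, mul_add, add_zero,
    and_self]

theorem frozenCol_one (b : Bool) (n : ℕ) :
    FrozenCol b (1 : Matrix (Fin (n + 1) → Bool) (Fin (n + 1) → Bool) R) 1 1 := by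
  intro v u
  simp [Matrix.one_apply, Fin.cons_inj]

theorem frozenCol_rowT (b : Bool) (w x y1 : R) {n : ℕ} (y : Fin n → R) (a : Bool) :
    FrozenCol b (rowT w x (Fin.cons y1 y : Fin (n + 1) → R) false a) (wtB w b x y1)
      (rowT w x y false a) := by
  intro v u
  simp only [rowT_apply_succ, Fin.cons_zero, Fin.tail_cons, Fintype.sum_bool]
  cases b <;> simp [vertexWt, wtB]

theorem frozenCol_dwProd (b : Bool) (w y1 : R) {n : ℕ} (y : Fin n → R) (xs : List R) :
    FrozenCol b (dwProd w (Fin.cons y1 y : Fin (n + 1) → R) xs)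
      (xs.map fun x => wtB w b x y1).prod (dwProd w y xs) := by
  induction xs with
  | nil => exact frozenCol_one b n
  | cons x xs ih =>
    simp only [dwProd, List.map_cons, List.prod_cons] at ih ⊢
    exact FrozenCol.mul (frozenCol_rowT b w x y1 y true) ih

theorem frozenCol_nest (b : Bool) (w y1 : R) {m n : ℕ} (z : Fin m → R) (y : Fin n → R)
    {B : Matrix (Fin (m + 1) → Bool) (Fin (n + 1) → Bool) R} {c : R}
    {B' : Matrix (Fin m → Bool) (Fin n → Bool) R} (hB : FrozenCol b B c B') (xs : List R) :
    FrozenCol b (nest (fun x => rowT w x (Fin.cons y1 z : Fin (m + 1) → R))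
      (fun x => rowT w x (Fin.cons y1 y : Fin (n + 1) → R)) B xs)
      ((xs.map fun x => wtB w b x y1 ^ 2).prod * c)
      (nest (fun x => rowT w x z) (fun x => rowT w x y) B' xs) := by
  induction xs with
  | nil => simpa [nest] using hB
  | cons x xs ih =>
    simp only [nest, Fintype.sum_bool, List.map_cons, List.prod_cons]
    have h := fun a a' =>
      ((show FrozenCol b _ _ _ from frozenCol_rowT b w x y1 z a).mul ih).mul
        (show FrozenCol b _ _ _ from frozenCol_rowT b w x y1 y a')
    have e : ∀ q : R, wtB w b x y1 ^ 2 * q * c = wtB w b x y1 * (q * c) * wtB w b x y1 := by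
      intro q; ring
    rw [e]
    exact (h true false).add (h false true)

theorem frozenCol_oddBase (b : Bool) (w p r z y1 : R) {n : ℕ} (y : Fin n → R) :
    FrozenCol b (oddBase w p r z (Fin.cons y1 y : Fin (n + 1) → R)) (wtB w b z y1)
      (oddBase w p r z y) := by
  intro v u
  have h := fun a v u => frozenCol_rowT b w z y1 y a v u
  have hl : ∀ a, (Fin.cons a v : Fin (n + 2) → Bool) (Fin.last (n + 1)) = v (Fin.last n) := by
    intro a; rw [← Fin.succ_last, Fin.cons_succ]
  have hi : ∀ a, Fin.init (Fin.cons a v : Fin (n + 2) → Bool) =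
      (Fin.cons a (Fin.init v) : Fin (n + 1) → Bool) := by
    intro a; ext i; refine Fin.cases ?_ (fun i => ?_) i
    · rfl
    · simp [Fin.init, ← Fin.succ_castSucc]
  simp only [oddBase, Matrix.of_apply, hl, hi, (h _ _ _).1, (h _ _ _).2]
  cases v (Fin.last n) <;> simp [mul_left_comm]

/-- If the weight of one kind of entry `0` vanishes at the vertex of the first column and the
outermost row, that row is frozen and forces the first column to be constant. -/
theorem nest_eq_of_wtB_eq_zero (b : Bool) {w x y1 : R} (h : wtB w (!b) x y1 = 0) {m n : ℕ}
    (z : Fin m → R) (y : Fin n → R) {B : Matrix (Fin (m + 1) → Bool) (Fin (n + 1) → Bool) R}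
    {c : R} {B' : Matrix (Fin m → Bool) (Fin n → Bool) R} (hB : FrozenCol b B c B')
    (xs : List R) :
    nest (fun x => rowT w x (Fin.cons y1 z : Fin (m + 1) → R))
      (fun x => rowT w x (Fin.cons y1 y : Fin (n + 1) → R)) B (x :: xs) bot top =
    wtB w b x y1 * (∏ k, wtB w b x (z k)) * (∏ k, wtB w b x (y k)) *
      ((xs.map fun x => wtB w b x y1 ^ 2).prod * c) *
      nest (fun x => rowT w x z) (fun x => rowT w x y) B' xs bot top := by
  have hN := frozenCol_nest b w y1 z y hB xs
  simp only [nest, Fintype.sum_bool, Matrix.add_apply, Matrix.mul_apply, Bool.not_true,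
    Bool.not_false]
  cases b
  · simp only [rowT_top_of_wtN_eq_zero h, rowT_false_false_bot]
    have := (hN bot top).1
    rw [← bot_cons] at this
    simp [this, Fin.prod_univ_succ]
    ring
  · simp only [rowT_bot_of_wtE_eq_zero h, rowT_false_false_top]
    have := (hN bot top).1
    rw [← top_cons] at this
    simp [this, Fin.prod_univ_succ]
    ring

theorem Zht_eq_of_wtB_eq_zero (b : Bool) {w x y1 : R} (h : wtB w (!b) x y1 = 0) {n : ℕ}
    (y : Fin n → R) (xs : List R) :
    Zht w (x :: xs) (Fin.cons y1 y : Fin (n + 1) → R) =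
      wtB w b x y1 * (∏ k, wtB w b x (y k)) ^ 2 * (xs.map fun x => wtB w b x y1 ^ 2).prod *
        Zht w xs y := by
  rw [Zht, nest_eq_of_wtB_eq_zero b h y y (frozenCol_one b n), Zht]
  ring

theorem Zodd_eq_of_wtB_eq_zero (b : Bool) {w x y1 : R} (h : wtB w (!b) x y1 = 0) (p r z z' : R)
    {n : ℕ} (y : Fin n → R) (xs : List R) :
    Zodd w p r z z' (x :: xs) (Fin.cons y1 y : Fin (n + 1) → R) =
      wtB w b x z' * wtB w b z y1 *
      (wtB w b x y1 * (∏ k, wtB w b x (y k)) ^ 2 * (xs.map fun x => wtB w b x y1 ^ 2).prod) *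
        Zodd w p r z z' xs y := by
  have := nest_eq_of_wtB_eq_zero b h (Fin.snoc y z' : Fin (n + 1) → R) y
    (frozenCol_oddBase b w p r z y1 y) xs
  rw [Fin.cons_snoc_eq_snoc_cons] at this
  rw [Zodd, this, Zodd, Fin.prod_univ_castSucc]
  simp only [Fin.snoc_castSucc, Fin.snoc_last]
  ring

end Freezing

/-! ### Freezing with domain wall boundary -/

section FreezingDW
variable {K : Type*} [Field K]

theorem Zdw_perm (w : K) {n : ℕ} (y : Fin n → K) {xs xs' : List K} (h : xs.Perm xs') :
    Zdw w xs y = Zdw w xs' y := by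
  rw [Zdw, dwProd_perm w y h, Zdw]

/-- The row with parameter `x` freezes at the bottom if `b = false`, where it is moved by the
symmetry in the row parameters, and at the top if `b = true`. -/
theorem Zdw_eq_of_wtB_eq_zero (b : Bool) {w x y1 : K} (h : wtB w (!b) x y1 = 0) {n : ℕ}
    (y : Fin n → K) (xs : List K) :
    Zdw w (x :: xs) (Fin.cons y1 y : Fin (n + 1) → K) =
      (∏ k, wtB w b x (y k)) * (xs.map fun x => wtB w b x y1).prod * Zdw w xs y := by
  have hN := (frozenCol_dwProd b w y1 y xs bot top).1
  cases b
  · rw [← bot_cons] at hN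
    rw [Zdw_perm w _ (List.perm_append_singleton x xs).symm]
    simp only [Zdw, dwProd, List.map_append, List.prod_append, List.map_cons, List.map_nil,
      List.prod_cons, List.prod_nil, mul_one]
    rw [Matrix.mul_apply]
    simp only [rowT_top_of_wtN_eq_zero h]
    simp only [dwProd] at hN
    simp [hN]
    ring
  · rw [← top_cons] at hN
    simp only [Zdw, dwProd, List.map_cons, List.prod_cons] at hN ⊢
    rw [Matrix.mul_apply]
    simp only [rowT_bot_of_wtE_eq_zero h]
    simp [hN, mul_assoc]

end FreezingDW

/-! ### Degrees in a column parameter -/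

section PolynomialDegree
variable {K : Type*} [Field K]
open Polynomial

/-- `f` is a polynomial function of degree at most `d`; for negative `d` this means `f = 0`. -/
def IsPolyDeg (d : ℤ) (f : K → K) : Prop :=
  ∃ p : K[X], (∀ a, f a = p.eval a) ∧ ∀ k : ℕ, d < k → p.coeff k = 0

theorem IsPolyDeg.mono {d d' : ℤ} {f : K → K} (h : IsPolyDeg d f) (hd : d ≤ d') :
    IsPolyDeg d' f := by
  obtain ⟨p, hp, hc⟩ := h
  exact ⟨p, hp, fun k hk => hc k (by omega)⟩

theorem isPolyDeg_zero (d : ℤ) : IsPolyDeg d fun _ : K => 0 := ⟨0, by simp, by simp⟩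

theorem isPolyDeg_linear (a b : K) : IsPolyDeg 1 fun x => a + b * x := by
  refine ⟨C a + C b * X, by simp, fun k hk => ?_⟩
  have h0 : k ≠ 0 := by rintro rfl; simp at hk
  have h1 : 1 ≠ k := by rintro rfl; simp at hk
  simp [coeff_X, coeff_C, h0, h1]

theorem isPolyDeg_const (a : K) : IsPolyDeg 0 fun _ => a := by
  refine ⟨C a, by simp, fun k hk => ?_⟩
  have h0 : k ≠ 0 := by rintro rfl; simp at hk
  simp [coeff_C, h0]

theorem IsPolyDeg.add {d : ℤ} {f g : K → K} (hf : IsPolyDeg d f) (hg : IsPolyDeg d g) :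
    IsPolyDeg d fun a => f a + g a := by
  obtain ⟨p, hp, hc⟩ := hf
  obtain ⟨q, hq, hd⟩ := hg
  exact ⟨p + q, fun a => by simp [hp, hq], fun k hk => by simp [hc k hk, hd k hk]⟩

theorem IsPolyDeg.mul {d e : ℤ} {f g : K → K} (hf : IsPolyDeg d f) (hg : IsPolyDeg e g) :
    IsPolyDeg (d + e) fun a => f a * g a := by
  obtain ⟨p, hp, hc⟩ := hf
  obtain ⟨q, hq, hd⟩ := hg
  refine ⟨p * q, fun a => by simp [hp, hq], fun k hk => ?_⟩
  rw [coeff_mul]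
  refine Finset.sum_eq_zero fun ij hij => ?_
  rw [Finset.HasAntidiagonal.mem_antidiagonal] at hij
  by_cases h : d < ij.1
  · rw [hc _ h, zero_mul]
  · rw [hd _ (by omega), mul_zero]

theorem IsPolyDeg.const_mul {d : ℤ} {f : K → K} (hf : IsPolyDeg d f) (c : K) :
    IsPolyDeg d fun a => c * f a := by
  simpa using (isPolyDeg_const c).mul hf

theorem IsPolyDeg.mul_const {d : ℤ} {f : K → K} (hf : IsPolyDeg d f) (c : K) :
    IsPolyDeg d fun a => f a * c := by
  simpa using hf.mul (isPolyDeg_const c)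

theorem IsPolyDeg.sub {d : ℤ} {f g : K → K} (hf : IsPolyDeg d f) (hg : IsPolyDeg d g) :
    IsPolyDeg d fun a => f a - g a := by
  simpa [sub_eq_add_neg] using hf.add (hg.const_mul (-1))

theorem IsPolyDeg.sum {ι : Type*} (s : Finset ι) {d : ℤ} {f : ι → K → K}
    (hf : ∀ i ∈ s, IsPolyDeg d (f i)) : IsPolyDeg d fun a => ∑ i ∈ s, f i a := by
  classical
  induction s using Finset.induction_on with
  | empty => simpa using isPolyDeg_zero d
  | insert i s hi ih =>
    simp only [Finset.sum_insert hi]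
    exact (hf i (by simp)).add (ih fun j hj => hf j (by simp [hj]))

theorem IsPolyDeg.prod {ι : Type*} (s : Finset ι) {d : ℤ} {f : ι → K → K}
    (hf : ∀ i ∈ s, IsPolyDeg d (f i)) : IsPolyDeg (s.card * d) fun a => ∏ i ∈ s, f i a := by
  classical
  induction s using Finset.induction_on with
  | empty => simpa using isPolyDeg_const 1
  | insert i s hi ih =>
    simp only [Finset.prod_insert hi, Finset.card_insert_of_notMem hi]
    refine ((hf i (by simp)).mul (ih fun j hj => hf j (by simp [hj]))).mono (le_of_eq ?_)
    push_cast; ring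

theorem IsPolyDeg.pow {d : ℤ} {f : K → K} (hf : IsPolyDeg d f) (n : ℕ) :
    IsPolyDeg (n * d) fun a => f a ^ n := by
  simpa using IsPolyDeg.prod (Finset.range n) (f := fun _ => f) fun _ _ => hf

/-- A polynomial function with more zeros than its degree vanishes. -/
theorem IsPolyDeg.eq_zero {d : ℤ} {f : K → K} (hf : IsPolyDeg d f) {ι : Type*} [Fintype ι]
    {r : ι → K} (hr : Function.Injective r) (h0 : ∀ i, f (r i) = 0)
    (hd : d < Fintype.card ι) (a : K) : f a = 0 := by
  obtain ⟨p, hp, hc⟩ := hf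
  have : p = 0 := by
    by_contra hne
    refine hne (eq_zero_of_natDegree_lt_card_of_eval_eq_zero p hr (fun i => ?_) ?_)
    · rw [← hp, h0]
    · by_contra hlt
      exact hne (leadingCoeff_eq_zero.1 (hc p.natDegree (by omega)))
  rw [hp, this, eval_zero]

theorem isPolyDeg_det {n : ℕ} {M : K → Matrix (Fin n) (Fin n) K} {d : ℤ}
    (hM : ∀ i j, IsPolyDeg d fun a => M a i j) : IsPolyDeg (n * d) fun a => (M a).det := by
  simp only [Matrix.det_apply']
  refine IsPolyDeg.sum _ fun σ _ => IsPolyDeg.const_mul ?_ _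
  simpa using IsPolyDeg.prod Finset.univ fun i _ => hM (σ i) i

/-- The vertical states of the first column change the degree of an entry in the first column
variable. -/
def bitDeg (b : Bool) : ℤ := bif b then 1 else 0

/-- The entry `(v, u)` has degree at most `N` plus the state of `v` minus the state of `u` in the
first column. -/
def MatDeg (N : ℤ) {m n : ℕ} (M : K → Matrix (Fin (m + 1) → Bool) (Fin (n + 1) → Bool) K) : Prop :=
  ∀ v u, IsPolyDeg (N + bitDeg (v 0) - bitDeg (u 0)) fun a => M a v u

theorem MatDeg.mul {N N' : ℤ} {l m n : ℕ}
    {A : K → Matrix (Fin (l + 1) → Bool) (Fin (m + 1) → Bool) K}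
    {B : K → Matrix (Fin (m + 1) → Bool) (Fin (n + 1) → Bool) K}
    (hA : MatDeg N A) (hB : MatDeg N' B) : MatDeg (N + N') fun a => A a * B a := by
  intro v u
  simp only [Matrix.mul_apply]
  refine IsPolyDeg.sum _ fun k _ => ((hA v k).mul (hB k u)).mono (le_of_eq ?_)
  ring

theorem MatDeg.add {N : ℤ} {m n : ℕ}
    {A B : K → Matrix (Fin (m + 1) → Bool) (Fin (n + 1) → Bool) K}
    (hA : MatDeg N A) (hB : MatDeg N B) : MatDeg N fun a => A a + B a :=
  fun v u => (hA v u).add (hB v u)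

theorem matDeg_one (n : ℕ) :
    MatDeg 0 fun _ : K => (1 : Matrix (Fin (n + 1) → Bool) (Fin (n + 1) → Bool) K) := by
  intro v u
  by_cases h : v = u
  · subst h; simpa using isPolyDeg_const (1 : K)
  · simpa [Matrix.one_apply_ne h] using isPolyDeg_zero _

theorem matDeg_rowT (w x : K) {n : ℕ} (y : Fin n → K) (b : Bool) :
    MatDeg 1 fun a => rowT w x (Fin.cons a y : Fin (n + 1) → K) false b := by
  intro v u
  have he : IsPolyDeg 1 fun a => wtE w x a := by
    convert isPolyDeg_linear (1 - x) (w - 1 + x) using 2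
    simp only [wtE]; ring
  have hn : IsPolyDeg 1 fun a => wtN w x a := by
    convert isPolyDeg_linear (1 + (w - 1) * x) (x - 1) using 2
    simp only [wtN]; ring
  simp only [rowT_apply_succ, Fin.cons_zero, Fin.tail_cons, Fintype.sum_bool]
  generalize v 0 = s, u 0 = t
  cases s <;> cases t <;>
    simp only [vertexWt, zero_mul, zero_add, add_zero, one_mul, bitDeg, cond_false, cond_true]
  · exact he.mul_const _
  · exact (isPolyDeg_const _).mono (by simp)
  · exact isPolyDeg_zero _
  · exact (hn.mul_const _).mono (by simp)

theorem isPolyDeg_Zdw (w : K) (xs : List K) {n : ℕ} (y : Fin n → K) :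
    IsPolyDeg (xs.length - 1) fun a => Zdw w xs (Fin.cons a y : Fin (n + 1) → K) := by
  have h : MatDeg xs.length fun a => dwProd w (Fin.cons a y : Fin (n + 1) → K) xs := by
    induction xs with
    | nil => exact matDeg_one n
    | cons x xs ih =>
      have := (matDeg_rowT w x y true).mul ih
      simp only [dwProd, List.map_cons, List.prod_cons, List.length_cons] at this ⊢
      convert this using 1
      push_cast; ring
  simpa [bitDeg, Zdw] using h bot top

theorem matDeg_nest (w : K) {m n : ℕ} (z : Fin m → K) (y : Fin n → K)
    {B : K → Matrix (Fin (m + 1) → Bool) (Fin (n + 1) → Bool) K} {d : ℤ} (hB : MatDeg d B)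
    (xs : List K) :
    MatDeg (2 * xs.length + d) fun a => nest (fun x => rowT w x (Fin.cons a z : Fin (m + 1) → K))
      (fun x => rowT w x (Fin.cons a y : Fin (n + 1) → K)) (B a) xs := by
  induction xs with
  | nil => simpa [nest] using hB
  | cons x xs ih =>
    simp only [nest, Fintype.sum_bool, Bool.not_true, Bool.not_false]
    have h := fun b b' => ((matDeg_rowT w x z b).mul ih).mul (matDeg_rowT w x y b')
    convert (h true false).add (h false true) using 1
    simp only [List.length_cons]
    push_cast; ring

theorem isPolyDeg_Zht (w : K) (xs : List K) {n : ℕ} (y : Fin n → K) :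
    IsPolyDeg (2 * xs.length - 1) fun a => Zht w xs (Fin.cons a y : Fin (n + 1) → K) := by
  simpa [bitDeg, Zht] using matDeg_nest w y y (matDeg_one n) xs bot top

theorem isPolyDeg_Zodd (w p r z z' : K) (xs : List K) {n : ℕ} (y : Fin n → K) :
    IsPolyDeg (2 * xs.length) fun a => Zodd w p r z z' xs (Fin.cons a y : Fin (n + 1) → K) := by
  have hB : MatDeg 1 fun a => oddBase w p r z (Fin.cons a y : Fin (n + 1) → K) := by
    intro v u
    simp only [oddBase, Matrix.of_apply]
    cases v (Fin.last (n + 1))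
    · exact (matDeg_rowT w z y false (Fin.init v) u).const_mul p
    · exact (matDeg_rowT w z y true (Fin.init v) u).const_mul r
  have := matDeg_nest w (Fin.snoc y z' : Fin (n + 1) → K) y hB xs bot top
  simp only [Fin.cons_snoc_eq_snoc_cons] at this
  simpa [bitDeg, Zodd] using this

end PolynomialDegree

/-! ### The determinant of even order -/

section Newton
variable {R : Type*} [CommRing R]

/-- The first entry of a row of the determinant; it is symmetric in `y`. -/
def newtonHead (w : R) {n : ℕ} (y : Fin (n + 1) → R) (x : R) : R :=
  (1 - x) ^ n * ∏ k, wtE w x (y k) + (-(w - 1 + x)) ^ n * ∏ k, wtN w x (y k)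

/-- The row with parameter `x` of the determinant. Its `j`-th entry is the product of `wtE * wtN`
over the first `j` columns times `newtonHead` of the other columns, a Newton-type basis. -/
def newtonRow (w : R) : {n : ℕ} → (Fin n → R) → R → Fin n → R
  | 0, _, _ => Fin.elim0
  | _ + 1, y, x => Fin.cons (newtonHead w y x)
      fun j => wtE w x (y 0) * wtN w x (y 0) * newtonRow w (Fin.tail y) x j

/-- The determinant that, divided by a Vandermonde determinant, gives the quotient of the partition
functions `Zht` and `Zdw`. -/
def newtonDet (w : R) {n : ℕ} (X y : Fin n → R) : R :=
  (Matrix.of fun i j => newtonRow w y (X i) j).det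

theorem newtonDet_succ (w : R) {n : ℕ} (X y : Fin (n + 1) → R) :
    newtonDet w X y = ∑ i : Fin (n + 1), (-1) ^ (i : ℕ) * newtonHead w y (X i) *
      ((∏ k, wtE w (X (i.succAbove k)) (y 0) * wtN w (X (i.succAbove k)) (y 0)) *
        newtonDet w (X ∘ i.succAbove) (Fin.tail y)) := by
  rw [newtonDet, Matrix.det_succ_column_zero]
  refine Finset.sum_congr rfl fun i _ => ?_
  congr 1
  rw [newtonDet, ← Matrix.det_mul_column]
  rfl

theorem newtonHead_comp_perm (w : R) {n : ℕ} (y : Fin (n + 1) → R) (x : R)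
    (σ : Equiv.Perm (Fin (n + 1))) : newtonHead w (y ∘ σ) x = newtonHead w y x := by
  simp only [newtonHead, Function.comp_apply]
  rw [Equiv.prod_comp σ fun k => wtE w x (y k), Equiv.prod_comp σ fun k => wtN w x (y k)]

theorem cons_cons_comp_swap {α : Type*} {n : ℕ} (y1 y2 : α) (y : Fin n → α) :
    (Fin.cons y1 (Fin.cons y2 y : Fin (n + 1) → α) : Fin (n + 2) → α) ∘
      Equiv.swap (0 : Fin (n + 1)).castSucc (0 : Fin (n + 1)).succ =
      (Fin.cons y2 (Fin.cons y1 y : Fin (n + 1) → α) : Fin (n + 2) → α) := by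
  ext j
  refine Fin.cases ?_ (fun j => ?_) j
  · simp
  · refine Fin.cases ?_ (fun j => ?_) j
    · simp
    · have h1 : j.succ.succ ≠ (0 : Fin (n + 1)).castSucc := by simp [Fin.ext_iff]
      have h2 : j.succ.succ ≠ (0 : Fin (n + 1)).succ := by simp [Fin.ext_iff]
      rw [Function.comp_apply, Equiv.swap_apply_of_ne_of_ne h1 h2]
      simp

theorem comp_swap_succ {α : Type*} {n : ℕ} (y : Fin (n + 2) → α) (i : Fin n) :
    y ∘ Equiv.swap i.succ.castSucc i.succ.succ =
      (Fin.cons (y 0) (Fin.tail y ∘ Equiv.swap i.castSucc i.succ) : Fin (n + 2) → α) := by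
  ext j
  refine Fin.cases ?_ (fun j => ?_) j
  · have h1 : (0 : Fin (n + 2)) ≠ i.succ.castSucc := by simp [Fin.ext_iff]
    have h2 : (0 : Fin (n + 2)) ≠ i.succ.succ := by simp [Fin.ext_iff]
    rw [Function.comp_apply, Equiv.swap_apply_of_ne_of_ne h1 h2]
    simp
  · simp only [Function.comp_apply, Fin.cons_succ, Fin.tail]
    congr 1
    rw [Fin.castSucc_succ]
    exact (Fin.succ_injective _).swap_apply _ _ _

/-- The determinant is symmetric in `y`: exchanging the first two column parameters adds a multiple
of its first column to the second one. -/
theorem newtonDet_swap (w : R) {n : ℕ} (X : Fin (n + 1) → R) (i : Fin n) (y : Fin (n + 1) → R) :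
    newtonDet w X (y ∘ Equiv.swap i.castSucc i.succ) = newtonDet w X y := by
  induction n with
  | zero => exact i.elim0
  | succ n ih =>
    revert i
    refine Fin.cases ?_ fun i => ?_
    · obtain ⟨y1, y2, y, rfl⟩ := exists_cons_cons y
      rw [cons_cons_comp_swap]
      have h := Matrix.det_updateCol_add_smul_self
        (Matrix.of fun i j => newtonRow w (Fin.cons y1 (Fin.cons y2 y : Fin (n + 1) → R) :
          Fin (n + 2) → R) (X i) j) (i := 1) (j := 0) (by simp) (y1 - y2)
      rw [newtonDet, newtonDet, ← h]
      congr 1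
      ext i j
      refine Fin.cases ?_ (fun j => ?_) j
      · rw [Matrix.updateCol_ne (by simp)]
        simp only [Matrix.of_apply, newtonRow, Fin.cons_zero]
        rw [← cons_cons_comp_swap, newtonHead_comp_perm]
      · refine Fin.cases ?_ (fun j => ?_) j
        · rw [Fin.succ_zero_eq_one, Matrix.updateCol_self]
          simp only [Matrix.of_apply, newtonRow, Pi.add_apply, Pi.smul_apply, Fin.cons_zero,
            ← Fin.succ_zero_eq_one, Fin.cons_succ, Matrix.transpose_apply, newtonHead,
            Fin.prod_univ_succ, Fin.tail_cons, smul_eq_mul]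
          simp only [wtE, wtN]
          ring
        · rw [Matrix.updateCol_ne (by simp [Fin.ext_iff])]
          simp only [Matrix.of_apply, newtonRow, Fin.cons_succ, Fin.cons_zero, Fin.tail_cons]
          ring
    · rw [comp_swap_succ, newtonDet_succ, newtonDet_succ]
      refine Finset.sum_congr rfl fun k _ => ?_
      simp only [Fin.cons_zero, Fin.tail_cons, ih]
      rw [← comp_swap_succ, newtonHead_comp_perm]

theorem newtonDet_comp_perm (w : R) {n : ℕ} (X y : Fin n → R) (σ : Equiv.Perm (Fin n)) :
    newtonDet w X (y ∘ σ) = newtonDet w X y := by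
  obtain _ | n := n
  · congr 1; exact Subsingleton.elim _ _
  · exact comp_perm_eq_of_swap (newtonDet w X) (newtonDet_swap w X) σ y

theorem newtonDet_perm_comp (w : R) {n : ℕ} (X y : Fin n → R) (σ : Equiv.Perm (Fin n)) :
    newtonDet w (X ∘ σ) y = Equiv.Perm.sign σ * newtonDet w X y :=
  Matrix.det_permute σ (Matrix.of fun i j => newtonRow w y (X i) j)

/-- The determinant satisfies the freezing recursion: all entries of the row `x` but the first
vanish. -/
theorem newtonDet_eq_of_wtB_eq_zero (b : Bool) {w x y1 : R} (h : wtB w (!b) x y1 = 0) {n : ℕ}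
    (X y : Fin n → R) :
    newtonDet w (Fin.cons x X : Fin (n + 1) → R) (Fin.cons y1 y : Fin (n + 1) → R) =
      w ^ n * (∏ i, (X i - x)) * (wtB w b x y1 * (∏ k, wtB w b x (y k)) *
        ∏ i, wtB w b (X i) y1) * newtonDet w X y := by
  have h0 : wtE w x y1 * wtN w x y1 = 0 := by
    cases b <;> simp [wtB] at h <;> simp [h]
  rw [newtonDet_succ, Fin.sum_univ_succ, Finset.sum_eq_zero, add_zero]
  · have hX : (Fin.cons x X : Fin (n + 1) → R) ∘ (0 : Fin (n + 1)).succAbove = X := by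
      ext i; simp
    rw [hX]
    simp only [Fin.cons_zero, Fin.tail_cons, Fin.val_zero, pow_zero, one_mul,
      Fin.succAbove_zero, Fin.cons_succ, newtonHead, Fin.prod_univ_succ]
    cases b
    · simp only [wtB, Bool.not_false, cond_true, cond_false] at h ⊢
      have hk : ∀ i, wtN w (X i) y1 = (X i - x) * (w - 1 + y1) := by
        intro i
        simp only [wtN] at h ⊢; linear_combination h
      have hw : w = (1 - x) * (w - 1 + y1) := by
        simp only [wtN] at h; linear_combination h
      rw [h, zero_mul, mul_zero, add_zero]
      simp only [hk, Finset.prod_mul_distrib, Finset.prod_const, Finset.card_univ,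
        Fintype.card_fin]
      conv_rhs => rw [show w ^ n = ((1 - x) * (w - 1 + y1)) ^ n from by rw [← hw]]
      rw [mul_pow]; ring
    · simp only [wtB, Bool.not_true, cond_true, cond_false] at h ⊢
      have hk : ∀ i, wtE w (X i) y1 = (X i - x) * (y1 - 1) := by
        intro i
        simp only [wtE] at h ⊢; linear_combination h
      have hw : w = -(w - 1 + x) * (y1 - 1) := by
        simp only [wtE] at h; linear_combination h
      rw [h, zero_mul, mul_zero, zero_add]
      simp only [hk, Finset.prod_mul_distrib, Finset.prod_const, Finset.card_univ,
        Fintype.card_fin]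
      conv_rhs => rw [show w ^ n = (-(w - 1 + x) * (y1 - 1)) ^ n from by rw [← hw]]
      rw [mul_pow]; ring
  · intro i _
    obtain ⟨k, hk⟩ := Fin.exists_succAbove_eq (Fin.succ_ne_zero i).symm
    rw [Finset.prod_eq_zero (Finset.mem_univ k), zero_mul, mul_zero]
    rw [hk]; exact h0

end Newton

/-! ### The degree of the determinant in a column parameter -/

section NewtonDegree
variable {K : Type*} [Field K]

theorem snoc_eq_cons_comp {α : Type*} {n : ℕ} (y : Fin n → α) (a : α) :
    (Fin.snoc y a : Fin (n + 1) → α) = (Fin.cons a y : Fin (n + 1) → α) ∘ finRotate (n + 1) :=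
  Fin.snoc_eq_cons_rotate _ _

theorem isPolyDeg_wtE (w x : K) : IsPolyDeg 1 fun a => wtE w x a := by
  convert isPolyDeg_linear (1 - x) (w - 1 + x) using 2
  simp only [wtE]; ring

theorem isPolyDeg_wtN (w x : K) : IsPolyDeg 1 fun a => wtN w x a := by
  convert isPolyDeg_linear (1 + (w - 1) * x) (x - 1) using 2
  simp only [wtN]; ring

theorem isPolyDeg_newtonRow_snoc (w x : K) {n : ℕ} (y : Fin n → K) (j : Fin (n + 1)) :
    IsPolyDeg 1 fun a => newtonRow w (Fin.snoc y a : Fin (n + 1) → K) x j := by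
  have hh : ∀ {n : ℕ} (y : Fin n → K),
      IsPolyDeg 1 fun a => newtonHead w (Fin.snoc y a : Fin (n + 1) → K) x := by
    intro n y
    simp only [newtonHead, Fin.prod_univ_castSucc, Fin.snoc_castSucc, Fin.snoc_last]
    exact (((isPolyDeg_wtE w x).const_mul _).const_mul _).add
      (((isPolyDeg_wtN w x).const_mul _).const_mul _)
  induction n with
  | zero =>
    simp only [newtonRow]
    refine Fin.cases ?_ (fun j => j.elim0) j
    exact hh y
  | succ n ih =>
    simp only [newtonRow]
    refine Fin.cases ?_ (fun j => ?_) j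
    · exact hh y
    · simp only [Fin.cons_succ, tail_snoc, snoc_apply_zero']
      exact (ih (Fin.tail y) j).const_mul _

theorem isPolyDeg_newtonDet (w : K) {n : ℕ} (X : Fin (n + 1) → K) (y : Fin n → K) :
    IsPolyDeg (n + 1) fun a => newtonDet w X (Fin.cons a y : Fin (n + 1) → K) := by
  have h : ∀ a, newtonDet w X (Fin.cons a y : Fin (n + 1) → K) =
      (Matrix.of fun i j => newtonRow w (Fin.snoc y a : Fin (n + 1) → K) (X i) j).det := by
    intro a
    rw [← newtonDet, snoc_eq_cons_comp, newtonDet_comp_perm]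
  simp only [h]
  refine (isPolyDeg_det (d := 1) fun i j => ?_).mono (by simp)
  exact isPolyDeg_newtonRow_snoc w (X i) y j

end NewtonDegree

/-! ### Half-turn symmetric states of even order -/

section HalfTurn
variable {K : Type*} [Field K]

theorem det_vandermonde_cons {R : Type*} [CommRing R] {n : ℕ} (x : R) (X : Fin n → R) :
    (vandermonde (Fin.cons x X : Fin (n + 1) → R)).det =
      (∏ i, (X i - x)) * (vandermonde X).det := by
  rw [det_vandermonde, det_vandermonde, Fin.prod_univ_succ, Fin.prod_Ioi_zero]
  simp [Fin.prod_Ioi_succ]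

theorem det_vandermonde_comp {R : Type*} [CommRing R] {n : ℕ} (X : Fin n → R)
    (σ : Equiv.Perm (Fin n)) :
    (vandermonde (X ∘ σ)).det = Equiv.Perm.sign σ * (vandermonde X).det :=
  det_permute σ (vandermonde X)

/-- Row parameters in general position. -/
structure GenericRows (w : K) {n : ℕ} (X : Fin n → K) : Prop where
  inj : Function.Injective X
  braidF_ne : ∀ i j, braidF w (X i) (X j) ≠ 0
  ne_one : ∀ i, X i ≠ 1
  add_ne : ∀ i, w - 1 + X i ≠ 0

theorem GenericRows.comp {w : K} {m n : ℕ} {X : Fin n → K} (h : GenericRows w X) {f : Fin m → Fin n}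
    (hf : Function.Injective f) : GenericRows w (X ∘ f) :=
  ⟨h.inj.comp hf, fun _ _ => h.braidF_ne _ _, fun _ => h.ne_one _, fun _ => h.add_ne _⟩

/-- The column parameter at which a row with parameter `x` freezes the first column into the
state `b`. -/
def colRoot (w : K) (b : Bool) (x : K) : K :=
  bif b then (x - 1) / (w - 1 + x) else (1 + (w - 1) * x) / (1 - x)

theorem wtB_colRoot {w : K} {x : K} (h1 : x ≠ 1) (h2 : w - 1 + x ≠ 0) (b : Bool) :
    wtB w (!b) x (colRoot w b x) = 0 := by
  have h1' : 1 - x ≠ 0 := sub_ne_zero.2 h1.symm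
  cases b <;> simp only [wtB, colRoot, Bool.not_true, Bool.not_false, cond_true, cond_false, wtE,
    wtN] <;> field_simp <;> ring

theorem wtE_one (w x : K) : wtE w x 1 = w := by simp only [wtE]; ring

theorem wtN_sub (w x : K) : wtN w x (1 - w) = w := by simp only [wtN]; ring

theorem wtE_wtN_ne {w x x' y : K} (hw : w ≠ 0) (hF : braidF w x' x ≠ 0) (h : wtE w x y = 0)
    (h' : wtN w x' y = 0) : False := by
  have e : wtN w x' y = x' * wtE w x y - braidF w x' x * (y - 1) := by
    simp only [wtN, wtE, braidF]; ring
  rw [h, h', mul_zero, zero_sub, eq_comm, neg_eq_zero] at e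
  rcases mul_eq_zero.1 e with e | e
  · exact hF e
  · rw [sub_eq_zero] at e
    rw [e, wtE_one] at h
    exact hw h

theorem wtB_inj {w x x' y : K} (hw : w ≠ 0) (b : Bool) (h : wtB w b x y = 0)
    (h' : wtB w b x' y = 0) : x = x' := by
  cases b <;> simp only [wtB, cond_true, cond_false] at h h'
  · have e : (x - x') * (y - 1) = 0 := by
      simp only [wtE] at h h'; linear_combination h - h'
    rcases mul_eq_zero.1 e with e | e
    · exact sub_eq_zero.1 e
    · rw [sub_eq_zero.1 e, wtE_one] at h
      exact absurd h hw
  · have e : (x - x') * (y - (1 - w)) = 0 := by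
      simp only [wtN] at h h'; linear_combination h - h'
    rcases mul_eq_zero.1 e with e | e
    · exact sub_eq_zero.1 e
    · rw [sub_eq_zero.1 e, wtN_sub] at h
      exact absurd h hw

theorem GenericRows.colRoot_injective {w : K} (hw : w ≠ 0) {n : ℕ} {X : Fin n → K}
    (h : GenericRows w X) :
    Function.Injective fun p : Bool × Fin n => colRoot w p.1 (X p.2) := by
  rintro ⟨b, i⟩ ⟨c, j⟩ hij
  dsimp only at hij
  have hi := wtB_colRoot (h.ne_one i) (h.add_ne i) b
  have hj := wtB_colRoot (h.ne_one j) (h.add_ne j) c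
  rw [← hij] at hj
  by_cases hbc : b = c
  · subst hbc
    rw [h.inj (wtB_inj hw _ hi hj)]
  · exfalso
    cases b <;> cases c <;> simp [wtB] at hbc hi hj
    · exact wtE_wtN_ne hw (h.braidF_ne _ _) hj hi
    · exact wtE_wtN_ne hw (h.braidF_ne _ _) hi hj

theorem comp_swap_zero_eq_cons {α : Type*} {n : ℕ} (X : Fin (n + 1) → α) (i : Fin (n + 1)) :
    X ∘ Equiv.swap 0 i = (Fin.cons (X i) (Fin.tail (X ∘ Equiv.swap 0 i)) : Fin (n + 1) → α) := by
  conv_lhs => rw [← Fin.cons_self_tail (X ∘ Equiv.swap 0 i)]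
  simp

theorem GenericRows.tail {w : K} {n : ℕ} {X : Fin (n + 1) → K} (h : GenericRows w X)
    (σ : Equiv.Perm (Fin (n + 1))) : GenericRows w (Fin.tail (X ∘ σ)) :=
  (h.comp σ.injective).comp (Fin.succ_injective n)

theorem ofFn_comp_perm {α : Type*} {n : ℕ} (X : Fin n → α) (σ : Equiv.Perm (Fin n)) :
    (List.ofFn (X ∘ σ)).Perm (List.ofFn X) := Equiv.Perm.ofFn_comp_perm σ X

theorem Zht_perm (w : K) {n : ℕ} (y : Fin n → K) {xs xs' : List K} (h : xs.Perm xs') :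
    Zht w xs y = Zht w xs' y := by
  rw [Zht, nest_perm w y y 1 h, Zht]

theorem Zodd_perm (w p r z z' : K) {n : ℕ} (y : Fin n → K) {xs xs' : List K} (h : xs.Perm xs') :
    Zodd w p r z z' xs y = Zodd w p r z z' xs' y := by
  rw [Zodd, nest_perm w _ y _ h, Zodd]

theorem sign_ne_zero {n : ℕ} (σ : Equiv.Perm (Fin n)) :
    ((Equiv.Perm.sign σ : ℤ) : K) ≠ 0 := by
  rcases Int.units_eq_one_or (Equiv.Perm.sign σ) with h | h <;> simp [h]

/-- The half-turn symmetric partition function of even order is the domain wall partition function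
times a determinant. Both sides satisfy the same recursion at the freezing points of the first
column, which are more than the degree in the parameter of that column. -/
theorem Zht_eq {w : K} (hw : w ≠ 0) {n : ℕ} {X : Fin n → K} (hX : GenericRows w X)
    (y : Fin n → K) :
    w ^ n.choose 2 * (vandermonde X).det * Zht w (List.ofFn X) y =
      Zdw w (List.ofFn X) y * newtonDet w X y := by
  induction n with
  | zero =>
    simp [Zht, Zdw, nest, dwProd, newtonDet, Subsingleton.elim (bot : Fin 0 → Bool) top]
  | succ n ih =>
    rw [← Fin.cons_self_tail y]
    generalize y 0 = a, Fin.tail y = y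
    rw [← sub_eq_zero]
    have hdeg : IsPolyDeg (2 * n + 1) fun a =>
        w ^ (n + 1).choose 2 * (vandermonde X).det *
          Zht w (List.ofFn X) (Fin.cons a y : Fin (n + 1) → K) -
        Zdw w (List.ofFn X) (Fin.cons a y : Fin (n + 1) → K) *
          newtonDet w X (Fin.cons a y : Fin (n + 1) → K) := by
      refine (((isPolyDeg_Zht w (List.ofFn X) y).const_mul _).mono ?_).sub
        (((isPolyDeg_Zdw w (List.ofFn X) y).mul (isPolyDeg_newtonDet w X y)).mono ?_) <;>
      · simp only [List.length_ofFn]; push_cast; linarith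
    -- The degree is `2n + 1` and there are two freezing points for each of the `n + 1` rows.
    refine hdeg.eq_zero (hX.colRoot_injective hw) ?_ ?_ a
    swap
    · simp only [Fintype.card_prod, Fintype.card_bool, Fintype.card_fin]; push_cast; linarith
    rintro ⟨b, i⟩
    have h0 := wtB_colRoot (hX.ne_one i) (hX.add_ne i) b
    -- By symmetry the row `i` may be taken to be the first one.
    dsimp only
    generalize colRoot w b (X i) = a at h0
    refine (mul_eq_zero.1 ?_).resolve_left (sign_ne_zero (K := K) (Equiv.swap 0 i))
    have ih' := ih (hX.tail (Equiv.swap 0 i)) y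
    rw [mul_sub]
    have e1 := det_vandermonde_comp X (Equiv.swap 0 i)
    have e2 := newtonDet_perm_comp w X (Fin.cons a y : Fin (n + 1) → K) (Equiv.swap 0 i)
    rw [← Zht_perm w _ (ofFn_comp_perm X (Equiv.swap 0 i)),
      ← Zdw_perm w _ (ofFn_comp_perm X (Equiv.swap 0 i))]
    trans w ^ (n + 1).choose 2 * (vandermonde (X ∘ Equiv.swap 0 i)).det *
          Zht w (List.ofFn (X ∘ Equiv.swap 0 i)) (Fin.cons a y : Fin (n + 1) → K) -
        Zdw w (List.ofFn (X ∘ Equiv.swap 0 i)) (Fin.cons a y : Fin (n + 1) → K) *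
          newtonDet w (X ∘ Equiv.swap 0 i) (Fin.cons a y : Fin (n + 1) → K)
    · rw [e1, e2]; ring
    rw [comp_swap_zero_eq_cons]
    generalize Fin.tail (X ∘ Equiv.swap 0 i) = X' at ih'
    rw [List.ofFn_cons, Zht_eq_of_wtB_eq_zero b h0, Zdw_eq_of_wtB_eq_zero b h0,
      newtonDet_eq_of_wtB_eq_zero b h0, det_vandermonde_cons, Nat.choose_succ_succ' n 1,
      Nat.choose_one_right, pow_add]
    simp only [List.map_ofFn, List.prod_ofFn, Function.comp_apply, Finset.prod_pow]
    linear_combination (w ^ n * (∏ k, (X' k - X i)) * wtB w b (X i) a *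
      (∏ k, wtB w b (X i) (y k)) ^ 2 * (∏ k, wtB w b (X' k) a) ^ 2) * ih'

end HalfTurn

/-! ### Sliding the central row through the other rows -/

section Sliding
variable {K : Type*} [Field K]

/-- The rows of a matrix whose last upper state is `s`. -/
def slice {n : ℕ} {ι : Type*} (M : Matrix (Fin (n + 1) → Bool) ι K) (s : Bool) :
    Matrix (Fin n → Bool) ι K :=
  Matrix.of fun v u => M (Fin.snoc v s : Fin (n + 1) → Bool) u

theorem slice_rowT_mul (w x z : K) {n : ℕ} (y : Fin n → K) {ι : Type*}
    (M : Matrix (Fin (n + 1) → Bool) ι K) (a b s : Bool) :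
    slice (rowT w x (Fin.snoc y z : Fin (n + 1) → K) a b * M) s =
      ∑ h, ∑ s', vertexWt w x z h b s s' • (rowT w x y a h * slice M s') := by
  ext v u
  simp only [slice, Matrix.of_apply, Matrix.mul_apply, sum_snoc, rowT_snoc, Fintype.sum_bool,
    Matrix.add_apply, Matrix.smul_apply, smul_eq_mul, Finset.mul_sum, ← Finset.sum_add_distrib]
  refine Finset.sum_congr rfl fun _ _ => ?_
  ring

theorem slice_mul {n : ℕ} {ι κ : Type*} [Fintype ι] (M : Matrix (Fin (n + 1) → Bool) ι K)
    (N : Matrix ι κ K) (s : Bool) : slice (M * N) s = slice M s * N := rfl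

theorem slice_add {n : ℕ} {ι : Type*} (M N : Matrix (Fin (n + 1) → Bool) ι K)
    (s : Bool) : slice (M + N) s = slice M s + slice N s := rfl

theorem slice_oddBase (w p r z : K) {n : ℕ} (y : Fin n → K) (s : Bool) :
    slice (oddBase w p r z y) s = (bif s then r else p) • rowT w z y false s := by
  ext v u
  cases s <;> simp [slice, oddBase]

theorem slice_nest_cons (w x z' : K) {n : ℕ} (y : Fin n → K)
    (B : Matrix (Fin (n + 1) → Bool) (Fin n → Bool) K) (xs : List K) (s : Bool) :
    slice (nest (fun x => rowT w x (Fin.snoc y z' : Fin (n + 1) → K)) (fun x => rowT w x y) B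
      (x :: xs)) s =
    ∑ ε, ∑ h, ∑ s', vertexWt w x z' h ε s s' • (rowT w x y false h *
      slice (nest (fun x => rowT w x (Fin.snoc y z' : Fin (n + 1) → K)) (fun x => rowT w x y) B
        xs) s' * rowT w x y false (!ε)) := by
  simp only [nest, Fintype.sum_bool, slice_add]
  rw [slice_mul (_ * _) (rowT w x y false !true), slice_mul (_ * _) (rowT w x y false !false),
    slice_rowT_mul, slice_rowT_mul]
  simp only [Fintype.sum_bool, Matrix.add_mul, Matrix.smul_mul]

/-- If the weight `wtE` vanishes at the centre, the left half of the central row slides outwards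
through the lower half rows, by the exchange relations, and the central column splits off. -/
theorem slice_nest_of_wtE_eq_zero {w z z' : K} (h0 : wtE w z z' = 0) {n : ℕ} (y : Fin n → K)
    {xs : List K} (hxs : ∀ x ∈ xs, wtE w x z' ≠ 0 ∧ wtN w x z' ≠ 0) (s : Bool) :
    slice (nest (fun x => rowT w x (Fin.snoc y z' : Fin (n + 1) → K)) (fun x => rowT w x y)
      (oddBase w 1 (wtN w z z') z y) xs) s =
    ((xs.map fun x => wtN w x z').prod * bif s then wtN w z z' else 1) •
      (nest (fun x => rowT w x y) (fun x => rowT w x y) 1 xs * rowT w z y false s) := by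
  induction xs generalizing s with
  | nil => rw [nest, slice_oddBase]; simp [nest]
  | cons x xs ih =>
    obtain ⟨he, hn⟩ := hxs x (by simp)
    replace ih := ih fun x hx => hxs x (by simp [hx])
    rw [slice_nest_cons]
    simp only [ih, nest, Fintype.sum_bool, List.map_cons, List.prod_cons, Bool.not_true,
      Bool.not_false]
    generalize (xs.map fun x => wtN w x z').prod = κ
    generalize nest (fun x => rowT w x y) (fun x => rowT w x y) 1 xs = P
    have hE := rowT_exchange w x z y
    -- The vertex weights of the row `x` in the central column are proportional to the coefficients
    -- of the exchange relations, because `wtE w z z' = 0`.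
    have s1 : braidF w x z * wtE w x z' = (z - x) * wtN w x z' := by
      simp only [wtE, wtN, braidF] at h0 ⊢
      linear_combination (1 + (w - 2) * x + x * z + (x - z) * x) * h0
    have s2 : braidF w x z * wtN w z z' = gam w z * wtN w x z' := by
      simp only [wtE, wtN, braidF, gam] at h0 ⊢
      linear_combination ((1 + (w - 2) * x + x * z) * z - (1 + (w - 2) * z + z ^ 2) * x) * h0
    have s3 : braidF w x z * (w * gam w z') = wtN w x z' * wtN w z z' := by
      have h1 : wtN w x z' = braidF w x z * (1 - z') := by
        simp only [wtE, wtN, braidF] at h0 ⊢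
        linear_combination x * h0
      have h2 : wtN w z z' * (1 - z') = w * gam w z' := by
        simp only [wtE, wtN, gam] at h0 ⊢
        linear_combination (1 - w - z') * h0
      rw [h1, mul_assoc, mul_comm (1 - z'), h2]
    have hF : braidF w x z ≠ 0 := by
      intro hF
      rw [hF, zero_mul] at s1
      rcases mul_eq_zero.1 s1.symm with h | h
      · rw [← sub_eq_zero.1 h, h0] at he
        exact he rfl
      · exact hn h
    have comm_ff := smul_right_injective _ hF hE.ff
    have comm_tt := smul_right_injective _ hF hE.tt
    have ft := hE.ft
    have tf := hE.tf
    beta_reduce at comm_ff comm_tt ft tf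
    cases s
    · generalize rowT w x y false false = A at *
      generalize rowT w x y false true = C at *
      generalize rowT w z y false false = Zf at *
      generalize rowT w z y false true = Zt at *
      have key : wtN w x z' • (C * Zf) = wtE w x z' • (Zf * C) + wtN w z z' • (Zt * A) := by
        refine smul_right_injective _ hF ?_
        beta_reduce
        rw [smul_comm, tf, smul_add, smul_add, smul_smul, smul_smul, smul_smul, smul_smul, s1, s2,
          mul_comm (wtN w x z'), mul_comm (wtN w x z')]
      have k2 := congrArg (fun M => κ • (A * (P * M))) key
      simp only [vertexWt, cond_true, cond_false, zero_smul, add_zero, zero_add, Matrix.smul_mul,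
        Matrix.mul_smul, Matrix.mul_add, Matrix.add_mul, smul_add, Matrix.mul_assoc,
        comm_ff] at k2 ⊢
      linear_combination (norm := module) -k2
    · generalize rowT w x y false false = A at *
      generalize rowT w x y false true = C at *
      generalize rowT w z y false false = Zf at *
      generalize rowT w z y false true = Zt at *
      have key : (wtN w x z' * wtN w z z') • (A * Zt) =
          (wtE w x z' * wtN w z z') • (Zt * A) + (w * gam w x * gam w z') • (Zf * C) := by
        refine smul_right_injective _ hF ?_
        beta_reduce
        rw [smul_comm, ft, smul_add, smul_add, smul_smul, smul_smul, smul_smul, smul_smul,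
          ← mul_assoc (braidF w x z), s1,
          show braidF w x z * (w * gam w x * gam w z') = gam w x * (braidF w x z * (w * gam w z'))
            by ring, s3, add_comm]
        congr 2 <;> ring
      have k2 := congrArg (fun M => κ • (C * (P * M))) key
      simp only [vertexWt, cond_true, cond_false, zero_smul, add_zero, zero_add, Matrix.smul_mul,
        Matrix.mul_smul, Matrix.mul_add, Matrix.add_mul, smul_add, Matrix.mul_assoc,
        comm_tt] at k2 ⊢
      linear_combination (norm := module) -k2

/-- If the weight `wtN` vanishes at the centre, the left half of the central row slides outwards
through the upper half rows, by the exchange relations, and the central column splits off. -/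
theorem slice_nest_of_wtN_eq_zero {w z z' : K} (h0 : wtN w z z' = 0) {n : ℕ} (y : Fin n → K)
    {xs : List K} (hxs : ∀ x ∈ xs, wtE w x z' ≠ 0 ∧ wtN w x z' ≠ 0) (s : Bool) :
    slice (nest (fun x => rowT w x (Fin.snoc y z' : Fin (n + 1) → K)) (fun x => rowT w x y)
      (oddBase w 1 (wtE w z z') z y) xs) s =
    ((xs.map fun x => wtE w x z').prod * bif s then wtE w z z' else 1) •
      (rowT w z y false s * nest (fun x => rowT w x y) (fun x => rowT w x y) 1 xs) := by
  induction xs generalizing s with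
  | nil => rw [nest, slice_oddBase]; simp [nest]
  | cons x xs ih =>
    obtain ⟨he, hn⟩ := hxs x (by simp)
    replace ih := ih fun x hx => hxs x (by simp [hx])
    rw [slice_nest_cons]
    simp only [ih, nest, Fintype.sum_bool, List.map_cons, List.prod_cons, Bool.not_true,
      Bool.not_false]
    generalize (xs.map fun x => wtE w x z').prod = κ
    generalize nest (fun x => rowT w x y) (fun x => rowT w x y) 1 xs = P
    have hE := rowT_exchange w z x y
    have h1 : wtE w x z' = braidF w z x * (w - 1 + z') - (w - 2 + x) * wtN w z z' := by
      simp only [wtE, wtN, braidF]; ring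
    -- The vertex weights of the row `x` in the central column are proportional to the coefficients
    -- of the exchange relations, because `wtN w z z' = 0`.
    have s1 : braidF w z x * wtN w x z' = (x - z) * wtE w x z' := by
      rw [h1]
      simp only [wtN, braidF] at h0 ⊢
      linear_combination (1 + (w - 2) * z + z * x + (x - z) * (w - 2 + x)) * h0
    have s2 : braidF w z x * wtE w z z' = gam w z * wtE w x z' := by
      rw [h1]
      simp only [wtE, wtN, braidF, gam] at h0 ⊢
      linear_combination ((1 + (w - 2) * z + z ^ 2) * (w - 2 + x) -
        (1 + (w - 2) * z + z * x) * (w - 2 + z)) * h0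
    have s3 : braidF w z x * (w * gam w z') = wtE w x z' * wtE w z z' := by
      have h2 : wtE w z z' * (w - 1 + z') = w * gam w z' := by
        simp only [wtE, wtN, gam] at h0 ⊢
        linear_combination (z' - 1) * h0
      rw [h1, h0, mul_zero, sub_zero, mul_assoc, mul_comm (w - 1 + z'), h2]
    have hF : braidF w z x ≠ 0 := by
      intro hF
      rw [hF, zero_mul] at s1
      rcases mul_eq_zero.1 s1.symm with h | h
      · rw [sub_eq_zero.1 h, h0] at hn
        exact hn rfl
      · exact he h
    have comm_ff := smul_right_injective _ hF hE.ff
    have comm_tt := smul_right_injective _ hF hE.tt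
    have ft := hE.ft
    have tf := hE.tf
    beta_reduce at comm_ff comm_tt ft tf
    cases s
    · generalize rowT w x y false false = A at *
      generalize rowT w x y false true = C at *
      generalize rowT w z y false false = Zf at *
      generalize rowT w z y false true = Zt at *
      have key : wtE w x z' • (Zf * C) = wtN w x z' • (C * Zf) + wtE w z z' • (A * Zt) := by
        refine smul_right_injective _ hF ?_
        beta_reduce
        rw [smul_comm, ft, smul_add, smul_add, smul_smul, smul_smul, smul_smul, smul_smul, s1, s2,
          mul_comm (wtE w x z'), mul_comm (wtE w x z'), add_comm]
      have k2 := congrArg (fun M => κ • (M * (P * A))) key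
      have k3 := congrArg (fun M => (κ * wtE w x z') • (M * (P * C))) comm_ff
      simp only [vertexWt, cond_true, cond_false, zero_smul, add_zero, zero_add, Matrix.smul_mul,
        Matrix.mul_smul, Matrix.mul_add, Matrix.add_mul, smul_add, Matrix.mul_assoc] at k2 k3 ⊢
      linear_combination (norm := module) -k2 - k3
    · generalize rowT w x y false false = A at *
      generalize rowT w x y false true = C at *
      generalize rowT w z y false false = Zf at *
      generalize rowT w z y false true = Zt at *
      have key : (wtE w x z' * wtE w z z') • (Zt * A) =
          (wtN w x z' * wtE w z z') • (A * Zt) + (w * gam w x * gam w z') • (C * Zf) := by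
        refine smul_right_injective _ hF ?_
        beta_reduce
        rw [smul_comm, tf, smul_add, smul_add, smul_smul, smul_smul, smul_smul, smul_smul,
          ← mul_assoc (braidF w z x), s1,
          show braidF w z x * (w * gam w x * gam w z') = gam w x * (braidF w z x * (w * gam w z'))
            by ring, s3]
        congr 2 <;> ring
      have k2 := congrArg (fun M => κ • (M * (P * C))) key
      have k3 := congrArg (fun M => (κ * wtE w x z' * wtE w z z') • (M * (P * A))) comm_tt
      simp only [vertexWt, cond_true, cond_false, zero_smul, add_zero, zero_add, Matrix.smul_mul,
        Matrix.mul_smul, Matrix.mul_add, Matrix.add_mul, smul_add, Matrix.mul_assoc] at k2 k3 ⊢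
      linear_combination (norm := module) -k2 - k3

/-- If one of the weights of an entry `0` vanishes at the centre, the partition function of odd
order with central weights `1` and the other of these weights reduces to that of even order. -/
theorem Zodd_one_of_wtB_eq_zero (b : Bool) {w z z' : K} (h0 : wtB w (!b) z z' = 0) {n : ℕ}
    (y : Fin n → K) {xs : List K} (hxs : ∀ x ∈ xs, wtE w x z' ≠ 0 ∧ wtN w x z' ≠ 0) :
    Zodd w 1 (wtB w b z z') z z' xs y =
      (xs.map fun x => wtB w b x z').prod * (∏ k, wtB w b z (y k)) * Zht w xs y := by
  have h : Zodd w 1 (wtB w b z z') z z' xs y = slice (nest (fun x => rowT w x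
      (Fin.snoc y z' : Fin (n + 1) → K)) (fun x => rowT w x y)
      (oddBase w 1 (wtB w b z z') z y) xs) false bot top := by
    rw [Zodd, bot_snoc]; rfl
  rw [h]
  cases b
  · simp only [wtB, Bool.not_false, cond_true, cond_false] at h0 ⊢
    rw [slice_nest_of_wtN_eq_zero h0 y hxs, Matrix.smul_apply, Matrix.mul_apply]
    simp only [rowT_false_false_bot]
    simp [Zht, wtB, mul_assoc]
  · simp only [wtB, Bool.not_true, cond_true, cond_false] at h0 ⊢
    rw [slice_nest_of_wtE_eq_zero h0 y hxs, Matrix.smul_apply, Matrix.mul_apply]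
    simp only [rowT_false_false_top]
    simp [Zht, wtB]
    ring

end Sliding

/-! ### The defects of the identities of odd order -/

section OddLinear
variable {K : Type*} [Field K]

theorem nest_add_base {κ ι : Type*} [Fintype κ] [Fintype ι] (t' : K → Bool → Bool → Matrix κ κ K)
    (t : K → Bool → Bool → Matrix ι ι K) (B B' : Matrix κ ι K) (xs : List K) :
    nest t' t (B + B') xs = nest t' t B xs + nest t' t B' xs := by
  induction xs with
  | nil => rfl
  | cons x xs ih =>
    simp only [nest, ih, Matrix.mul_add, Matrix.add_mul, Finset.sum_add_distrib]

theorem nest_smul_base {κ ι : Type*} [Fintype κ] [Fintype ι] (t' : K → Bool → Bool → Matrix κ κ K)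
    (t : K → Bool → Bool → Matrix ι ι K) (c : K) (B : Matrix κ ι K) (xs : List K) :
    nest t' t (c • B) xs = c • nest t' t B xs := by
  induction xs with
  | nil => rfl
  | cons x xs ih =>
    simp only [nest, ih, Matrix.mul_smul, Matrix.smul_mul, Finset.smul_sum]

theorem Zodd_mul (w c p r z z' : K) (xs : List K) {n : ℕ} (y : Fin n → K) :
    Zodd w (c * p) (c * r) z z' xs y = c * Zodd w p r z z' xs y := by
  have h : oddBase w (c * p) (c * r) z y = c • oddBase w p r z y := by
    ext v u
    simp only [oddBase, Matrix.of_apply, Matrix.smul_apply, smul_eq_mul]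
    cases v (Fin.last n) <;> simp [mul_assoc]
  rw [Zodd, h, nest_smul_base, Matrix.smul_apply, smul_eq_mul, Zodd]

theorem wtE_eq_wtN_swap (w x y : K) : wtE w x y = wtN w y x := by
  simp only [wtE, wtN]; ring

theorem wtN_eq_wtE_swap (w x y : K) : wtN w x y = wtE w y x := by
  simp only [wtE, wtN]; ring

theorem Zdw_snoc_eq_cons (w : K) (xs : List K) {n : ℕ} (y : Fin n → K) (a : K) :
    Zdw w xs (Fin.snoc y a : Fin (n + 1) → K) = Zdw w xs (Fin.cons a y : Fin (n + 1) → K) := by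
  rw [snoc_eq_cons_comp, Zdw_comp_perm]

/-- The defect of the identity for the partition function with central weights `1` and
`wtE + wtN`, with the factor `Zht / Zdw` written as a determinant. -/
def oddDefect (w z z' : K) {n : ℕ} (X y : Fin n → K) : K :=
  w ^ n.choose 2 * (vandermonde X).det *
      Zodd w 1 (wtE w z z' + wtN w z z') z z' (List.ofFn X) y -
    Zdw w (z :: List.ofFn X) (Fin.snoc y z' : Fin (n + 1) → K) * newtonDet w X y

/-- The defect of the identity for the partition function with central weights `wtE + wtN` and
`w * gam w z * gam w z'`. -/
def oddDefect' (w z z' : K) {n : ℕ} (X y : Fin n → K) : K :=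
  w ^ (n + 1).choose 2 * (vandermonde (Fin.cons z X : Fin (n + 1) → K)).det *
      Zodd w (wtE w z z' + wtN w z z') (w * gam w z * gam w z') z z' (List.ofFn X) y -
    Zdw w (List.ofFn X) y *
      newtonDet w (Fin.cons z X : Fin (n + 1) → K) (Fin.cons z' y : Fin (n + 1) → K)

theorem cons_comp_perm {α : Type*} {n : ℕ} (z : α) (X : Fin n → α) (σ : Equiv.Perm (Fin n)) :
    (Fin.cons z (X ∘ σ) : Fin (n + 1) → α) =
      (Fin.cons z X : Fin (n + 1) → α) ∘ Equiv.Perm.decomposeFin.symm (0, σ) := by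
  ext j; refine Fin.cases ?_ (fun j => ?_) j
  · simp
  · simp

theorem oddDefect_perm_comp (w z z' : K) {n : ℕ} (X y : Fin n → K) (σ : Equiv.Perm (Fin n)) :
    oddDefect w z z' (X ∘ σ) y = Equiv.Perm.sign σ * oddDefect w z z' X y := by
  rw [oddDefect, oddDefect, det_vandermonde_comp, newtonDet_perm_comp,
    Zodd_perm w _ _ _ _ _ (ofFn_comp_perm X σ), Zdw_perm w _ ((ofFn_comp_perm X σ).cons z)]
  ring

theorem oddDefect'_perm_comp (w z z' : K) {n : ℕ} (X y : Fin n → K) (σ : Equiv.Perm (Fin n)) :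
    oddDefect' w z z' (X ∘ σ) y = Equiv.Perm.sign σ * oddDefect' w z z' X y := by
  rw [oddDefect', oddDefect', cons_comp_perm, det_vandermonde_comp, newtonDet_perm_comp,
    Zodd_perm w _ _ _ _ _ (ofFn_comp_perm X σ), Zdw_perm w _ (ofFn_comp_perm X σ),
    Equiv.Perm.decomposeFin.symm_sign]
  simp only [if_true, one_mul]
  ring

theorem oddDefect_comp_perm (w z z' : K) {n : ℕ} (X y : Fin n → K) (σ : Equiv.Perm (Fin n)) :
    oddDefect w z z' X (y ∘ σ) = oddDefect w z z' X y := by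
  rw [oddDefect, oddDefect, newtonDet_comp_perm, Zodd_comp_perm, Zdw_snoc_comp_perm]

theorem oddDefect'_comp_perm (w z z' : K) {n : ℕ} (X y : Fin n → K) (σ : Equiv.Perm (Fin n)) :
    oddDefect' w z z' X (y ∘ σ) = oddDefect' w z z' X y := by
  rw [oddDefect', oddDefect', cons_comp_perm, newtonDet_comp_perm, Zodd_comp_perm, Zdw_comp_perm]

theorem oddDefect_eq_of_wtB_eq_zero (b : Bool) {w x a : K} (h : wtB w (!b) x a = 0) (z z' : K)
    {n : ℕ} (X y : Fin n → K) :
    ∃ c, oddDefect w z z' (Fin.cons x X : Fin (n + 1) → K) (Fin.cons a y : Fin (n + 1) → K) =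
      c * oddDefect w z z' X y := by
  rw [oddDefect, oddDefect, List.ofFn_cons, Zodd_eq_of_wtB_eq_zero b h,
    newtonDet_eq_of_wtB_eq_zero b h, det_vandermonde_cons, Zdw_perm w _ (List.Perm.swap x z _),
    ← Fin.cons_snoc_eq_snoc_cons, Zdw_eq_of_wtB_eq_zero b h, Nat.choose_succ_succ' n 1,
    Nat.choose_one_right, pow_add, Fin.prod_univ_castSucc]
  simp only [List.map_cons, List.prod_cons, List.map_ofFn, List.prod_ofFn, Function.comp_apply,
    Finset.prod_pow, Fin.snoc_castSucc, Fin.snoc_last]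
  exact ⟨w ^ n * (∏ k, (X k - x)) * wtB w b x a * (∏ k, wtB w b x (y k)) ^ 2 *
    (∏ k, wtB w b (X k) a) ^ 2 * wtB w b x z' * wtB w b z a, by ring⟩

theorem oddDefect'_eq_of_wtB_eq_zero (b : Bool) {w x a : K} (h : wtB w (!b) x a = 0) (z z' : K)
    {n : ℕ} (X y : Fin n → K) :
    ∃ c, oddDefect' w z z' (Fin.cons x X : Fin (n + 1) → K) (Fin.cons a y : Fin (n + 1) → K) =
      c * oddDefect' w z z' X y := by
  have e : newtonDet w (Fin.cons z (Fin.cons x X : Fin (n + 1) → K) : Fin (n + 2) → K)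
      (Fin.cons z' (Fin.cons a y : Fin (n + 1) → K) : Fin (n + 2) → K) =
      -newtonDet w (Fin.cons x (Fin.cons z X : Fin (n + 1) → K) : Fin (n + 2) → K)
      (Fin.cons a (Fin.cons z' y : Fin (n + 1) → K) : Fin (n + 2) → K) := by
    rw [← cons_cons_comp_swap x z, ← cons_cons_comp_swap a z', newtonDet_comp_perm,
      newtonDet_perm_comp, Equiv.Perm.sign_swap (by simp [Fin.ext_iff])]
    simp
  rw [oddDefect', oddDefect', e, List.ofFn_cons, Zodd_eq_of_wtB_eq_zero b h,
    newtonDet_eq_of_wtB_eq_zero b h, det_vandermonde_cons, det_vandermonde_cons,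
    det_vandermonde_cons, Zdw_eq_of_wtB_eq_zero b h, Nat.choose_succ_succ' (n + 1) 1,
    Nat.choose_one_right, pow_add]
  simp only [List.map_cons, List.prod_cons, List.map_ofFn, List.prod_ofFn, Function.comp_apply,
    Finset.prod_pow, Fin.prod_univ_succ, Fin.cons_zero, Fin.cons_succ]
  exact ⟨w ^ (n + 1) * (x - z) * (∏ k, (X k - x)) * wtB w b x a * (∏ k, wtB w b x (y k)) ^ 2 *
    (∏ k, wtB w b (X k) a) ^ 2 * wtB w b x z' * wtB w b z a, by ring⟩

/-- The parameter `z'` of the central column is in general position to the row parameters `X`. -/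
structure GenericCol (w : K) {n : ℕ} (X : Fin n → K) (z' : K) : Prop where
  gam_ne : gam w z' ≠ 0
  ne_one : z' ≠ 1
  add_ne : w - 1 + z' ≠ 0
  wt_ne : ∀ i, wtE w (X i) z' ≠ 0 ∧ wtN w (X i) z' ≠ 0

theorem GenericCol.comp {w : K} {m n : ℕ} {X : Fin n → K} {z' : K} (h : GenericCol w X z')
    (f : Fin m → Fin n) : GenericCol w (X ∘ f) z' :=
  ⟨h.gam_ne, h.ne_one, h.add_ne, fun _ => h.wt_ne _⟩

theorem oddDefect_of_wtB_eq_zero (b : Bool) {w z z' : K} (hw : w ≠ 0) (h : wtB w (!b) z z' = 0)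
    {n : ℕ} {X : Fin n → K} (hX : GenericRows w X) (hz : GenericCol w X z') (y : Fin n → K) :
    oddDefect w z z' X y = 0 := by
  have e : wtE w z z' + wtN w z z' = wtB w b z z' := by
    cases b <;> simp [wtB] at h ⊢ <;> simp [h]
  rw [oddDefect, e, Zodd_one_of_wtB_eq_zero b h y
    (by simpa only [List.forall_mem_ofFn_iff] using hz.wt_ne), Zdw_snoc_eq_cons,
    Zdw_eq_of_wtB_eq_zero b h]
  linear_combination (∏ k, wtB w b z (y k)) *
    ((List.ofFn X).map fun x => wtB w b x z').prod * Zht_eq hw hX y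

/-- When one of the weights `wtE`, `wtN` vanishes, the second pair of central weights is a multiple
of the first. -/
theorem wtB_sq {w z z' : K} (b : Bool) (h : wtB w (!b) z z' = 0) :
    w * gam w z * gam w z' = wtB w b z z' * wtB w b z z' := by
  cases b <;> simp only [wtB, Bool.not_true, Bool.not_false, cond_true, cond_false] at h ⊢
  · have e : w * gam w z * gam w z' = wtE w z z' ^ 2 + wtN w z z' ^ 2 +
        (w - 2) * wtE w z z' * wtN w z z' := by
      simp only [wtE, wtN, gam]; ring
    rw [e, h]; ring
  · have e : w * gam w z * gam w z' = wtE w z z' ^ 2 + wtN w z z' ^ 2 +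
        (w - 2) * wtE w z z' * wtN w z z' := by
      simp only [wtE, wtN, gam]; ring
    rw [e, h]; ring

theorem oddDefect'_of_wtB_eq_zero (b : Bool) {w z z' : K} (hw : w ≠ 0) (h : wtB w (!b) z z' = 0)
    {n : ℕ} {X : Fin n → K} (hX : GenericRows w X) (hz : GenericCol w X z') (y : Fin n → K) :
    oddDefect' w z z' X y = 0 := by
  have e : wtE w z z' + wtN w z z' = wtB w b z z' * 1 := by
    cases b <;> simp [wtB] at h ⊢ <;> simp [h]
  rw [oddDefect', e, wtB_sq b h, Zodd_mul, Zodd_one_of_wtB_eq_zero b h y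
    (by simpa only [List.forall_mem_ofFn_iff] using hz.wt_ne), newtonDet_eq_of_wtB_eq_zero b h,
    det_vandermonde_cons, Nat.choose_succ_succ' n 1, Nat.choose_one_right, pow_add]
  simp only [List.map_ofFn, List.prod_ofFn, Function.comp_apply]
  linear_combination w ^ n * (∏ k, (X k - z)) * wtB w b z z' * (∏ k, wtB w b z (y k)) *
    (∏ k, wtB w b (X k) z') * Zht_eq hw hX y

end OddLinear

/-! ### Moving the columns to a root of `gam` -/

section ColumnInduction
variable {K : Type*} [Field K]

/-- A symmetric property of vectors that holds for the constant vector `c`, and that persists when a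
coordinate equal to `c` is changed, holds for all vectors. -/
theorem column_induction {α : Type*} {n : ℕ} {P : (Fin (n + 1) → α) → Prop} (c : α)
    (hperm : ∀ (σ : Equiv.Perm (Fin (n + 1))) y, P (y ∘ σ) ↔ P y) (h0 : P fun _ => c)
    (hstep : ∀ y : Fin n → α, P (Fin.cons c y : Fin (n + 1) → α) →
      ∀ a, P (Fin.cons a y : Fin (n + 1) → α)) (y : Fin (n + 1) → α) : P y := by
  classical
  have key : ∀ (s : Finset (Fin (n + 1))) (y : Fin (n + 1) → α), (∀ k, k ∉ s → y k = c) → P y := by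
    intro s
    induction s using Finset.induction_on with
    | empty =>
      intro y hy
      rwa [show y = fun _ => c from funext fun k => hy k (by simp)]
    | insert k s _ ih =>
      intro y hy
      have h1 := ih (Function.update y k c) fun j hj => by
        by_cases hjk : j = k
        · subst hjk; simp
        · rw [Function.update_of_ne hjk]; exact hy j (by simp [hj, hjk])
      rw [← hperm (Equiv.swap 0 k), comp_swap_zero_eq_cons, Function.update_self] at h1
      have h2 := hstep _ h1 (y k)
      have e : Fin.tail (Function.update y k c ∘ Equiv.swap 0 k) =
          Fin.tail (y ∘ Equiv.swap 0 k) := by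
        ext j
        have : Equiv.swap 0 k j.succ ≠ k := by
          intro h
          rw [Equiv.swap_apply_eq_iff, Equiv.swap_apply_right] at h
          exact Fin.succ_ne_zero j h
        simp [Fin.tail, Function.update_of_ne this]
      rw [e, ← comp_swap_zero_eq_cons, hperm] at h2
      exact h2
  exact key Finset.univ y fun k hk => absurd (Finset.mem_univ k) hk

theorem wtE_root {w y0 : K} (h : gam w y0 = 0) (x : K) : wtE w x y0 = (1 - y0) * (y0 - x) := by
  simp only [wtE, gam] at h ⊢; linear_combination h

theorem root_ne {w y0 : K} (hw : w ≠ 0) (h : gam w y0 = 0) : y0 ≠ 0 ∧ 1 - y0 ≠ 0 := by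
  constructor
  · rintro rfl; simp [gam] at h
  · intro h1
    rw [← sub_eq_zero.1 h1] at h
    simp only [gam] at h
    exact hw (by linear_combination h)

theorem wtN_root {w y0 : K} (hw : w ≠ 0) (h : gam w y0 = 0) (x : K) :
    wtN w x y0 = (1 - y0) / y0 * (y0 - x) := by
  have h0 := (root_ne hw h).1
  rw [div_mul_eq_mul_div, eq_div_iff h0]
  simp only [wtN, gam] at h ⊢; linear_combination x * h

theorem wtB_root_ne {w y0 x : K} (hw : w ≠ 0) (h : gam w y0 = 0) (hx : gam w x ≠ 0) (b : Bool) :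
    wtB w b x y0 ≠ 0 := by
  obtain ⟨h0, h1⟩ := root_ne hw h
  have h2 : y0 - x ≠ 0 := by
    intro e; rw [← sub_eq_zero.1 e] at hx; exact hx h
  cases b
  · simp only [wtB, cond_false, wtE_root h]; exact mul_ne_zero h1 h2
  · simp only [wtB, cond_true, wtN_root hw h]; exact mul_ne_zero (div_ne_zero h1 h0) h2

theorem isPolyDeg_oddDefect (w z z' : K) {n : ℕ} (X : Fin (n + 1) → K) (y : Fin n → K) :
    IsPolyDeg (2 * n + 2) fun a => oddDefect w z z' X (Fin.cons a y : Fin (n + 1) → K) := by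
  simp only [oddDefect, ← Fin.cons_snoc_eq_snoc_cons]
  refine (((isPolyDeg_Zodd w _ _ z z' (List.ofFn X) y).const_mul _).mono ?_).sub
    (((isPolyDeg_Zdw w (z :: List.ofFn X) _).mul (isPolyDeg_newtonDet w X y)).mono ?_) <;>
  · simp only [List.length_cons, List.length_ofFn]; push_cast; linarith

theorem isPolyDeg_oddDefect' (w z z' : K) {n : ℕ} (X : Fin (n + 1) → K) (y : Fin n → K) :
    IsPolyDeg (2 * n + 2) fun a => oddDefect' w z z' X (Fin.cons a y : Fin (n + 1) → K) := by
  have e : ∀ a, newtonDet w (Fin.cons z X : Fin (n + 2) → K)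
      (Fin.cons z' (Fin.cons a y : Fin (n + 1) → K) : Fin (n + 2) → K) =
      newtonDet w (Fin.cons z X : Fin (n + 2) → K)
      (Fin.cons a (Fin.cons z' y : Fin (n + 1) → K) : Fin (n + 2) → K) := by
    intro a
    rw [← cons_cons_comp_swap a z', newtonDet_comp_perm]
  simp only [oddDefect', e]
  refine (((isPolyDeg_Zodd w _ _ z z' (List.ofFn X) y).const_mul _).mono ?_).sub
    (((isPolyDeg_Zdw w (List.ofFn X) _).mul (isPolyDeg_newtonDet w _ _)).mono ?_) <;>
  · simp only [List.length_ofFn]; push_cast; linarith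

/-- A function of the column variables that vanishes at the freezing points of the first column and
has degree at most `2n + 2` in that column vanishes as soon as it vanishes when that column is at a
root of `gam`. -/
theorem eq_zero_of_root {w y0 : K} (hw : w ≠ 0) (h0 : gam w y0 = 0) {n : ℕ} {X : Fin (n + 1) → K}
    (hX : GenericRows w X) {f : K → K} (hf : IsPolyDeg (2 * n + 2) f)
    (hroot : ∀ b i, f (colRoot w b (X i)) = 0) (hy0 : f y0 = 0) (a : K) : f a = 0 := by
  refine hf.eq_zero (r := fun o : Option (Bool × Fin (n + 1)) =>
    o.elim y0 fun p => colRoot w p.1 (X p.2)) ?_ ?_ ?_ a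
  · intro o o' h
    have hne : ∀ b i, y0 ≠ colRoot w b (X i) := by
      intro b i e
      have h1 := wtB_colRoot (hX.ne_one i) (hX.add_ne i) b
      rw [← e] at h1
      refine wtB_root_ne hw h0 ?_ _ h1
      have := hX.braidF_ne i i
      rwa [show braidF w (X i) (X i) = gam w (X i) by simp only [braidF, gam]; ring] at this
    rcases o with _ | p <;> rcases o' with _ | p'
    · rfl
    · exact absurd h (hne _ _)
    · exact absurd h.symm (hne _ _)
    · rw [hX.colRoot_injective hw h]
  · rintro (_ | ⟨b, i⟩)
    · exact hy0
    · exact hroot b i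
  · simp only [Fintype.card_option, Fintype.card_prod, Fintype.card_bool, Fintype.card_fin]
    push_cast; linarith

end ColumnInduction

/-! ### Columns at a root of `gam` and the identities of odd order -/

section RootColumns
variable {K : Type*} [Field K]

/-- Entries `-1` do not occur in columns at a root of `gam`. -/
theorem rowT_true_false_root {w y0 : K} (h : gam w y0 = 0) (z : K) (n : ℕ) :
    rowT w z (fun _ : Fin n => y0) true false = 0 := by
  induction n with
  | zero => ext v u; simp [rowT_zero]
  | succ n ih =>
    ext v u
    have ht : Fin.tail (fun _ : Fin (n + 1) => y0) = fun _ => y0 := rfl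
    simp only [rowT_apply_succ, Fintype.sum_bool, ht, ih]
    cases v 0 <;> cases u 0 <;> simp [vertexWt, h]

/-- With all columns at a root `y0` of `gam`, both weights of an entry `0` are multiples of
`y0 - z`; so the row operator depends on `z` only through a power of `y0 - z`. -/
theorem rowT_diag_root {w y0 : K} (hw : w ≠ 0) (h : gam w y0 = 0) (n : ℕ) (a : Bool) :
    ∃ D : Matrix (Fin n → Bool) (Fin n → Bool) K, ∀ z,
      rowT w z (fun _ : Fin n => y0) a a = (y0 - z) ^ n • D := by
  induction n with
  | zero => exact ⟨rowT w 0 (fun _ : Fin 0 => y0) a a, fun z => by ext v u; simp [rowT_zero]⟩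
  | succ n ih =>
    obtain ⟨D, hD⟩ := ih
    refine ⟨Matrix.of fun v u => (bif v 0 then bif u 0 then bif a then 1 - y0 else (1 - y0) / y0
      else 0 else bif u 0 then 0 else bif a then (1 - y0) / y0 else 1 - y0) *
        D (Fin.tail v) (Fin.tail u), fun z => ?_⟩
    ext v u
    have ht : Fin.tail (fun _ : Fin (n + 1) => y0) = fun _ => y0 := rfl
    have hD' := fun v u => congrFun (congrFun (hD z) v) u
    simp only [Matrix.smul_apply, smul_eq_mul] at hD'
    simp only [rowT_apply_succ, Fintype.sum_bool, ht, Matrix.smul_apply, Matrix.of_apply,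
      smul_eq_mul]
    cases a <;> cases v 0 <;> cases u 0 <;>
      simp [vertexWt, hD', rowT_true_false_root h, h, wtE_root h, wtN_root hw h] <;> ring

/-- A row that enters in the state `false` and leaves in the state `true` has exactly one entry `1`,
whose weight carries no factor `y0 - z`. -/
theorem rowT_false_true_root {w y0 : K} (hw : w ≠ 0) (h : gam w y0 = 0) (n : ℕ) :
    ∃ B : Matrix (Fin n → Bool) (Fin n → Bool) K, ∀ z,
      (y0 - z) • rowT w z (fun _ : Fin n => y0) false true = (y0 - z) ^ n • B := by
  induction n with
  | zero => exact ⟨0, fun z => by ext v u; simp [rowT_zero]⟩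
  | succ n ih =>
    obtain ⟨B, hB⟩ := ih
    obtain ⟨D, hD⟩ := rowT_diag_root hw h n true
    refine ⟨Matrix.of fun v u => bif v 0 then bif u 0 then (1 - y0) / y0 *
        B (Fin.tail v) (Fin.tail u) else 0 else bif u 0 then D (Fin.tail v) (Fin.tail u)
        else (1 - y0) * B (Fin.tail v) (Fin.tail u), fun z => ?_⟩
    ext v u
    have ht : Fin.tail (fun _ : Fin (n + 1) => y0) = fun _ => y0 := rfl
    have hB' := fun v u => congrFun (congrFun (hB z) v) u
    have hD' := fun v u => congrFun (congrFun (hD z) v) u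
    simp only [Matrix.smul_apply, smul_eq_mul] at hB' hD'
    simp only [rowT_apply_succ, Fintype.sum_bool, ht, Matrix.smul_apply, Matrix.of_apply,
      smul_eq_mul]
    cases v 0 <;> cases u 0 <;>
      simp only [vertexWt, hD', h, wtE_root h, wtN_root hw h, zero_mul, zero_add, add_zero,
        one_mul, mul_zero, cond_true, cond_false]
    · linear_combination (1 - y0) * (y0 - z) * hB' (Fin.tail v) (Fin.tail u)
    · ring
    · linear_combination (1 - y0) / y0 * (y0 - z) * hB' (Fin.tail v) (Fin.tail u)

/-- With all columns at a root of `gam` the odd partition function is, up to a power of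
`y0 - z`, linear in the two central weights with coefficients independent of `z`. -/
theorem Zodd_root {w y0 : K} (hw : w ≠ 0) (h : gam w y0 = 0) (z' : K) (xs : List K) (n : ℕ) :
    ∃ α β : K, ∀ p r z, Zodd w p ((y0 - z) * r) z z' xs (fun _ : Fin n => y0) =
      (y0 - z) ^ n * (p * α + r * β) := by
  obtain ⟨D, hD⟩ := rowT_diag_root hw h n false
  obtain ⟨B, hB⟩ := rowT_false_true_root hw h n
  set B1 : Matrix (Fin (n + 1) → Bool) (Fin n → Bool) K :=
    Matrix.of fun v u => bif v (Fin.last n) then 0 else D (Fin.init v) u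
  set B2 : Matrix (Fin (n + 1) → Bool) (Fin n → Bool) K :=
    Matrix.of fun v u => bif v (Fin.last n) then B (Fin.init v) u else 0
  set y : Fin n → K := fun _ => y0
  set N := nest (fun x => rowT w x (Fin.snoc y z' : Fin (n + 1) → K)) (fun x => rowT w x y)
  refine ⟨N B1 xs bot top, N B2 xs bot top, fun p r z => ?_⟩
  have e : oddBase w p ((y0 - z) * r) z y =
      ((y0 - z) ^ n * p) • B1 + ((y0 - z) ^ n * r) • B2 := by
    ext v u
    have hB' := fun v u => congrFun (congrFun (hB z) v) u
    have hD' := fun v u => congrFun (congrFun (hD z) v) u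
    simp only [Matrix.smul_apply, smul_eq_mul] at hB' hD'
    simp only [oddBase, Matrix.of_apply, Matrix.add_apply, Matrix.smul_apply, smul_eq_mul, B1, B2]
    cases v (Fin.last n)
    · simp only [cond_false, mul_zero, add_zero]
      rw [hD']; ring
    · simp only [cond_true, mul_zero, zero_add]
      linear_combination r * hB' (Fin.init v) u
  rw [Zodd, e, nest_add_base, nest_smul_base, nest_smul_base]
  simp only [Matrix.add_apply, Matrix.smul_apply, smul_eq_mul, N]
  ring

/-- With all columns but one at a root of `gam`, the dependence of the domain wall partition
function on a row parameter. -/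
theorem Zdw_root {w y0 : K} (hw : w ≠ 0) (h : gam w y0 = 0) (z' : K) (xs : List K) (n : ℕ) :
    ∃ α β : K, ∀ z, (y0 - z) * Zdw w (z :: xs)
      (Fin.snoc (fun _ : Fin n => y0) z' : Fin (n + 1) → K) =
      (y0 - z) ^ n * ((y0 - z) * α + wtN w z z' * β) := by
  obtain ⟨D, hD⟩ := rowT_diag_root hw h n false
  obtain ⟨B, hB⟩ := rowT_false_true_root hw h n
  set y : Fin n → K := fun _ => y0
  set M := dwProd w (Fin.snoc y z' : Fin (n + 1) → K) xs
  refine ⟨∑ u, D bot u * M (Fin.snoc u true) top, ∑ u, B bot u * M (Fin.snoc u false) top,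
    fun z => ?_⟩
  have hB' := fun v u => congrFun (congrFun (hB z) v) u
  have hD' := fun v u => congrFun (congrFun (hD z) v) u
  simp only [Matrix.smul_apply, smul_eq_mul] at hB' hD'
  have e : Zdw w (z :: xs) (Fin.snoc y z' : Fin (n + 1) → K) =
      (rowT w z (Fin.snoc y z' : Fin (n + 1) → K) false true * M) bot top := by
    simp [Zdw, dwProd, M]
  rw [e, Matrix.mul_apply, bot_snoc]
  simp only [sum_snoc, rowT_snoc, Fintype.sum_bool, vertexWt, mul_zero, zero_add, add_zero,
    mul_one]
  rw [Finset.sum_add_distrib]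
  simp only [hD', Finset.mul_sum, mul_add]
  congr 1
  · exact Finset.sum_congr rfl fun u _ => by ring
  · refine Finset.sum_congr rfl fun u _ => ?_
    linear_combination wtN w z z' * M (Fin.snoc u false) top * hB' bot u

theorem isPolyDeg_sub_left (c : K) : IsPolyDeg 1 fun x : K => c - x := by
  simpa [sub_eq_add_neg] using isPolyDeg_linear c (-1)

theorem isPolyDeg_wtE_left (w y : K) : IsPolyDeg 1 fun x => wtE w x y := by
  convert isPolyDeg_linear (1 + (w - 1) * y) (y - 1) using 2
  simp only [wtE]; ring

theorem isPolyDeg_wtN_left (w y : K) : IsPolyDeg 1 fun x => wtN w x y := by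
  convert isPolyDeg_linear (1 - y) (w - 1 + y) using 2
  simp only [wtN]; ring

/-- The weights `wtE` and `wtN` do not vanish together at the centre. -/
theorem GenericCol.colRoot_ne {w : K} (hw : w ≠ 0) {n : ℕ} {X : Fin n → K} {z' : K}
    (hz : GenericCol w X z') {b c : Bool} {z : K} (h : wtB w (!b) z z' = 0)
    (h' : wtB w (!c) z z' = 0) : b = c := by
  by_contra hbc
  have h1 : wtE w z z' = 0 ∧ wtN w z z' = 0 := by
    cases b <;> cases c <;> simp [wtB] at hbc h h' <;> exact ⟨by assumption, by assumption⟩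
  have h2 : wtN w z z' * (1 - z') = w * gam w z' := by
    have := h1.1
    simp only [wtE, wtN, gam] at this ⊢
    linear_combination (1 - w - z') * this
  rw [h1.2, zero_mul, eq_comm] at h2
  exact (mul_ne_zero hw hz.gam_ne) h2

theorem gam_ne_of_wtB_eq_zero {w z z' : K} (hw : w ≠ 0) (hz : gam w z' ≠ 0) (b : Bool)
    (h : wtB w b z z' = 0) : gam w z ≠ 0 := by
  intro hg
  rw [wtB] at h
  have := wtB_root_ne hw hg hz (!b)
  cases b
  · exact this (by simpa [wtB, wtE_eq_wtN_swap w z] using h)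
  · exact this (by simpa [wtB, wtN_eq_wtE_swap w z] using h)

/-- Up to exchanging `wtE` and `wtN`, rows and columns play symmetric parts, so `colRoot` also gives
the row parameters at which a weight of an entry `0` in the column `z'` vanishes. -/
theorem wtB_centralRoot {w z' : K} (h1 : z' ≠ 1) (h2 : w - 1 + z' ≠ 0) (b : Bool) :
    wtB w (!b) (colRoot w (!b) z') z' = 0 := by
  have h := wtB_colRoot h1 h2 (!b)
  cases b
  · simpa [wtB, wtN_eq_wtE_swap w _ z'] using h
  · simpa [wtB, wtE_eq_wtN_swap w _ z'] using h

/-- The defect is, up to a power of `y0 - z`, of degree one in `z`, and vanishes at the two values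
of `z` at which one of the weights of an entry `0` at the centre vanishes. -/
theorem oddDefect_root {w y0 z z' : K} (hw : w ≠ 0) (h0 : gam w y0 = 0) {n : ℕ} {X : Fin n → K}
    (hX : GenericRows w X) (hz : GenericCol w X z') (hzg : gam w z ≠ 0) :
    oddDefect w z z' X (fun _ => y0) = 0 := by
  obtain ⟨α, β, hα⟩ := Zodd_root hw h0 z' (List.ofFn X) n
  obtain ⟨α', β', hα'⟩ := Zdw_root hw h0 z' (List.ofFn X) n
  have key : ∀ z, ∃ l, (y0 - z) * oddDefect w z z' X (fun _ => y0) = (y0 - z) ^ n * l ∧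
      l = w ^ n.choose 2 * (vandermonde X).det *
        ((y0 - z) * α + (wtE w z z' + wtN w z z') * β) -
      ((y0 - z) * α' + wtN w z z' * β') * newtonDet w X (fun _ => y0) := by
    intro z
    refine ⟨_, ?_, rfl⟩
    rw [oddDefect, mul_sub, ← mul_assoc _ (Zdw _ _ _), hα',
      mul_left_comm (y0 - z), ← Zodd_mul, hα]
    ring
  choose l hl hl' using key
  have hdeg : IsPolyDeg 1 l := by
    rw [show l = _ from funext hl']
    exact ((((isPolyDeg_sub_left y0).mul_const α).add
      (((isPolyDeg_wtE_left w z').add (isPolyDeg_wtN_left w z')).mul_const β)).const_mul _).sub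
      ((((isPolyDeg_sub_left y0).mul_const α').add
      ((isPolyDeg_wtN_left w z').mul_const β')).mul_const _)
  have hne : ∀ z, gam w z ≠ 0 → y0 - z ≠ 0 := by
    intro z hz e; rw [← sub_eq_zero.1 e] at hz; exact hz h0
  have hl0 : l z = 0 := by
    refine hdeg.eq_zero (r := fun b : Bool => colRoot w (!b) z') ?_ ?_ (by simp) z
    · intro b c hbc
      have hb := wtB_centralRoot hz.ne_one hz.add_ne b
      have hc := wtB_centralRoot hz.ne_one hz.add_ne c
      dsimp only at hbc
      rw [← hbc] at hc
      exact hz.colRoot_ne hw hb hc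
    · intro b
      have hb := wtB_centralRoot hz.ne_one hz.add_ne b
      have h1 := hl (colRoot w (!b) z')
      rw [oddDefect_of_wtB_eq_zero b hw hb hX hz, mul_zero, eq_comm] at h1
      exact (mul_eq_zero.1 h1).resolve_left
        (pow_ne_zero _ (hne _ (gam_ne_of_wtB_eq_zero hw hz.gam_ne _ hb)))
  have h1 := hl z
  rw [hl0, mul_zero] at h1
  exact (mul_eq_zero.1 h1).resolve_left (hne z hzg)

theorem newtonRow_zero (w x : K) {n : ℕ} (y : Fin (n + 1) → K) :
    newtonRow w y x 0 = newtonHead w y x := rfl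

theorem newtonRow_succ (w x : K) {n : ℕ} (y : Fin (n + 1) → K) (j : Fin n) :
    newtonRow w y x j.succ = wtE w x (y 0) * wtN w x (y 0) * newtonRow w (Fin.tail y) x j := rfl

theorem newtonRow_root {w y0 : K} (hw : w ≠ 0) (h0 : gam w y0 = 0) (z' : K) (n : ℕ)
    (j : Fin (n + 1)) : ∃ q : K → K, IsPolyDeg (n + 1) q ∧ ∀ z,
      newtonRow w (Fin.snoc (fun _ : Fin n => y0) z' : Fin (n + 1) → K) z j =
        (y0 - z) ^ n * q z := by
  have hh : ∀ n : ℕ, ∃ q : K → K, IsPolyDeg (n + 1) q ∧ ∀ z,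
      newtonHead w (Fin.snoc (fun _ : Fin n => y0) z' : Fin (n + 1) → K) z =
        (y0 - z) ^ n * q z := by
    intro n
    refine ⟨fun z => (1 - z) ^ n * ((1 - y0) ^ n * wtE w z z') +
      (-(w - 1) - z) ^ n * (((1 - y0) / y0) ^ n * wtN w z z'), ?_, fun z => ?_⟩
    · refine ((((isPolyDeg_sub_left 1).pow n).mul ((isPolyDeg_wtE_left w z').const_mul _)).mono
        (by simp)).add ((((isPolyDeg_sub_left _).pow n).mul
          ((isPolyDeg_wtN_left w z').const_mul _)).mono (by simp))
    · simp only [newtonHead, Fin.prod_univ_castSucc, Fin.snoc_castSucc, Fin.snoc_last,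
        wtE_root h0, wtN_root hw h0, Finset.prod_const, Finset.card_univ, Fintype.card_fin, mul_pow]
      ring
  induction n with
  | zero =>
    refine Fin.cases ?_ (fun j => j.elim0) j
    simpa only [newtonRow_zero] using hh 0
  | succ n ih =>
    refine Fin.cases ?_ (fun j => ?_) j
    · simpa only [newtonRow_zero] using hh (n + 1)
    · obtain ⟨q, hq, hq'⟩ := ih j
      refine ⟨fun z => (1 - y0) * ((1 - y0) / y0) * ((y0 - z) * q z), ?_, fun z => ?_⟩
      · refine (((isPolyDeg_sub_left y0).mul hq).const_mul _).mono (le_of_eq ?_)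
        push_cast; ring
      · simp only [newtonRow_succ, tail_snoc, snoc_apply_zero']
        rw [show Fin.tail (fun _ : Fin (n + 1) => y0) = fun _ => y0 from rfl, hq', wtE_root h0,
          wtN_root hw h0]
        ring

/-- The determinant is expanded along the row of the central parameter `z`. -/
theorem newtonDet_root {w y0 : K} (hw : w ≠ 0) (h0 : gam w y0 = 0) (z' : K) {n : ℕ}
    (X : Fin n → K) : ∃ q : K → K, IsPolyDeg (n + 1) q ∧ ∀ z,
      newtonDet w (Fin.cons z X : Fin (n + 1) → K)
        (Fin.cons z' (fun _ => y0) : Fin (n + 1) → K) = (y0 - z) ^ n * q z := by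
  choose q hq hq' using newtonRow_root hw h0 z' n
  refine ⟨fun z => ∑ j : Fin (n + 1), (-1) ^ (j : ℕ) * q j z *
    ((Matrix.of fun i j => newtonRow w (Fin.snoc (fun _ : Fin n => y0) z' : Fin (n + 1) → K)
      ((Fin.cons 0 X : Fin (n + 1) → K) i) j).submatrix Fin.succ j.succAbove).det, ?_, fun z => ?_⟩
  · exact IsPolyDeg.sum _ fun j _ => ((hq j).const_mul _).mul_const _
  · rw [← newtonDet_comp_perm w _ _ (finRotate (n + 1)), ← snoc_eq_cons_comp, newtonDet,
      Matrix.det_succ_row_zero, Finset.mul_sum]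
    refine Finset.sum_congr rfl fun j _ => ?_
    have : ∀ a, ((Matrix.of fun i j => newtonRow w
        (Fin.snoc (fun _ : Fin n => y0) z' : Fin (n + 1) → K)
        ((Fin.cons a X : Fin (n + 1) → K) i) j).submatrix Fin.succ j.succAbove) =
        Matrix.of fun i j' => newtonRow w (Fin.snoc (fun _ : Fin n => y0) z' : Fin (n + 1) → K)
          (X i) (j.succAbove j') := by
      intro a; ext i j'; simp
    rw [this, this, Matrix.of_apply, Fin.cons_zero, hq']
    ring

theorem oddDefect'_of_mem {w z z' : K} {n : ℕ} (X y : Fin n → K) (i : Fin n) (h : X i = z) :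
    oddDefect' w z z' X y = 0 := by
  have h1 : (vandermonde (Fin.cons z X : Fin (n + 1) → K)).det = 0 :=
    Matrix.det_zero_of_row_eq (Fin.succ_ne_zero i).symm (by ext j; simp [vandermonde, h])
  have h2 : newtonDet w (Fin.cons z X : Fin (n + 1) → K) (Fin.cons z' y : Fin (n + 1) → K) = 0 :=
    Matrix.det_zero_of_row_eq (Fin.succ_ne_zero i).symm (by ext j; simp [h])
  rw [oddDefect', h1, h2]; ring

/-- The defect is, up to a power of `y0 - z`, of degree `n + 1` in `z`, and vanishes at the two
values of `z` at which one of the weights of an entry `0` at the centre vanishes, and when `z` is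
one of the `n` other row parameters. -/
theorem oddDefect'_root {w y0 : K} (hw : w ≠ 0) (h0 : gam w y0 = 0) (z z' : K) {n : ℕ}
    {X : Fin n → K} (hX : GenericRows w X) (hz : GenericCol w X z') :
    oddDefect' w z z' X (fun _ => y0) = 0 := by
  obtain ⟨α, β, hα⟩ := Zodd_root hw h0 z' (List.ofFn X) n
  obtain ⟨q, hq, hq'⟩ := newtonDet_root hw h0 z' X
  obtain ⟨hy0, -⟩ := root_ne hw h0
  -- The roots of `gam` are `y0` and its inverse.
  have hgam : ∀ z, gam w z = (y0 - z) * (y0⁻¹ - z) := by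
    intro z
    have e : y0⁻¹ = 2 - w - y0 := by
      rw [inv_eq_iff_eq_inv, eq_comm, inv_eq_iff_eq_inv, ← one_div, eq_div_iff hy0]
      simp only [gam] at h0; linear_combination -h0
    rw [e]; simp only [gam] at h0 ⊢; linear_combination h0
  have key : ∀ z, ∃ l, oddDefect' w z z' X (fun _ => y0) = (y0 - z) ^ n * l ∧
      l = (∏ i, (X i - z)) * (w ^ (n + 1).choose 2 * (vandermonde X).det *
        ((wtE w z z' + wtN w z z') * α + (y0⁻¹ - z) * (w * gam w z' * β))) -
      Zdw w (List.ofFn X) (fun _ : Fin n => y0) * q z := by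
    intro z
    refine ⟨_, ?_, rfl⟩
    rw [oddDefect', hq', det_vandermonde_cons,
      show w * gam w z * gam w z' = (y0 - z) * (w * (y0⁻¹ - z) * gam w z') by rw [hgam]; ring, hα]
    ring
  choose l hl hl' using key
  have hdeg : IsPolyDeg (n + 1) l := by
    rw [show l = _ from funext hl']
    have hp : IsPolyDeg n fun z : K => ∏ i, (X i - z) := by
      simpa using IsPolyDeg.prod Finset.univ fun i _ => isPolyDeg_sub_left (X i)
    exact (hp.mul (((((isPolyDeg_wtE_left w z').add (isPolyDeg_wtN_left w z')).mul_const α).add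
      ((isPolyDeg_sub_left y0⁻¹).mul_const _)).const_mul _)).sub (hq.const_mul _)
  have hne : ∀ z, gam w z ≠ 0 → y0 - z ≠ 0 := by
    intro z hz e; rw [← sub_eq_zero.1 e] at hz; exact hz h0
  rw [hl, hdeg.eq_zero (r := Sum.elim (fun b : Bool => colRoot w (!b) z') X) ?_ ?_ ?_ z, mul_zero]
  · have hcb := fun b => wtB_centralRoot hz.ne_one hz.add_ne b
    have hxb : ∀ b i, colRoot w (!b) z' ≠ X i := by
      intro b i e
      have := hcb b
      rw [e] at this
      cases b
      · exact (hz.wt_ne i).2 (by simpa [wtB] using this)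
      · exact (hz.wt_ne i).1 (by simpa [wtB] using this)
    refine Function.Injective.sumElim ?_ hX.inj hxb
    intro b c hbc
    have hc := hcb c
    dsimp only at hbc
    rw [← hbc] at hc
    exact hz.colRoot_ne hw (hcb b) hc
  · rintro (b | i)
    · have hb := wtB_centralRoot hz.ne_one hz.add_ne b
      have h1 := hl (colRoot w (!b) z')
      rw [oddDefect'_of_wtB_eq_zero b hw hb hX hz, eq_comm] at h1
      exact (mul_eq_zero.1 h1).resolve_left
        (pow_ne_zero _ (hne _ (gam_ne_of_wtB_eq_zero hw hz.gam_ne _ hb)))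
    · have h1 := hl (X i)
      rw [oddDefect'_of_mem X _ i rfl, eq_comm] at h1
      refine (mul_eq_zero.1 h1).resolve_left (pow_ne_zero _ (hne _ ?_))
      have := hX.braidF_ne i i
      rwa [show braidF w (X i) (X i) = gam w (X i) by simp only [braidF, gam]; ring] at this
  · simp only [Fintype.card_sum, Fintype.card_bool, Fintype.card_fin]; push_cast; linarith

theorem GenericCol.tail {w : K} {n : ℕ} {X : Fin (n + 1) → K} {z' : K} (h : GenericCol w X z')
    (σ : Equiv.Perm (Fin (n + 1))) : GenericCol w (Fin.tail (X ∘ σ)) z' :=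
  h.comp (σ ∘ Fin.succ)

/-- The identity for the central weights `1` and `wtE + wtN`, by induction on the size; at fixed
size the columns are moved one by one to a root of `gam`. -/
theorem oddDefect_eq_zero {w y0 z z' : K} (hw : w ≠ 0) (h0 : gam w y0 = 0) (hzg : gam w z ≠ 0)
    {n : ℕ} {X : Fin n → K} (hX : GenericRows w X) (hz : GenericCol w X z') (y : Fin n → K) :
    oddDefect w z z' X y = 0 := by
  induction n with
  | zero =>
    rw [Subsingleton.elim y fun _ => y0]
    exact oddDefect_root hw h0 hX hz hzg
  | succ n ih =>
    refine column_induction (P := fun y => oddDefect w z z' X y = 0) y0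
      (fun σ y => by rw [oddDefect_comp_perm]) (oddDefect_root hw h0 hX hz hzg)
      (fun y hy a => ?_) y
    refine eq_zero_of_root hw h0 hX (isPolyDeg_oddDefect w z z' X y) (fun b i => ?_) hy a
    have hb := wtB_colRoot (hX.ne_one i) (hX.add_ne i) b
    refine (mul_eq_zero.1 ?_).resolve_left (sign_ne_zero (K := K) (Equiv.swap 0 i))
    rw [← oddDefect_perm_comp, comp_swap_zero_eq_cons]
    obtain ⟨c, hc⟩ := oddDefect_eq_of_wtB_eq_zero b hb z z' (Fin.tail (X ∘ Equiv.swap 0 i)) y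
    rw [hc, ih (hX.tail _) (hz.tail _), mul_zero]

/-- The identity for the central weights `wtE + wtN` and `w * gam w z * gam w z'`, by the same
induction. -/
theorem oddDefect'_eq_zero {w y0 : K} (hw : w ≠ 0) (h0 : gam w y0 = 0) (z z' : K)
    {n : ℕ} {X : Fin n → K} (hX : GenericRows w X) (hz : GenericCol w X z') (y : Fin n → K) :
    oddDefect' w z z' X y = 0 := by
  induction n with
  | zero =>
    rw [Subsingleton.elim y fun _ => y0]
    exact oddDefect'_root hw h0 z z' hX hz
  | succ n ih =>
    refine column_induction (P := fun y => oddDefect' w z z' X y = 0) y0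
      (fun σ y => by rw [oddDefect'_comp_perm]) (oddDefect'_root hw h0 z z' hX hz)
      (fun y hy a => ?_) y
    refine eq_zero_of_root hw h0 hX (isPolyDeg_oddDefect' w z z' X y) (fun b i => ?_) hy a
    have hb := wtB_colRoot (hX.ne_one i) (hX.add_ne i) b
    refine (mul_eq_zero.1 ?_).resolve_left (sign_ne_zero (K := K) (Equiv.swap 0 i))
    rw [← oddDefect'_perm_comp, comp_swap_zero_eq_cons]
    obtain ⟨c, hc⟩ := oddDefect'_eq_of_wtB_eq_zero b hb z z' (Fin.tail (X ∘ Equiv.swap 0 i)) y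
    rw [hc, ih (hX.tail _) (hz.tail _), mul_zero]

end RootColumns

/-! ### Row parameters tending to one -/

section Specialization
open Polynomial
variable {F : Type*} [Field F]

/-- Row parameters `1 + (i + 1) ε`, as polynomials in `ε`. They are in general position, and all
equal to `1` at `ε = 0`. -/
noncomputable def rowPoly (F : Type*) [Field F] (n : ℕ) : Fin n → F[X] :=
  fun i => 1 + C ((i : F) + 1) * X

theorem ne_zero_of_eval_zero {p : F[X]} {a : F} (h : p.eval 0 = a) (ha : a ≠ 0) : p ≠ 0 := by
  rintro rfl; simp at h; exact ha h.symm

theorem rowPoly_injective [CharZero F] (n : ℕ) : Function.Injective (rowPoly F n) := by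
  intro i j h
  have := congrArg (fun p => p.coeff 1) h
  simpa [rowPoly, coeff_one, Fin.ext_iff] using this

theorem rowPoly_ne_one [CharZero F] {n : ℕ} (i : Fin n) : rowPoly F n i ≠ 1 := by
  intro h
  have := congrArg (fun p => p.coeff 1) h
  simp [rowPoly, coeff_one] at this
  exact Nat.cast_add_one_ne_zero (R := F) i this

theorem genericRows_rowPoly [CharZero F] {w : F} (hw : w ≠ 0) (n : ℕ) :
    GenericRows (algebraMap F[X] (FractionRing F[X]) (C w))
      (algebraMap F[X] (FractionRing F[X]) ∘ rowPoly F n) := by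
  have hinj := IsFractionRing.injective F[X] (FractionRing F[X])
  refine ⟨hinj.comp (rowPoly_injective n), fun i j => ?_, fun i => ?_, fun i => ?_⟩
  · have : braidF (C w) (rowPoly F n i) (rowPoly F n j) ≠ 0 := by
      refine ne_zero_of_eval_zero (a := w) ?_ hw
      simp [braidF, rowPoly]; ring
    simpa [braidF, map_ofNat (algebraMap F[X] (FractionRing F[X])) 2] using
      (map_ne_zero_iff _ hinj).2 this
  · rw [Function.comp_apply, Ne, ← map_one (algebraMap F[X] (FractionRing F[X])), hinj.eq_iff]
    exact rowPoly_ne_one i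
  · have : C w - 1 + rowPoly F n i ≠ 0 := by
      refine ne_zero_of_eval_zero (a := w) ?_ hw
      simp [rowPoly]
    simpa using (map_ne_zero_iff _ hinj).2 this

theorem genericCol_rowPoly [CharZero F] {w : F} (hw : w ≠ 0) {m n : ℕ} (j : Fin m) :
    GenericCol (algebraMap F[X] (FractionRing F[X]) (C w))
      (algebraMap F[X] (FractionRing F[X]) ∘ rowPoly F n)
      (algebraMap F[X] (FractionRing F[X]) (rowPoly F m j)) := by
  have hinj := IsFractionRing.injective F[X] (FractionRing F[X])
  have h := genericRows_rowPoly hw m (F := F)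
  refine ⟨?_, h.ne_one j, h.add_ne j, fun i => ⟨?_, ?_⟩⟩
  · have := h.braidF_ne j j
    rwa [show ∀ a b : FractionRing F[X], braidF a b b = gam a b by
      intros; simp only [braidF, gam]; ring] at this
  · have : wtE (C w) (rowPoly F n i) (rowPoly F m j) ≠ 0 := by
      refine ne_zero_of_eval_zero (a := w) ?_ hw
      simp [wtE, rowPoly]
    simpa [wtE] using (map_ne_zero_iff _ hinj).2 this
  · have : wtN (C w) (rowPoly F n i) (rowPoly F m j) ≠ 0 := by
      refine ne_zero_of_eval_zero (a := w) ?_ hw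
      simp [wtN, rowPoly]
    simpa [wtN] using (map_ne_zero_iff _ hinj).2 this

theorem det_vandermonde_ne_zero {K : Type*} [Field K] {w : K} {n : ℕ} {X : Fin n → K}
    (h : GenericRows w X) : (vandermonde X).det ≠ 0 :=
  det_vandermonde_ne_zero_iff.2 h.inj

/-- The identity of odd order for the central weights `1` and `wtE + wtN`. -/
theorem Zdw_mul_Zodd {K : Type*} [Field K] {w y0 z z' : K} (hw : w ≠ 0) (h0 : gam w y0 = 0)
    (hz : gam w z ≠ 0) {n : ℕ} {X : Fin n → K} (hX : GenericRows w X) (hz' : GenericCol w X z')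
    (y : Fin n → K) :
    Zdw w (List.ofFn X) y * Zodd w 1 (wtE w z z' + wtN w z z') z z' (List.ofFn X) y =
      Zdw w (z :: List.ofFn X) (Fin.cons z' y : Fin (n + 1) → K) * Zht w (List.ofFn X) y := by
  have h1 := oddDefect_eq_zero hw h0 hz hX hz' y
  rw [oddDefect, Zdw_snoc_eq_cons] at h1
  refine mul_left_cancel₀ (mul_ne_zero (pow_ne_zero (n.choose 2) hw)
    (det_vandermonde_ne_zero hX)) ?_
  linear_combination Zdw w (List.ofFn X) y * h1 -
    Zdw w (z :: List.ofFn X) (Fin.cons z' y : Fin (n + 1) → K) * Zht_eq hw hX y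

/-- The identity of odd order for the central weights `wtE + wtN` and `w * gam w z * gam w z'`. -/
theorem Zdw_mul_Zodd' {K : Type*} [Field K] {w y0 z z' : K} (hw : w ≠ 0) (h0 : gam w y0 = 0)
    {n : ℕ} {X : Fin n → K} (hX : GenericRows w X)
    (hX' : GenericRows w (Fin.cons z X : Fin (n + 1) → K)) (hz' : GenericCol w X z')
    (y : Fin n → K) :
    Zdw w (z :: List.ofFn X) (Fin.cons z' y : Fin (n + 1) → K) *
      Zodd w (wtE w z z' + wtN w z z') (w * gam w z * gam w z') z z' (List.ofFn X) y =
      Zdw w (List.ofFn X) y *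
        Zht w (z :: List.ofFn X) (Fin.cons z' y : Fin (n + 1) → K) := by
  have h1 := oddDefect'_eq_zero hw h0 z z' hX hz' y
  have h2 := Zht_eq hw hX' (Fin.cons z' y)
  rw [List.ofFn_cons] at h2
  rw [oddDefect'] at h1
  refine mul_left_cancel₀ (mul_ne_zero (pow_ne_zero ((n + 1).choose 2) hw)
    (det_vandermonde_ne_zero hX')) ?_
  linear_combination Zdw w (z :: List.ofFn X) (Fin.cons z' y : Fin (n + 1) → K) * h1 -
    Zdw w (List.ofFn X) y * h2

theorem map_ofFn_rowPoly (n : ℕ) (f : Fin n → F[X]) (hf : ∀ i, (f i).eval 0 = 1) :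
    (List.ofFn f).map (evalRingHom 0) = List.replicate n 1 := by
  rw [List.map_ofFn, ← List.ofFn_const]
  congr 1
  ext i
  simp [hf]

theorem eval_zero_comp_C {n : ℕ} (y : Fin n → F) : evalRingHom 0 ∘ (C ∘ y) = y := by
  ext i; simp

theorem wtE_map {R S : Type*} [CommRing R] [CommRing S] (φ : R →+* S) (w x y : R) :
    φ (wtE w x y) = wtE (φ w) (φ x) (φ y) := by simp [wtE]

theorem wtN_map {R S : Type*} [CommRing R] [CommRing S] (φ : R →+* S) (w x y : R) :
    φ (wtN w x y) = wtN (φ w) (φ x) (φ y) := by simp [wtN]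

theorem gam_map {R S : Type*} [CommRing R] [CommRing S] (φ : R →+* S) (w x : R) :
    φ (gam w x) = gam (φ w) (φ x) := by simp [gam, map_ofNat φ 2]

theorem comp_cons' {T S : Type*} (φ : T → S) {n : ℕ} (z : T) (y : Fin n → T) :
    φ ∘ (Fin.cons z y : Fin (n + 1) → T) = (Fin.cons (φ z) (φ ∘ y) : Fin (n + 1) → S) := by
  ext i; refine Fin.cases ?_ (fun i => ?_) i <;> simp

/-- The identities of odd order hold at the parameters `rowPoly`, over the field of rational
functions in `ε`; there all partition functions are polynomials in `ε`, which are evaluated at `0`.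
-/
theorem homogeneous_of_root [CharZero F] {w y0 : F} (hw : w ≠ 0) (h0 : gam w y0 = 0) {n : ℕ}
    (y : Fin n → F) :
    Zdw w (List.replicate n 1) y * Zodd w 1 (w + w) 1 1 (List.replicate n 1) y =
      Zdw w (List.replicate (n + 1) 1) (Fin.cons 1 y : Fin (n + 1) → F) *
        Zht w (List.replicate n 1) y ∧
    Zdw w (List.replicate (n + 1) 1) (Fin.cons 1 y : Fin (n + 1) → F) *
      Zodd w (w + w) (w * w * w) 1 1 (List.replicate n 1) y =
      Zdw w (List.replicate n 1) y *
        Zht w (List.replicate (n + 1) 1) (Fin.cons 1 y : Fin (n + 1) → F) := by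
  set φ := algebraMap F[X] (FractionRing F[X])
  have hinj : Function.Injective φ := IsFractionRing.injective F[X] (FractionRing F[X])
  set P := rowPoly F (n + 1)
  have hX' := genericRows_rowPoly hw (n + 1) (F := F)
  have hz' := genericCol_rowPoly hw (n := n + 1) (0 : Fin (n + 1)) (F := F)
  have hX : GenericRows (φ (C w)) (φ ∘ Fin.tail P) := hX'.comp (Fin.succ_injective n)
  have hz : GenericCol (φ (C w)) (φ ∘ Fin.tail P) (φ (P 0)) := hz'.comp Fin.succ
  have hw' : φ (C w) ≠ 0 := (map_ne_zero_iff _ hinj).2 (C_ne_zero.2 hw)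
  have h0' : gam (φ (C w)) (φ (C y0)) = 0 := by
    rw [← gam_map, ← gam_map, h0, map_zero, map_zero]
  have hcons : (Fin.cons (φ (P 0)) (φ ∘ Fin.tail P) : Fin (n + 1) → FractionRing F[X]) = φ ∘ P := by
    rw [← comp_cons', Fin.cons_self_tail]
  have e1 := Zdw_mul_Zodd hw' h0' hz.gam_ne hX hz (φ ∘ (C ∘ y))
  have e2 := Zdw_mul_Zodd' (z := φ (P 0)) hw' h0' hX (by rw [hcons]; exact hX') hz (φ ∘ (C ∘ y))
  rw [← List.map_ofFn, ← List.map_cons, ← comp_cons', ← wtE_map, ← wtN_map, ← map_add] at e1 e2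
  rw [← map_one φ, ← Zodd_map, ← Zht_map, ← Zdw_map, ← Zdw_map, ← map_mul, ← map_mul,
    hinj.eq_iff] at e1
  rw [← gam_map, ← map_mul, ← map_mul, ← Zodd_map, ← Zht_map, ← Zdw_map, ← Zdw_map, ← map_mul,
    ← map_mul, hinj.eq_iff] at e2
  have hP : ∀ i, (P i).eval 0 = 1 := fun i => by simp [P, rowPoly]
  have hPr : evalRingHom 0 (P 0) = 1 := hP 0
  have l1 : (List.ofFn (Fin.tail P)).map (evalRingHom 0) = List.replicate n 1 :=
    map_ofFn_rowPoly n _ fun i => hP i.succ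
  have hwr : evalRingHom 0 (C w) = w := by simp
  have v1 : wtE w 1 1 = w := by simp only [wtE]; ring
  have v2 : wtN w 1 1 = w := by simp only [wtN]; ring
  have v3 : gam w 1 = w := by simp only [gam]; ring
  have e1' := congrArg (evalRingHom 0) e1
  have e2' := congrArg (evalRingHom 0) e2
  rw [map_mul, map_mul, Zodd_map, Zht_map, Zdw_map, Zdw_map, List.map_cons, l1, comp_cons',
    eval_zero_comp_C, map_add, wtE_map, wtN_map, hPr, hwr, v1, v2, map_one,
    ← List.replicate_succ] at e1'
  rw [map_mul, map_mul, Zodd_map, Zht_map, Zdw_map, Zdw_map, List.map_cons, l1, comp_cons',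
    eval_zero_comp_C, map_add, wtE_map, wtN_map, map_mul, map_mul, gam_map, hPr, hwr, v1, v2, v3,
    ← List.replicate_succ] at e2'
  exact ⟨e1', e2'⟩

theorem exists_gam_eq_zero [CharZero F] [IsAlgClosed F] (w : F) : ∃ y0, gam w y0 = 0 := by
  obtain ⟨s, hs⟩ := IsAlgClosed.exists_eq_mul_self (discrim 1 (w - 2) 1)
  obtain ⟨y, hy⟩ := exists_quadratic_eq_zero (one_ne_zero (α := F)) ⟨s, hs⟩
  exact ⟨y, by simp only [gam]; linear_combination hy⟩

/-- At the homogeneous point, with the central weights `(1, 2w)` and `(2w, w ^ 3)`, the odd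
half-turn partition function factors through those of even order. -/
theorem homogeneous_identities [CharZero F] {w : F} (hw : w ≠ 0) {n : ℕ} (y : Fin n → F) :
    Zdw w (List.replicate n 1) y * Zodd w 1 (w + w) 1 1 (List.replicate n 1) y =
      Zdw w (List.replicate (n + 1) 1) (Fin.cons 1 y : Fin (n + 1) → F) *
        Zht w (List.replicate n 1) y ∧
    Zdw w (List.replicate (n + 1) 1) (Fin.cons 1 y : Fin (n + 1) → F) *
      Zodd w (w + w) (w * w * w) 1 1 (List.replicate n 1) y =
      Zdw w (List.replicate n 1) y *
        Zht w (List.replicate (n + 1) 1) (Fin.cons 1 y : Fin (n + 1) → F) := by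
  -- A root of `gam` exists over the algebraic closure.
  set φ := algebraMap F (AlgebraicClosure F)
  have hinj : Function.Injective φ := φ.injective
  have : CharZero (AlgebraicClosure F) := charZero_of_injective_algebraMap hinj
  obtain ⟨y0, h0⟩ := exists_gam_eq_zero (φ w)
  have hl : ∀ n, List.replicate n (1 : AlgebraicClosure F) = (List.replicate n (1 : F)).map φ := by
    intro n; simp
  obtain ⟨e1, e2⟩ := homogeneous_of_root ((map_ne_zero_iff _ hinj).2 hw) h0 (φ ∘ y)
  rw [← map_one φ, ← comp_cons', map_one, hl, hl, ← map_add] at e1 e2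
  constructor
  · apply hinj
    simpa only [map_mul, Zdw_map, Zodd_map, Zht_map, map_one, map_add] using e1
  · apply hinj
    simpa only [map_mul, Zdw_map, Zodd_map, Zht_map, map_one, map_add] using e2

end Specialization

/-! ### Divisibility by the Vandermonde determinant -/

section Divisibility
open Polynomial
variable {R : Type*} [CommRing R]

/-- A determinant of polynomials evaluated at `X` is divisible by the Vandermonde determinant: the
polynomials may be reduced modulo `∏ i, (T - X i)`, and then have degree less than `n`. -/
theorem exists_det_eval_eq [Nontrivial R] {n : ℕ} (X : Fin n → R) (p : Fin n → R[X]) :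
    ∃ Q, (Matrix.of fun i j => (p j).eval (X i)).det = (vandermonde X).det * Q := by
  set M : R[X] := ∏ i, (Polynomial.X - C (X i))
  have hM : M.Monic := monic_prod_of_monic _ _ fun i _ => monic_X_sub_C _
  have hdeg : M.natDegree = n := by simp [M]
  refine ⟨(Matrix.of fun k j : Fin n => (p j %ₘ M).coeff k).det, ?_⟩
  rw [← Matrix.det_mul]
  congr 1
  ext i j
  have h0 : M.eval (X i) = 0 := by
    rw [eval_prod]; exact Finset.prod_eq_zero (Finset.mem_univ i) (by simp)
  have h1 : (p j).eval (X i) = (p j %ₘ M).eval (X i) := by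
    conv_lhs => rw [← modByMonic_add_div (p j) M]
    rw [eval_add, eval_mul, h0, zero_mul, add_zero]
  have h2 : (p j %ₘ M).natDegree < n ∨ n = 0 := by
    rcases Nat.eq_zero_or_pos n with h | h
    · exact Or.inr h
    · left
      rw [← hdeg]
      exact natDegree_modByMonic_lt _ hM fun h1 => by rw [h1] at hdeg; simp at hdeg; omega
  rcases h2 with h2 | h2
  · rw [Matrix.of_apply, h1, eval_eq_sum_range' h2, Matrix.mul_apply, Finset.sum_range]
    refine Finset.sum_congr rfl fun k _ => ?_
    rw [Matrix.of_apply, vandermonde_apply, mul_comm]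
  · subst h2; exact i.elim0

theorem newtonHead_map {S : Type*} [CommRing S] (φ : R →+* S) (w x : R) {n : ℕ}
    (y : Fin (n + 1) → R) : φ (newtonHead w y x) = newtonHead (φ w) (φ ∘ y) (φ x) := by
  simp [newtonHead, wtE_map, wtN_map]

theorem newtonRow_map {S : Type*} [CommRing S] (φ : R →+* S) (w x : R) {n : ℕ}
    (y : Fin n → R) (j : Fin n) : φ (newtonRow w y x j) = newtonRow (φ w) (φ ∘ y) (φ x) j := by
  induction n with
  | zero => exact j.elim0
  | succ n ih =>
    simp only [newtonRow]
    refine Fin.cases ?_ (fun j => ?_) j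
    · simp only [Fin.cons_zero, newtonHead_map]
    · simp only [Fin.cons_succ, map_mul, ih, wtE_map, wtN_map]; rfl

theorem newtonDet_map {S : Type*} [CommRing S] (φ : R →+* S) (w : R) {n : ℕ}
    (X y : Fin n → R) : φ (newtonDet w X y) = newtonDet (φ w) (φ ∘ X) (φ ∘ y) := by
  rw [newtonDet, RingHom.map_det, newtonDet]
  congr 1
  ext i j
  simp [newtonRow_map]

theorem exists_newtonDet_eq [Nontrivial R] (w : R) {n : ℕ} (X y : Fin n → R) :
    ∃ Q, newtonDet w X y = (vandermonde X).det * Q := by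
  obtain ⟨Q, hQ⟩ := exists_det_eval_eq X fun j => newtonRow (C w) (C ∘ y) Polynomial.X j
  refine ⟨Q, hQ ▸ ?_⟩
  rw [newtonDet]
  congr 1
  ext i j
  have := newtonRow_map (evalRingHom (X i)) (C w) Polynomial.X (C ∘ y) j
  have e : evalRingHom (X i) ∘ (C ∘ y) = y := by ext; simp
  rw [e, coe_evalRingHom, eval_C, eval_X] at this
  rw [Matrix.of_apply, Matrix.of_apply, this]

theorem vandermonde_det_map {S : Type*} [CommRing S] (φ : R →+* S) {n : ℕ} (X : Fin n → R) :
    φ (vandermonde X).det = (vandermonde (φ ∘ X)).det := by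
  rw [RingHom.map_det]; congr 1; ext i j; simp [vandermonde_apply]

/-- At the homogeneous point `Zdw` divides `Zht` up to a power of `w`. In `Zht_eq` the Vandermonde
determinant is cancelled before the row parameters tend to `1`. -/
theorem exists_Zht_eq [IsDomain R] [CharZero R] {w : R} (hw : w ≠ 0) {n : ℕ} (y : Fin n → R) :
    ∃ Q, w ^ n.choose 2 * Zht w (List.replicate n 1) y = Zdw w (List.replicate n 1) y * Q := by
  set F := FractionRing R
  have hR : Function.Injective (algebraMap R F) := IsFractionRing.injective R F
  have : CharZero F := charZero_of_injective_algebraMap hR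
  set P : Fin n → R[X] := fun i => 1 + C ((i : R) + 1) * Polynomial.X
  set ψ : R[X] →+* FractionRing F[X] :=
    (algebraMap F[X] (FractionRing F[X])).comp (mapRingHom (algebraMap R F))
  have hψ : Function.Injective ψ :=
    (IsFractionRing.injective F[X] (FractionRing F[X])).comp (Polynomial.map_injective _ hR)
  have hX := genericRows_rowPoly ((map_ne_zero_iff _ hR).2 hw) n
  have hP : algebraMap F[X] (FractionRing F[X]) ∘ rowPoly F n = ψ ∘ P := by
    ext i; simp [ψ, P, rowPoly, map_natCast C]
  have hwψ : algebraMap F[X] (FractionRing F[X]) (C (algebraMap R F w)) = ψ (C w) := by simp [ψ]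
  rw [hP, hwψ] at hX
  have hw' : ψ (C w) ≠ 0 := (map_ne_zero_iff _ hψ).2 (C_ne_zero.2 hw)
  have h := Zht_eq hw' hX (ψ ∘ (C ∘ y))
  have hV := det_vandermonde_ne_zero hX
  rw [← vandermonde_det_map] at h hV
  rw [← List.map_ofFn, ← Zht_map, ← Zdw_map, ← newtonDet_map, ← map_pow, ← map_mul, ← map_mul,
    ← map_mul, hψ.eq_iff] at h
  obtain ⟨Q, hQ⟩ := exists_newtonDet_eq (C w) P (C ∘ y)
  have hV' : (vandermonde P).det ≠ 0 := fun h0 => hV (by rw [h0, map_zero])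
  rw [hQ] at h
  have h2 : C w ^ n.choose 2 * Zht (C w) (List.ofFn P) (C ∘ y) =
      Zdw (C w) (List.ofFn P) (C ∘ y) * Q :=
    mul_left_cancel₀ hV' (by linear_combination h)
  have h3 := congrArg (evalRingHom 0) h2
  have l1 : (List.ofFn P).map (evalRingHom 0) = List.replicate n 1 := by
    rw [List.map_ofFn, ← List.ofFn_const]
    congr 1
    ext i
    simp [P]
  have e : evalRingHom 0 ∘ (C ∘ y) = y := by ext; simp
  rw [map_mul, map_mul, map_pow, Zht_map, Zdw_map, l1, e, coe_evalRingHom, eval_C] at h3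
  exact ⟨_, h3⟩

end Divisibility

/-! ### Sums over sign matrices -/

section Walks
variable {R : Type*} [CommRing R]

/-- The weight of the entry `m` between edges in the states `a` and `h`: it vanishes unless
`m = h - a`, it is `e` or `n` for an entry `0` between edges in the state `false` or `true`, it is
`1` for an entry `1` and `d` for an entry `-1`. -/
def stepWt (e n d : R) : Bool → SignType → Bool → R
  | false, m, false => if m = 0 then e else 0
  | true, m, true => if m = 0 then n else 0
  | false, m, true => if m = 1 then 1 else 0
  | true, m, false => if m = -1 then d else 0

/-- The weight of a sequence of entries that leads from the state `a` to the state `b`. -/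
def walk (S : Bool → SignType → Bool → R) : Bool → List SignType → Bool → R
  | a, [], b => if a = b then 1 else 0
  | a, m :: l, b => ∑ h, S a m h * walk S h l b

theorem sum_signType {M : Type*} [AddCommMonoid M] (f : SignType → M) :
    ∑ m, f m = f 0 + f (-1) + f 1 := by
  rw [show (Finset.univ : Finset SignType) = {0, -1, 1} from rfl]
  rw [Finset.sum_insert (by decide), Finset.sum_insert (by decide), Finset.sum_singleton, add_assoc]

/-- The step weights of a column with parameter `y` in a row with parameter `1`. -/
abbrev colStep (w y : R) : Bool → SignType → Bool → R :=
  stepWt (wtE w 1 y) (wtN w 1 y) (w * gam w 1 * gam w y)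

/-- For a row with parameter `1` the vertex weight splits into a factor `0` or `1` for the row and a
weight for the column. The weight of an entry `0` depends on the states of both the horizontal and
the vertical edges in general, but only on the latter if the former are in the state `false`, and on
neither if `y = 1`. -/
theorem vertexWt_eq_sum (w y : R) (a h v u : Bool) (hy : a = false ∨ y = 1) :
    vertexWt w 1 y a h v u = ∑ m, stepWt (1 : R) 1 1 a m h * colStep w y v m u := by
  have h1 : (0 : SignType) ≠ 1 := by decide
  have h2 : (0 : SignType) ≠ -1 := by decide
  have h3 : (1 : SignType) ≠ -1 := by decide
  have e : y = 1 → wtE w 1 y = wtN w 1 y := by rintro rfl; simp only [wtE, wtN]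
  rw [sum_signType]
  rcases hy with rfl | hy
  · cases h <;> cases v <;> cases u <;>
      simp [vertexWt, stepWt, h1, h2, h3, h1.symm, h2.symm, h3.symm]
  · cases a <;> cases h <;> cases v <;> cases u <;>
      simp [vertexWt, stepWt, h1, h2, h3, h1.symm, h2.symm, h3.symm, e hy]

theorem rowT_succ_eq_sum (w : R) {n : ℕ} (y : Fin (n + 1) → R) (a b : Bool)
    (v u : Fin (n + 1) → Bool) (hy : a = false ∨ y 0 = 1)
    (ih : ∀ a, rowT w 1 (Fin.tail y) a b (Fin.tail v) (Fin.tail u) =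
      ∑ r : Fin n → SignType, walk (stepWt (1 : R) 1 1) a (List.ofFn r) b *
        ∏ k, colStep w (Fin.tail y k) (Fin.tail v k) (r k) (Fin.tail u k)) :
    rowT w 1 y a b v u = ∑ r : Fin (n + 1) → SignType, walk (stepWt (1 : R) 1 1) a (List.ofFn r) b *
      ∏ k, colStep w (y k) (v k) (r k) (u k) := by
  have h := fun h => vertexWt_eq_sum w (y 0) a h (v 0) (u 0) hy
  simp only [rowT_apply_succ, ih, h, sum_cons, Finset.sum_mul_sum]
  simp only [List.ofFn_cons, walk, Fin.prod_univ_succ,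
    Fin.cons_zero, Fin.cons_succ, Fin.tail, Finset.sum_mul]
  rw [Finset.sum_comm]
  refine Finset.sum_congr rfl fun m _ => ?_
  rw [Finset.sum_comm]
  refine Finset.sum_congr rfl fun r _ => Finset.sum_congr rfl fun h _ => ?_
  ring

theorem rowT_one_eq_sum (w : R) {n : ℕ} (a b : Bool) (v u : Fin n → Bool) :
    rowT w 1 (fun _ => 1) a b v u = ∑ r : Fin n → SignType,
      walk (stepWt (1 : R) 1 1) a (List.ofFn r) b * ∏ k, colStep w 1 (v k) (r k) (u k) := by
  induction n generalizing a with
  | zero =>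
    simp only [rowT_zero, Finset.univ_unique, Finset.sum_singleton, List.ofFn_zero, walk,
      Finset.univ_eq_empty, Finset.prod_empty, mul_one]
    split_ifs
    · rw [Subsingleton.elim v u, Matrix.one_apply_eq]
    · rfl
  | succ n ih => exact rowT_succ_eq_sum w _ a b v u (Or.inr rfl) fun a => ih a _ _

theorem rowT_eq_sum (w : R) {n : ℕ} {y : Fin n → R} (hy : ∀ k : Fin n, (k : ℕ) ≠ 0 → y k = 1)
    (b : Bool) (v u : Fin n → Bool) :
    rowT w 1 y false b v u = ∑ r : Fin n → SignType,
      walk (stepWt (1 : R) 1 1) false (List.ofFn r) b * ∏ k, colStep w (y k) (v k) (r k) (u k) := by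
  obtain _ | n := n
  · rw [Subsingleton.elim y fun _ => 1]; exact rowT_one_eq_sum ..
  · refine rowT_succ_eq_sum w _ _ b v u (Or.inl rfl) fun a => ?_
    have : Fin.tail y = fun _ => 1 := funext fun k => hy k.succ (by simp)
    rw [this]; exact rowT_one_eq_sum ..

theorem walk_append (S : Bool → SignType → Bool → R) (a : Bool) (l l' : List SignType) (b : Bool) :
    walk S a (l ++ l') b = ∑ h, walk S a l h * walk S h l' b := by
  induction l generalizing a with
  | nil => cases a <;> simp [walk]
  | cons m l ih =>
    simp only [List.cons_append, walk, ih, Finset.mul_sum, Finset.sum_mul]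
    rw [Finset.sum_comm]
    simp only [mul_assoc]

theorem walk_singleton (S : Bool → SignType → Bool → R) (a : Bool) (m : SignType) (b : Bool) :
    walk S a [m] b = S a m b := by
  cases b <;> simp [walk]

theorem stepWt_not (a : Bool) (m : SignType) (b : Bool) :
    stepWt (1 : R) 1 1 (!b) m (!a) = stepWt (1 : R) 1 1 a m b := by
  cases a <;> cases b <;> rfl

/-- Reading a sequence backwards reverses the walk and complements its states. -/
theorem walk_reverse (a : Bool) (l : List SignType) (b : Bool) :
    walk (stepWt (1 : R) 1 1) (!b) l.reverse (!a) = walk (stepWt (1 : R) 1 1) a l b := by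
  induction l generalizing a with
  | nil => cases a <;> cases b <;> simp [walk]
  | cons m l ih =>
    rw [List.reverse_cons, walk_append, walk]
    rw [← Equiv.sum_comp Equiv.boolNot]
    refine Finset.sum_congr rfl fun h _ => ?_
    rw [show Equiv.boolNot h = !h from rfl, ih, walk_singleton, stepWt_not, mul_comm]

/-- The transfer of the vertical states through columns with the given entries. -/
def colMat (w : R) {n : ℕ} (y : Fin n → R) (A : Fin n → List SignType) :
    Matrix (Fin n → Bool) (Fin n → Bool) R :=
  Matrix.of fun v u => ∏ k, walk (colStep w (y k)) (v k) (A k) (u k)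

theorem colMat_nil (w : R) {n : ℕ} (y : Fin n → R) : colMat w y (fun _ => []) = 1 := by
  ext v u
  simp only [colMat, Matrix.of_apply, walk]
  rw [Finset.prod_ite_zero, Matrix.one_apply, Finset.prod_const_one]
  simp only [funext_iff, Finset.mem_univ, true_imp_iff]

theorem colMat_mul (w : R) {n : ℕ} (y : Fin n → R) (A A' : Fin n → List SignType) :
    colMat w y A * colMat w y A' = colMat w y fun k => A k ++ A' k := by
  ext v u
  simp only [colMat, Matrix.mul_apply, Matrix.of_apply, walk_append, Finset.prod_univ_sum,
    Fintype.piFinset_univ, Finset.prod_mul_distrib]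

theorem rowT_eq_colMat (w : R) {n : ℕ} {y : Fin n → R} (hy : ∀ k : Fin n, (k : ℕ) ≠ 0 → y k = 1)
    (b : Bool) : rowT w 1 y false b = ∑ r : Fin n → SignType,
      walk (stepWt (1 : R) 1 1) false (List.ofFn r) b • colMat w y fun k => [r k] := by
  ext v u
  rw [rowT_eq_sum w hy, Matrix.sum_apply]
  simp only [colMat, Matrix.smul_apply, Matrix.of_apply, walk_singleton, smul_eq_mul]

theorem dwProd_eq_sum (w : R) {n : ℕ} {y : Fin n → R}
    (hy : ∀ k : Fin n, (k : ℕ) ≠ 0 → y k = 1) (N : ℕ) :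
    dwProd w y (List.replicate N 1) = ∑ M : Fin N → Fin n → SignType,
      (∏ i, walk (stepWt (1 : R) 1 1) false (List.ofFn (M i)) true) •
        colMat w y fun k => List.ofFn fun i => M i k := by
  induction N with
  | zero => simp [dwProd, colMat_nil]
  | succ N ih =>
    have e : dwProd w y (List.replicate (N + 1) 1) =
        rowT w 1 y false true * dwProd w y (List.replicate N 1) := by
      simp [dwProd, List.replicate_succ]
    rw [e, ih, rowT_eq_colMat w hy, Finset.sum_mul_sum, sum_cons]
    refine Finset.sum_congr rfl fun r _ => Finset.sum_congr rfl fun M _ => ?_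
    rw [Matrix.smul_mul, Matrix.mul_smul, colMat_mul, smul_smul, Fin.prod_univ_succ]
    simp only [List.ofFn_succ (n := N), Fin.cons_zero, Fin.cons_succ, List.singleton_append]

/-- The nested product as a sum over the upper half rows `U` and the lower half rows `D`, both
numbered from the outside; so the lower ones occur in reverse order in the columns. -/
theorem nest_eq_sum (w : R) {m n : ℕ} {z : Fin m → R} {y : Fin n → R}
    (hz : ∀ k : Fin m, (k : ℕ) ≠ 0 → z k = 1) (hy : ∀ k : Fin n, (k : ℕ) ≠ 0 → y k = 1)
    (B : Matrix (Fin m → Bool) (Fin n → Bool) R) (N : ℕ) :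
    nest (fun x => rowT w x z) (fun x => rowT w x y) B (List.replicate N 1) =
      ∑ U : Fin N → Fin m → SignType, ∑ D : Fin N → Fin n → SignType,
        (∏ i, ∑ ε, walk (stepWt (1 : R) 1 1) false (List.ofFn (U i)) ε *
          walk (stepWt (1 : R) 1 1) false (List.ofFn (D i)) (!ε)) •
        (colMat w z (fun k => List.ofFn fun i => U i k) * B *
          colMat w y fun k => (List.ofFn fun i => D i k).reverse) := by
  induction N with
  | zero => simp [nest, colMat_nil]
  | succ N ih =>
    have e : ∀ ε, rowT w 1 z false ε * nest (fun x => rowT w x z) (fun x => rowT w x y) B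
        (List.replicate N 1) * rowT w 1 y false (!ε) =
        ∑ U0 : Fin m → SignType, ∑ U : Fin N → Fin m → SignType, ∑ D0 : Fin n → SignType,
        ∑ D : Fin N → Fin n → SignType,
        (walk (stepWt (1 : R) 1 1) false (List.ofFn U0) ε *
          walk (stepWt (1 : R) 1 1) false (List.ofFn D0) (!ε)) •
        (∏ i, ∑ ε, walk (stepWt (1 : R) 1 1) false (List.ofFn (U i)) ε *
          walk (stepWt (1 : R) 1 1) false (List.ofFn (D i)) (!ε)) •
        (colMat w z (fun k => U0 k :: List.ofFn fun i => U i k) * B *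
          colMat w y fun k => (List.ofFn fun i => D i k).reverse ++ [D0 k]) := by
      intro ε
      rw [ih, rowT_eq_colMat w hz, rowT_eq_colMat w hy]
      rw [Matrix.sum_mul, Matrix.sum_mul]
      refine Finset.sum_congr rfl fun U0 _ => ?_
      rw [Matrix.mul_sum]
      simp only [Matrix.mul_sum, Matrix.sum_mul]
      rw [Finset.sum_comm]
      refine Finset.sum_congr rfl fun U _ => Finset.sum_congr rfl fun D0 _ =>
        Finset.sum_congr rfl fun D _ => ?_
      have h1 := colMat_mul w z (fun k => [U0 k]) fun k => List.ofFn fun i => U i k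
      have h2 := colMat_mul w y (fun k => (List.ofFn fun i => D i k).reverse) fun k => [D0 k]
      simp only [List.singleton_append] at h1
      rw [← h1, ← h2]
      simp only [Matrix.smul_mul, Matrix.mul_smul, Matrix.mul_assoc, smul_smul]
      congr 1
      ring
    simp only [List.replicate_succ, nest, e]
    rw [Finset.sum_comm, sum_cons]
    refine Finset.sum_congr rfl fun U0 _ => ?_
    rw [Finset.sum_comm]
    refine Finset.sum_congr rfl fun U _ => ?_
    rw [Finset.sum_comm, sum_cons]
    refine Finset.sum_congr rfl fun D0 _ => ?_
    rw [Finset.sum_comm]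
    refine Finset.sum_congr rfl fun D _ => ?_
    rw [← Finset.sum_smul, smul_smul, Fin.prod_univ_succ]
    simp only [List.ofFn_succ (n := N), Fin.cons_zero, Fin.cons_succ, List.reverse_cons]

end Walks

/-! ### Alternating sequences as walks -/

section Alternating

/-- The entries that follow an edge in the state `a` in an alternating sequence: nonzero entries
alternate, the last one is `1`, and the first one is `-1` if `a = true` and `1` if `a = false`. If
`a = true` there need not be any. -/
def AltFrom (a : Bool) {n : ℕ} (v : Fin n → SignType) : Prop :=
  (a = false → ∃ i, v i ≠ 0) ∧
  (∀ i, v i ≠ 0 → (∀ k, k < i → v k = 0) → v i = bif a then -1 else 1) ∧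
  (∀ i, v i ≠ 0 → (∀ k, i < k → v k = 0) → v i = 1) ∧
  (∀ i j, i < j → v i ≠ 0 → v j ≠ 0 → (∀ k, i < k → k < j → v k = 0) → v j = -v i)

theorem altFrom_false {n : ℕ} (v : Fin n → SignType) : AltFrom false v ↔ IsAlternating v := by
  simp [AltFrom, IsAlternating]

theorem altFrom_zero (a : Bool) (v : Fin 0 → SignType) : AltFrom a v ↔ a = true := by
  simp [AltFrom]

theorem altFrom_cons_zero (a : Bool) {n : ℕ} (v : Fin n → SignType) :
    AltFrom a (Fin.cons 0 v : Fin (n + 1) → SignType) ↔ AltFrom a v := by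
  simp [AltFrom, Fin.forall_fin_succ, Fin.exists_fin_succ]

theorem altFrom_cons (a : Bool) {n : ℕ} (x : SignType) (hx : x ≠ 0) (v : Fin n → SignType) :
    AltFrom a (Fin.cons x v : Fin (n + 1) → SignType) ↔
      (x = bif a then -1 else 1) ∧ AltFrom (!a) v := by
  have h3 : (-1 : SignType) ≠ 1 := by decide
  have h4 : (-1 : SignType) ≠ 0 := by decide
  constructor
  · rintro ⟨-, h2, h3', h4'⟩
    have hx' := h2 0 hx (by simp)
    rw [Fin.cons_zero] at hx'
    refine ⟨hx', ?_, ?_, ?_, ?_⟩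
    · intro ha
      by_contra hne
      push Not at hne
      have := h3' 0 hx (by simpa [Fin.forall_fin_succ] using hne)
      cases a <;> simp_all
    · intro i hi hk
      have := h4' 0 i.succ (by simp) hx hi (by
        simp only [Fin.forall_fin_succ]; simpa [Fin.succ_lt_succ_iff] using hk)
      rw [Fin.cons_succ, Fin.cons_zero, hx'] at this
      rw [this]; cases a <;> simp
    · intro i hi hk
      exact h3' i.succ hi (by simp only [Fin.forall_fin_succ]; simpa using hk)
    · intro i j hij hi hj hk
      exact h4' i.succ j.succ (by simpa) hi hj (by
        simp only [Fin.forall_fin_succ]; simpa using hk)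
  · rintro ⟨hx', h1, h2, h3', h4'⟩
    refine ⟨fun _ => ⟨0, hx⟩, ?_, ?_, ?_⟩
    · refine Fin.cases (fun _ _ => by simpa using hx') fun i hi hk => ?_
      exact absurd (hk 0 (by simp)) hx
    · refine Fin.cases (fun _ hk => ?_) fun i hi hk => ?_
      · cases a
        · simpa using hx'
        · obtain ⟨i, hi⟩ := h1 rfl
          exact absurd (hk i.succ (by simp)) hi
      · exact h3' i hi fun k hk' => hk k.succ (by simpa)
    · refine Fin.cases (fun j => ?_) fun i j => ?_
      · refine Fin.cases (fun h => absurd h (by simp)) (fun j _ _ hj hk => ?_) j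
        have := h2 j hj fun k hk' => hk k.succ (by simp) (by simpa)
        rw [Fin.cons_succ, Fin.cons_zero, this, hx']; cases a <;> simp
      · refine Fin.cases (fun h => absurd h (by simp)) (fun j hij hi hj hk => ?_) j
        exact h4' i j (by simpa using hij) hi hj fun k h1 h2 => hk k.succ (by simpa) (by simpa)

variable {R : Type*} [CommRing R]

open Classical in
theorem walk_eq_altFrom (a : Bool) {n : ℕ} (v : Fin n → SignType) :
    walk (stepWt (1 : R) 1 1) a (List.ofFn v) true = if AltFrom a v then 1 else 0 := by
  induction n generalizing a with
  | zero => simp [walk, altFrom_zero]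
  | succ n ih =>
    rw [← Fin.cons_self_tail v]
    generalize v 0 = x, Fin.tail v = v
    rw [List.ofFn_cons, walk]
    have h1 : (0 : SignType) ≠ 1 := by decide
    have h2 : (0 : SignType) ≠ -1 := by decide
    have h3 : (-1 : SignType) ≠ 1 := by decide
    by_cases hx : x = 0
    · subst hx
      simp only [ih, altFrom_cons_zero]
      cases a <;> simp [stepWt, h1, h2]
    · simp only [ih, altFrom_cons a x hx]
      cases a <;> simp only [stepWt, hx, Fintype.sum_bool, if_false, zero_mul, zero_add, add_zero,
        ite_mul, one_mul, ite_and, cond_true, cond_false, Bool.not_true, Bool.not_false]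

open Classical in
/-- With unit weights, a walk from `false` to `true` detects alternating sequences. -/
theorem walk_eq_isAlternating {n : ℕ} (v : Fin n → SignType) :
    walk (stepWt (1 : R) 1 1) false (List.ofFn v) true = if IsAlternating v then 1 else 0 := by
  rw [walk_eq_altFrom, altFrom_false]

theorem isAlternating_iff_walk {n : ℕ} (v : Fin n → SignType) :
    IsAlternating v ↔ walk (stepWt (1 : ℤ) 1 1) false (List.ofFn v) true ≠ 0 := by
  rw [walk_eq_isAlternating]; simp

/-- The entries of a walk sum to the difference of its end states. -/
theorem count_of_walk_ne_zero {a b : Bool} {l : List SignType}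
    (h : walk (stepWt (1 : R) 1 1) a l b ≠ 0) :
    l.count 1 + a.toNat = l.count (-1) + b.toNat := by
  induction l generalizing a with
  | nil =>
    simp only [walk] at h
    rw [show a = b by by_contra hne; simp [hne] at h]
    simp
  | cons m l ih =>
    rw [walk] at h
    obtain ⟨c, -, hc⟩ := Finset.exists_ne_zero_of_sum_ne_zero h
    have h1 := ih (right_ne_zero_of_mul hc)
    have h2 := left_ne_zero_of_mul hc
    have h3 : (-1 : SignType) ≠ 1 := by decide
    have h4 : (0 : SignType) ≠ 1 := by decide
    have h5 : (0 : SignType) ≠ -1 := by decide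
    cases a <;> cases c <;> simp only [stepWt, ne_eq, ite_eq_right_iff, Classical.not_imp] at h2 <;>
      obtain ⟨rfl, -⟩ := h2 <;> simp_all [List.count_cons] <;> try omega

theorem stepWt_colStep_one (w : R) : colStep w 1 = stepWt w w (w ^ 3) := by
  simp only [colStep]
  congr 1 <;> (simp only [wtE, wtN, gam]; ring)

/-- In a column with parameter `1` the weight depends only on the number of entries `-1`: as the
entries `1` and `-1` take turns, the weights `1` and `w ^ 3` may be replaced by `w` and `w ^ 2`,
with a correction for the end states. -/
theorem walk_colStep_one (w : R) (a b : Bool) (l : List SignType) :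
    walk (colStep w 1) a l b * w ^ b.toNat =
      w ^ (l.length + l.count (-1) + a.toNat) * walk (stepWt 1 1 1) a l b := by
  rw [stepWt_colStep_one]
  induction l generalizing a with
  | nil => cases a <;> cases b <;> simp [walk]
  | cons m l ih =>
    have h3 : (-1 : SignType) ≠ 1 := by decide
    have h4 : (0 : SignType) ≠ 1 := by decide
    have h5 : (0 : SignType) ≠ -1 := by decide
    simp only [walk, Finset.sum_mul, Finset.mul_sum]
    refine Finset.sum_congr rfl fun c _ => ?_
    rw [mul_assoc, ih, List.length_cons, List.count_cons]
    cases a <;> cases c <;> simp only [stepWt, beq_iff_eq]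
    · by_cases hm : m = 0
      · rw [if_pos hm, if_pos hm, if_neg (hm ▸ h5)]; simp; ring
      · simp [hm]
    · by_cases hm : m = 1
      · simp [hm, h3.symm]; ring
      · simp [hm]
    · by_cases hm : m = -1
      · simp [hm]; ring
      · simp [hm]
    · by_cases hm : m = 0
      · rw [if_pos hm, if_pos hm, if_neg (hm ▸ h5)]; simp; ring
      · simp [hm]

theorem walk_colStep_true (w t : R) (b : Bool) {l : List SignType} (hl : -1 ∉ l) :
    walk (colStep w t) true l b = w ^ l.length * walk (stepWt 1 1 1) true l b := by
  induction l with
  | nil => simp [walk]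
  | cons m l ih =>
    rw [List.mem_cons, not_or] at hl
    have e : wtN w 1 t = w := by simp only [wtN]; ring
    simp only [walk, Fintype.sum_bool, ih hl.2, stepWt, if_neg (Ne.symm hl.1), List.length_cons, e]
    split_ifs <;> ring

/-- In a column without entries `-1` and with parameter `t`, the exponent of `t` is the position
of the first entry `1`. -/
theorem walk_colStep_false (w t : R) (b : Bool) {l : List SignType} (hl : -1 ∉ l) :
    walk (colStep w t) false l b * w ^ b.toNat =
      t ^ l.idxOf 1 * w ^ l.length * walk (stepWt 1 1 1) false l b := by
  induction l with
  | nil => cases b <;> simp [walk]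
  | cons m l ih =>
    rw [List.mem_cons, not_or] at hl
    have e : wtE w 1 t = w * t := by simp only [wtE]; ring
    have h4 : (0 : SignType) ≠ 1 := by decide
    simp only [walk, Fintype.sum_bool, walk_colStep_true w t b hl.2, stepWt, List.length_cons, e]
    have hm : m = 0 ∨ m = 1 := by
      rcases SignType.trichotomy m with h | h | h
      · exact absurd h.symm hl.1
      · exact Or.inl h
      · exact Or.inr h
    rcases hm with rfl | rfl
    · simp only [h4, if_true, if_false, List.idxOf_cons_ne _ h4,
        Nat.succ_eq_add_one]
      linear_combination (w * t) * ih hl.2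
    · simp only [h4.symm, if_true, if_false, List.idxOf_cons_self]
      have hb : walk (stepWt (1 : R) 1 1) true l b * w ^ b.toNat =
          w * walk (stepWt 1 1 1) true l b := by
        cases b
        · by_cases h : walk (stepWt (1 : R) 1 1) true l false = 0
          · rw [h]; ring
          · have := count_of_walk_ne_zero h
            rw [List.count_eq_zero_of_not_mem hl.2] at this
            simp at this
        · simp [mul_comm]
      linear_combination w ^ l.length * hb

theorem count_ofFn {α : Type*} [DecidableEq α] (a : α) {n : ℕ} (f : Fin n → α) :
    (List.ofFn f).count a = ∑ i, if f i = a then 1 else 0 := by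
  induction n with
  | zero => simp
  | succ n ih =>
    rw [List.ofFn_succ, List.count_cons, ih, Fin.sum_univ_succ, add_comm]
    simp

theorem sum_pow_eq_pow_idxOf (t : R) {n : ℕ} (c : Fin n → SignType)
    (h : (List.ofFn c).count 1 = 1) :
    (∑ r, if c r = 1 then t ^ (r : ℕ) else 0) = t ^ (List.ofFn c).idxOf 1 := by
  induction n with
  | zero => simp at h
  | succ n ih =>
    rw [List.ofFn_succ, List.count_cons] at h
    rw [Fin.sum_univ_succ, List.ofFn_succ]
    by_cases h0 : c 0 = 1
    · simp only [h0, beq_self_eq_true, if_true, Nat.add_eq_right, List.count_eq_zero,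
        List.mem_ofFn] at h
      rw [Finset.sum_eq_zero, h0, List.idxOf_cons_self]
      · simp
      · intro i _
        rw [if_neg]
        intro hi; exact h ⟨i, hi⟩
    · simp only [beq_iff_eq, h0, if_false, add_zero] at h
      rw [if_neg h0, List.idxOf_cons_ne _ h0, pow_succ, ← ih _ h, zero_add, Finset.sum_mul]
      refine Finset.sum_congr rfl fun i _ => ?_
      rw [ite_mul, zero_mul, Fin.val_succ, pow_succ]

theorem negCount_eq_sum {n : ℕ} (M : Matrix (Fin n) (Fin n) SignType) :
    negCount M = ∑ k, (List.ofFn fun i => M i k).count (-1) := by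
  simp only [count_ofFn]
  rw [negCount, negPos, Finset.card_filter, Fintype.sum_prod_type_right]

end Alternating

/-! ### Alternating-sign matrices -/

section FirstColumn
variable {R : Type*} [CommRing R]

theorem ne_neg_one_of_walk_ne_zero {n : ℕ} (hn : 0 < n) {v : Fin n → SignType} {b : Bool}
    (h : walk (stepWt (1 : R) 1 1) false (List.ofFn v) b ≠ 0) : v ⟨0, hn⟩ ≠ -1 := by
  obtain _ | n := n
  · omega
  intro h0
  have h1 : (-1 : SignType) ≠ 1 := by decide
  have h2 : (-1 : SignType) ≠ 0 := by decide
  rw [List.ofFn_succ, walk, show v 0 = -1 from h0] at h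
  simp [stepWt, h1, h2] at h

theorem neg_one_notMem_firstCol {N : ℕ} (hN : 0 < N) {M : Matrix (Fin N) (Fin N) SignType}
    (hM : ∀ i, IsAlternating fun j => M i j) : -1 ∉ List.ofFn fun i => M i ⟨0, hN⟩ := by
  rw [List.mem_ofFn]
  rintro ⟨i, hi⟩
  exact ne_neg_one_of_walk_ne_zero hN ((isAlternating_iff_walk _).1 (hM i)) hi

theorem count_one_firstCol {N : ℕ} (hN : 0 < N) {M : Matrix (Fin N) (Fin N) SignType}
    (hM : IsASM M) : (List.ofFn fun i => M i ⟨0, hN⟩).count 1 = 1 := by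
  have h := count_of_walk_ne_zero ((isAlternating_iff_walk _).1 (hM.2 ⟨0, hN⟩))
  rw [List.count_eq_zero_of_not_mem (neg_one_notMem_firstCol hN hM.1)] at h
  simpa using h

open Classical in
/-- A sum over the row of the entry `1` in the first column is a sum weighted by the position of
that entry. -/
theorem sum_firstCol {N : ℕ} (hN : 0 < N) (P : Matrix (Fin N) (Fin N) SignType → Prop)
    (hP : ∀ M, P M → IsASM M) (f : Matrix (Fin N) (Fin N) SignType → R) (t : R) :
    ∑ r : Fin N, (∑ M with P M ∧ M r ⟨0, r.pos⟩ = 1, f M) * t ^ (r : ℕ) =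
      ∑ M with P M, t ^ (List.ofFn fun i => M i ⟨0, hN⟩).idxOf 1 * f M := by
  simp only [Finset.sum_mul, Finset.sum_filter]
  rw [Finset.sum_comm]
  refine Finset.sum_congr rfl fun M _ => ?_
  by_cases hM : P M
  · rw [if_pos hM, ← sum_pow_eq_pow_idxOf t (fun i => M i ⟨0, hN⟩)
      (count_one_firstCol hN (hP M hM)), Finset.sum_mul]
    refine Finset.sum_congr rfl fun r _ => ?_
    by_cases h : M r ⟨0, hN⟩ = 1 <;> simp [h, hM, mul_comm]
  · simp [hM]

/-- The weights of the columns, when the first one has the parameter `t` and no entry `-1`. -/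
theorem prod_walk_colStep (w t : R) {n : ℕ} (L : ℕ) (c : Fin (n + 1) → List SignType)
    (hL : ∀ k, (c k).length = L) (h0 : -1 ∉ c 0) :
    w ^ (n + 1) * ∏ k, walk (colStep w ((Fin.cons t fun _ => 1 : Fin (n + 1) → R) k)) false (c k)
      true = t ^ (c 0).idxOf 1 * w ^ ((n + 1) * L + ∑ k, (c k).count (-1)) *
        ∏ k, walk (stepWt 1 1 1) false (c k) true := by
  have h1 := walk_colStep_false w t true h0
  have h2 := fun k : Fin n => walk_colStep_one w false true (c k.succ)
  simp only [Fin.prod_univ_succ, Fin.sum_univ_succ, Fin.cons_zero, Fin.cons_succ, Bool.toNat_true,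
    Bool.toNat_false, pow_one, add_zero, hL, List.count_eq_zero_of_not_mem h0] at h1 h2 ⊢
  have h3 : w ^ n * ∏ k : Fin n, walk (colStep w 1) false (c k.succ) true =
      w ^ (n * L + ∑ k : Fin n, (c k.succ).count (-1)) *
        ∏ k : Fin n, walk (stepWt 1 1 1) false (c k.succ) true := by
    have : w ^ n = ∏ _k : Fin n, w := by simp
    rw [this, ← Finset.prod_mul_distrib]
    simp only [mul_comm w, h2, Finset.prod_mul_distrib, Finset.prod_pow_eq_pow_sum,
      Finset.sum_add_distrib]
    simp
  calc _ = (walk (colStep w t) false (c 0) true * w) *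
        (w ^ n * ∏ k : Fin n, walk (colStep w 1) false (c k.succ) true) := by ring
    _ = _ := by rw [h1, h3]; ring

theorem cons_one_apply {n : ℕ} (t : R) (k : Fin (n + 1)) (hk : (k : ℕ) ≠ 0) :
    (Fin.cons t fun _ => 1 : Fin (n + 1) → R) k = 1 := by
  obtain ⟨j, rfl⟩ := Fin.exists_succ_eq.2 (show k ≠ 0 from fun h => hk (by simp [h]))
  simp

theorem A_eq_sum {N : ℕ} (hN : 0 < N) (t x : R) : A N t x =
    open Classical in ∑ M : Matrix (Fin N) (Fin N) SignType with IsASM M,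
      t ^ (List.ofFn fun i => M i ⟨0, hN⟩).idxOf 1 * x ^ negCount M :=
  sum_firstCol hN IsASM (fun _ h => h) _ t

open Classical in
/-- The domain wall partition function at the homogeneous point, with `t` in the first column,
enumerates the alternating-sign matrices. -/
theorem Zdw_eq_A (w t : R) (n : ℕ) :
    w ^ (n + 1) * Zdw w (List.replicate (n + 1) 1) (Fin.cons t fun _ => 1 : Fin (n + 1) → R) =
      w ^ ((n + 1) * (n + 1)) * A (n + 1) t w := by
  rw [Zdw, dwProd_eq_sum w (cons_one_apply t), A_eq_sum n.succ_pos,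
    Matrix.sum_apply, Finset.mul_sum, Finset.mul_sum, Finset.sum_filter,
    ← (Matrix.of (α := SignType)).sum_comp]
  refine Finset.sum_congr rfl fun M _ => ?_
  rw [Matrix.smul_apply, smul_eq_mul, mul_left_comm]
  by_cases hrow : ∀ i, IsAlternating (M i)
  · have h0 : -1 ∉ List.ofFn fun i => M i 0 :=
      neg_one_notMem_firstCol n.succ_pos (M := Matrix.of M) hrow
    have e : IsASM (Matrix.of M) ↔ ∀ j, IsAlternating fun i => M i j :=
      ⟨fun h => h.2, fun h => ⟨hrow, h⟩⟩
    simp only [colMat, Matrix.of_apply, walk_eq_isAlternating, hrow, if_true,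
      Finset.prod_const_one, one_mul]
    rw [prod_walk_colStep w t (n + 1) _ (by simp) h0]
    simp only [walk_eq_isAlternating, Finset.prod_ite_zero, Finset.prod_const_one, e,
      Finset.mem_univ, true_imp_iff]
    split_ifs
    · rw [negCount_eq_sum, pow_add, mul_one, mul_left_comm]; rfl
    · simp
  · rw [if_neg fun h => hrow h.1]
    simp only [walk_eq_isAlternating, Finset.prod_ite_zero, Finset.mem_univ, true_imp_iff]
    rw [if_neg hrow, zero_mul]

end FirstColumn

/-! ### Vectors glued from two pieces -/

section Glue
variable {α β : Type*} {N a b n : ℕ}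

/-- The vector of length `N = a + b` that starts with `f` and, read backwards, starts with `g`. -/
def glue (h : N = a + b) (f : Fin a → α) (g : Fin b → α) (i : Fin N) : α :=
  if hi : (i : ℕ) < a then f ⟨i, hi⟩ else g ⟨N - 1 - i, by omega⟩

theorem glue_comp (φ : α → β) (h : N = a + b) (f : Fin a → α) (g : Fin b → α)
    (i : Fin N) : φ (glue h f g i) = glue h (fun i => φ (f i)) (fun i => φ (g i)) i := by
  simp only [glue]; split_ifs <;> rfl

theorem glue_castLE (h : N = a + b) (f : Fin a → α) (g : Fin b → α) (i : Fin a)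
    (h' : a ≤ N) : glue h f g (Fin.castLE h' i) = f i := by
  simp [glue]

theorem glue_rev_castLE (h : N = a + b) (f : Fin a → α) (g : Fin b → α) (i : Fin b)
    (h' : b ≤ N) : glue h f g (Fin.castLE h' i).rev = g i := by
  rw [glue, dif_neg (by simp [Fin.val_rev]; omega)]
  congr 1
  ext
  simp [Fin.val_rev]; omega

theorem glue_rev (h : N = a + b) (h' : N = b + a) (f : Fin a → α) (g : Fin b → α) (i : Fin N) :
    glue h f g i.rev = glue h' g f i := by
  simp only [glue, Fin.val_rev]
  split_ifs
  · omega
  · congr 1; ext; simp; omega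
  · congr 1; ext; simp; omega
  · omega

theorem ofFn_glue (h : N = a + b) (f : Fin a → α) (g : Fin b → α) :
    List.ofFn (glue h f g) = List.ofFn f ++ (List.ofFn g).reverse := by
  refine List.ext_getElem (by simp [h]) fun i h1 h2 => ?_
  simp only [List.length_ofFn] at h1
  simp only [List.getElem_ofFn, List.getElem_append, List.length_ofFn, List.getElem_reverse, glue]
  split_ifs
  · rfl
  · congr 2; omega

/-- Vectors of length `N = a + b` are glued from two pieces. -/
def glueEquiv (h : N = a + b) : (Fin a → α) × (Fin b → α) ≃ (Fin N → α) where
  toFun p := glue h p.1 p.2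
  invFun v := (fun i => v (Fin.castLE (by omega) i), fun i => v (Fin.castLE (by omega) i).rev)
  left_inv p := by ext i <;> simp [glue_castLE, glue_rev_castLE]
  right_inv v := by
    ext i
    simp only [glue]
    split_ifs
    · rfl
    · congr 1; ext; simp [Fin.val_rev]; omega

theorem sum_glue [Fintype α] {S : Type*} [AddCommMonoid S] (h : N = a + b)
    (G : (Fin N → α) → S) : ∑ v, G v = ∑ f : Fin a → α, ∑ g : Fin b → α, G (glue h f g) := by
  rw [← (glueEquiv h).sum_comp, Fintype.sum_prod_type]; rfl

theorem sum_glue_rows [Fintype α] {S : Type*} [AddCommMonoid S] {ι : Type*} [Fintype ι]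
    [DecidableEq ι] (h : N = a + b) (G : (ι → Fin N → α) → S) :
    ∑ T, G T = ∑ U : ι → Fin a → α, ∑ D : ι → Fin b → α, G fun i => glue h (U i) (D i) := by
  rw [← (Equiv.piCongrRight fun _ : ι => glueEquiv (α := α) h).sum_comp,
    ← (Equiv.arrowProdEquivProdArrow ι (fun _ => Fin a → α) fun _ => Fin b → α).symm.sum_comp,
    Fintype.sum_prod_type]
  rfl

theorem forall_glue (h : N = a + b) {P : Fin N → Prop} : (∀ i, P i) ↔
    (∀ i : Fin a, P (Fin.castLE (by omega) i)) ∧ ∀ i : Fin b, P (Fin.castLE (by omega) i).rev := by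
  refine ⟨fun h => ⟨fun _ => h _, fun _ => h _⟩, fun ⟨h1, h2⟩ i => ?_⟩
  by_cases hi : (i : ℕ) < a
  · exact h1 ⟨i, hi⟩
  · convert h2 ⟨N - 1 - i, by omega⟩
    ext; simp [Fin.val_rev]; omega

theorem sum_fin_glue (h : N = a + b) {S : Type*} [AddCommMonoid S] (f : Fin N → S) :
    ∑ i, f i = ∑ i : Fin a, f (Fin.castLE (by omega) i) +
      ∑ i : Fin b, f (Fin.castLE (by omega) i).rev := by
  rw [← List.sum_ofFn, show f = glue h (fun i : Fin a => f (Fin.castLE (by omega) i))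
    (fun i : Fin b => f (Fin.castLE (by omega) i).rev) from ((glueEquiv h).right_inv f).symm,
    ofFn_glue, List.sum_append, List.sum_reverse, List.sum_ofFn, List.sum_ofFn]
  simp only [glue_castLE, glue_rev_castLE]

variable {τ : α → α}

/-- A vector with `v (rev i) = τ (v i)` is determined by its first half. -/
theorem glue_symm_even (hτ : Function.Involutive τ) (h : N = n + n) {f g : Fin n → α} :
    (∀ i, glue h f g i.rev = τ (glue h f g i)) ↔ g = τ ∘ f := by
  simp only [forall_glue h, glue_castLE, glue_rev_castLE, Fin.rev_rev, funext_iff,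
    Function.comp_apply]
  exact ⟨fun h => h.1, fun h => ⟨h, fun i => by rw [h, hτ]⟩⟩

theorem castLE_last_eq_rev (h : N = n + 1 + n) :
    (Fin.castLE (by omega : n + 1 ≤ N) (Fin.last n)).rev = Fin.castLE (by omega) (Fin.last n) := by
  ext; simp [Fin.val_rev]; omega

/-- A vector of odd length with `v (rev i) = τ (v i)` is determined by its first half and its middle
entry, which is fixed by `τ`. -/
theorem glue_symm_odd (hτ : Function.Involutive τ) (h : N = n + 1 + n) {f g : Fin n → α} {c : α} :
    (∀ i, glue h (Fin.snoc f c : Fin (n + 1) → α) g i.rev =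
      τ (glue h (Fin.snoc f c : Fin (n + 1) → α) g i)) ↔ g = τ ∘ f ∧ τ c = c := by
  have e (i : Fin n) : Fin.castLE (by omega : n ≤ N) i =
      Fin.castLE (by omega : n + 1 ≤ N) i.castSucc := rfl
  have e1 (i : Fin n) : glue h (Fin.snoc f c : Fin (n + 1) → α) g
      (Fin.castLE (by omega) i.castSucc).rev = g i := glue_rev_castLE h _ g i (by omega)
  simp only [forall_glue h, Fin.forall_fin_succ', e, e1, castLE_last_eq_rev h, glue_castLE,
    Fin.rev_rev, funext_iff, Function.comp_apply, Fin.snoc_castSucc, Fin.snoc_last]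
  exact ⟨fun h => ⟨h.1.1, h.1.2.symm⟩, fun h => ⟨⟨h.1, h.2.symm⟩, fun i => by rw [h.1, hτ]⟩⟩

open Classical in
theorem sum_symm_even [Fintype α] {S : Type*} [AddCommMonoid S] (hτ : Function.Involutive τ)
    (h : N = n + n) (G : (Fin N → α) → S) :
    ∑ F with ∀ i, F (Fin.rev i) = τ (F i), G F = ∑ f : Fin n → α, G (glue h f (τ ∘ f)) := by
  rw [Finset.sum_filter, sum_glue h]
  simp only [glue_symm_even hτ]
  simp

open Classical in
theorem sum_symm_odd [Fintype α] {S : Type*} [AddCommMonoid S] (hτ : Function.Involutive τ)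
    (h : N = n + 1 + n) (G : (Fin N → α) → S) :
    ∑ F with ∀ i, F (Fin.rev i) = τ (F i), G F = ∑ f : Fin n → α, ∑ c with τ c = c,
      G (glue h (Fin.snoc f c : Fin (n + 1) → α) (τ ∘ f)) := by
  rw [Finset.sum_filter, sum_glue h, sum_snoc]
  simp only [glue_symm_odd hτ, ite_and, Finset.sum_filter]
  simp

end Glue

/-! ### Half-turn symmetric matrices -/

section HalfTurn
variable {n N : ℕ}

/-- Invariance of a matrix under the half-turn. -/
def IsHT (M : Matrix (Fin N) (Fin N) SignType) : Prop := ∀ i j, M i.rev j.rev = M i j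

theorem isHT_of {F : Fin N → Fin N → SignType} :
    IsHT (Matrix.of F) ↔ ∀ i, F i.rev = F i ∘ Fin.rev := by
  simp only [IsHT, funext_iff, Function.comp_apply, Matrix.of_apply]
  exact forall_congr' fun i => ⟨fun h j => by rw [← h, Fin.rev_rev],
    fun h j => by rw [h, Fin.rev_rev]⟩

theorem involutive_comp_rev : Function.Involutive fun v : Fin N → SignType => v ∘ Fin.rev :=
  fun v => by ext; simp

/-- The half-turn symmetric matrix of even order with the upper half `(U i, D i reversed)`. -/
def htEven (h : N = n + n) (U D : Fin n → Fin n → SignType) : Matrix (Fin N) (Fin N) SignType :=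
  Matrix.of (glue h (fun i => glue h (U i) (D i)) fun i => glue h (D i) (U i))

/-- The half-turn symmetric matrix of odd order with the upper half `(U i, D i reversed)` and the
middle row `(r, c, r reversed)`. -/
def htOdd (h : N = n + 1 + n) (U : Fin n → Fin (n + 1) → SignType) (D : Fin n → Fin n → SignType)
    (r : Fin n → SignType) (c : SignType) : Matrix (Fin N) (Fin N) SignType :=
  Matrix.of (glue h (Fin.snoc (fun i => glue h (U i) (D i))
    (glue h (Fin.snoc r c : Fin (n + 1) → SignType) r) : Fin (n + 1) → Fin N → SignType)
    fun i => glue h (U i) (D i) ∘ Fin.rev)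

open Classical in
theorem sum_isHT_even {S : Type*} [AddCommMonoid S] (h : N = n + n)
    (G : Matrix (Fin N) (Fin N) SignType → S) :
    ∑ M with IsHT M, G M =
      ∑ U : Fin n → Fin n → SignType, ∑ D : Fin n → Fin n → SignType, G (htEven h U D) := by
  rw [Finset.sum_filter, ← (Matrix.of (α := SignType)).sum_comp, ← Finset.sum_filter]
  simp only [isHT_of]
  refine (Eq.trans (Finset.sum_congr (by congr!) fun _ _ => rfl)
    (sum_symm_even involutive_comp_rev h fun F => G (Matrix.of F))).trans ?_
  rw [sum_glue_rows h]
  refine Finset.sum_congr rfl fun U _ => Finset.sum_congr rfl fun D _ => ?_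
  rw [htEven]
  congr 3
  ext i j
  exact glue_rev h h (U i) (D i) j

open Classical in
/-- A half-turn symmetric matrix is a symmetric vector of rows, whose middle row is a palindrome. -/
theorem sum_isHT_odd {S : Type*} [AddCommMonoid S] (h : N = n + 1 + n)
    (G : Matrix (Fin N) (Fin N) SignType → S) :
    ∑ M with IsHT M, G M =
      ∑ U : Fin n → Fin (n + 1) → SignType, ∑ D : Fin n → Fin n → SignType,
        ∑ r : Fin n → SignType, ∑ c, G (htOdd h U D r c) := by
  rw [Finset.sum_filter, ← (Matrix.of (α := SignType)).sum_comp, ← Finset.sum_filter]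
  simp only [isHT_of]
  refine (Eq.trans (Finset.sum_congr (by congr!) fun _ _ => rfl)
    (sum_symm_odd involutive_comp_rev h fun F => G (Matrix.of F))).trans ?_
  rw [sum_glue_rows h]
  refine Finset.sum_congr rfl fun U _ => Finset.sum_congr rfl fun D _ => ?_
  have := sum_symm_odd (α := SignType) (τ := id) (fun _ => rfl) h fun c => G (Matrix.of
    (glue h (Fin.snoc (fun i => glue h (U i) (D i)) c : Fin (n + 1) → Fin N → SignType)
    fun i => glue h (U i) (D i) ∘ Fin.rev))
  simp only [id, Finset.filter_true] at this
  refine Eq.trans (Finset.sum_congr ?_ fun _ _ => rfl) this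
  ext v
  simp [funext_iff]

end HalfTurn

/-! ### Half-turn symmetric alternating-sign matrices of even order -/

section HalfTurnASM
variable {R : Type*} [CommRing R] {N a b n : ℕ}

theorem ofFn_comp_rev {α : Type*} (v : Fin N → α) :
    List.ofFn (fun i => v i.rev) = (List.ofFn v).reverse := by
  refine List.ext_getElem (by simp) fun i h1 h2 => ?_
  simp only [List.length_ofFn] at h1
  simp only [List.getElem_ofFn, List.getElem_reverse, List.length_ofFn]
  congr 1; ext; simp [Fin.val_rev]; omega

theorem isAlternating_comp_rev {v : Fin N → SignType} :
    IsAlternating (fun i => v i.rev) ↔ IsAlternating v := by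
  have := walk_reverse (R := ℤ) false (List.ofFn v) true
  rw [isAlternating_iff_walk, isAlternating_iff_walk, ofFn_comp_rev, ← this]; rfl

/-- A row of a half-turn symmetric state is allowed if the walks through its left half and backwards
through its right half end in opposite states. -/
theorem walk_glue (h : N = a + b) (f : Fin a → SignType) (g : Fin b → SignType) :
    walk (stepWt (1 : R) 1 1) false (List.ofFn (glue h f g)) true =
      ∑ ε, walk (stepWt (1 : R) 1 1) false (List.ofFn f) ε *
        walk (stepWt (1 : R) 1 1) false (List.ofFn g) (!ε) := by
  rw [ofFn_glue, walk_append]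
  refine Finset.sum_congr rfl fun ε _ => ?_
  rw [← walk_reverse false (List.ofFn g) (!ε), Bool.not_not]; rfl

theorem IsHT.forall_rows {M : Matrix (Fin N) (Fin N) SignType} (hM : IsHT M) (h : N = a + b)
    (hab : b ≤ a) : (∀ i, IsAlternating fun j => M i j) ↔
      ∀ i : Fin a, IsAlternating fun j => M (Fin.castLE (by omega) i) j := by
  have h1 (i : Fin N) : IsAlternating (fun j => M i.rev j) ↔ IsAlternating fun j => M i j := by
    rw [← isAlternating_comp_rev]; simp only [hM i]
  rw [forall_glue h]
  simp only [h1]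
  exact ⟨fun h => h.1, fun h => ⟨h, fun i => h (Fin.castLE hab i)⟩⟩

theorem IsHT.forall_cols {M : Matrix (Fin N) (Fin N) SignType} (hM : IsHT M) (h : N = a + b)
    (hab : b ≤ a) : (∀ j, IsAlternating fun i => M i j) ↔
      ∀ k : Fin a, IsAlternating fun i => M i (Fin.castLE (by omega) k) := by
  have h2 (j : Fin N) : IsAlternating (fun i => M i j.rev) ↔ IsAlternating fun i => M i j := by
    rw [← isAlternating_comp_rev]; simp only [hM _ j]
  rw [forall_glue h]
  simp only [h2]
  exact ⟨fun h => h.1, fun h => ⟨h, fun i => h (Fin.castLE hab i)⟩⟩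

theorem IsHT.count_rev {M : Matrix (Fin N) (Fin N) SignType} (hM : IsHT M) (k : Fin N) :
    (List.ofFn fun i => M i k.rev).count (-1) = (List.ofFn fun i => M i k).count (-1) := by
  rw [← List.count_reverse, ← ofFn_comp_rev]; simp only [hM _ k]

theorem isHT_htEven (h : N = n + n) (U D : Fin n → Fin n → SignType) : IsHT (htEven h U D) := by
  rw [htEven, isHT_of]
  intro i
  rw [glue_rev h h]
  ext j
  refine (glue_comp (fun v : Fin N → SignType => v j) h _ _ i).trans (Eq.trans ?_
    (glue_comp (fun v : Fin N → SignType => v j.rev) h _ _ i).symm)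
  simp only [glue_rev h h]

theorem isHT_htOdd (h : N = n + 1 + n) (U : Fin n → Fin (n + 1) → SignType)
    (D : Fin n → Fin n → SignType) (r : Fin n → SignType) (c : SignType) :
    IsHT (htOdd h U D r c) := by
  rw [htOdd, isHT_of]
  refine (glue_symm_odd involutive_comp_rev h).2 ⟨rfl, ?_⟩
  ext j
  exact (glue_symm_odd (τ := id) (fun _ => rfl) h).2 ⟨rfl, rfl⟩ j

theorem htEven_castLE (h : N = n + n) (U D : Fin n → Fin n → SignType) (i : Fin n) :
    (fun j => htEven h U D (Fin.castLE (by omega) i) j) = glue h (U i) (D i) := by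
  ext j; rw [htEven, Matrix.of_apply, glue_castLE]

theorem htEven_col (h : N = n + n) (U D : Fin n → Fin n → SignType) (k : Fin n) :
    (fun i => htEven h U D i (Fin.castLE (by omega) k)) =
      glue h (fun i => U i k) (fun i => D i k) := by
  ext i
  rw [htEven, Matrix.of_apply]
  refine (glue_comp (fun v : Fin N → SignType => v (Fin.castLE (by omega) k)) h _ _ i).trans ?_
  simp only [glue_castLE]

theorem IsHT.negCount_even {M : Matrix (Fin N) (Fin N) SignType} (hM : IsHT M) (h : N = n + n) :
    negCount M =
      2 * ∑ k : Fin n, (List.ofFn fun i => M i (Fin.castLE (by omega) k)).count (-1) := by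
  rw [negCount_eq_sum, sum_fin_glue h]
  simp only [hM.count_rev, two_mul]

open Classical in
/-- The generating function of the half-turn symmetric alternating-sign matrices of even order `N`,
as a polynomial in `t` and `x`. -/
noncomputable def htGen (N : ℕ) (hN : 0 < N) (t x : R) : R :=
  ∑ M : Matrix (Fin N) (Fin N) SignType with IsHTASM M,
    t ^ (List.ofFn fun i => M i ⟨0, hN⟩).idxOf 1 * x ^ (negCount M / 2)

theorem AHT_eq_htGen (hN : 0 < 2 * n) (t s : R) : AHT (2 * n) t s = htGen (2 * n) hN t (s ^ 2) := by
  classical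
  refine (sum_firstCol hN IsHTASM (fun _ h => h.1) _ t).trans ?_
  rw [htGen]
  refine Finset.sum_congr (by congr!) fun M hM => ?_
  have hM : IsHT M := (Finset.mem_filter.1 hM).2.2
  rw [hM.negCount_even (n := n) (by omega), Nat.mul_div_cancel_left _ two_pos, pow_mul]

/-- The half-turn symmetric partition function at the homogeneous point, with `t` in the first
column, enumerates the half-turn symmetric alternating-sign matrices. -/
theorem Zht_eq_htGen (w t : R) (h : N = n + 1 + (n + 1)) (hN : 0 < N) :
    w ^ (n + 1) * Zht w (List.replicate (n + 1) 1) (Fin.cons t fun _ => 1 : Fin (n + 1) → R) =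
      w ^ ((n + 1) * N) * htGen N hN t w := by
  classical
  have e : htGen N hN t w = ∑ M with IsHT M, if IsASM M then
      t ^ (List.ofFn fun i => M i ⟨0, hN⟩).idxOf 1 * w ^ (negCount M / 2) else 0 := by
    rw [htGen, ← Finset.sum_filter, Finset.filter_filter]
    refine Finset.sum_congr (Finset.ext fun M => by
      simp only [Finset.mem_filter, Finset.mem_univ, true_and]; exact and_comm) fun _ _ => rfl
  rw [e, sum_isHT_even h, Zht, nest_eq_sum w (cons_one_apply t) (cons_one_apply t),
    Matrix.sum_apply, Finset.mul_sum, Finset.mul_sum]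
  refine Finset.sum_congr rfl fun U _ => ?_
  rw [Matrix.sum_apply, Finset.mul_sum, Finset.mul_sum]
  refine Finset.sum_congr rfl fun D _ => ?_
  have hM := isHT_htEven h U D
  rw [Matrix.smul_apply, smul_eq_mul, mul_left_comm, Matrix.mul_one, colMat_mul,
    hM.negCount_even h, Nat.mul_div_cancel_left _ two_pos, IsASM, hM.forall_rows h le_rfl,
    hM.forall_cols h le_rfl]
  simp only [← walk_glue h, ← ofFn_glue h, ← htEven_castLE, ← htEven_col h]
  generalize htEven h U D = M at hM ⊢
  by_cases hrow : ∀ i : Fin (n + 1), IsAlternating fun j => M (Fin.castLE (by omega) i) j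
  · have h0 := neg_one_notMem_firstCol hN ((hM.forall_rows h le_rfl).2 hrow)
    rw [colMat, Matrix.of_apply, prod_walk_colStep w t N _ (by simp) h0]
    by_cases hcol : ∀ k : Fin (n + 1), IsAlternating fun i => M i (Fin.castLE (by omega) k)
    · rw [if_pos ⟨hrow, hcol⟩]
      simp only [walk_eq_isAlternating, hrow, hcol, if_true, Finset.prod_const_one, one_mul,
        mul_one, pow_add, mul_left_comm (w ^ ((n + 1) * N))]
      rfl
    · rw [if_neg fun h => hcol h.2]
      simp only [walk_eq_isAlternating, Finset.prod_ite_zero, Finset.mem_univ, true_imp_iff]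
      rw [if_neg hcol, mul_zero, mul_zero, mul_zero]
  · rw [if_neg fun h => hrow h.1]
    simp only [walk_eq_isAlternating, Finset.prod_ite_zero, Finset.mem_univ, true_imp_iff]
    rw [if_neg hrow, zero_mul, mul_zero]

end HalfTurnASM

/-! ### The central row and the central column -/

section HalfTurnOdd
variable {R : Type*} [CommRing R] {N n : ℕ}

theorem signType_cases (m : SignType) : m = 0 ∨ m = 1 ∨ m = -1 := by
  rcases SignType.trichotomy m with h | h | h <;> simp [h]

theorem walk_eq_zero_or_one (a : Bool) (l : List SignType) (b : Bool) :
    walk (stepWt (1 : R) 1 1) a l b = 0 ∨ walk (stepWt (1 : R) 1 1) a l b = 1 := by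
  have h1 : (0 : SignType) ≠ 1 := by decide
  have h2 : (0 : SignType) ≠ -1 := by decide
  have h3 : (1 : SignType) ≠ -1 := by decide
  induction l generalizing a with
  | nil => simp only [walk]; split_ifs <;> simp
  | cons m l ih =>
    rcases signType_cases m with rfl | rfl | rfl <;> cases a <;>
      simp [walk, stepWt, h1, h2, h3, h1.symm, h2.symm, h3.symm, ih]

theorem walk_true_mul_walk_false (a : Bool) (l : List SignType) :
    walk (stepWt (1 : R) 1 1) a l true * walk (stepWt (1 : R) 1 1) a l false = 0 := by
  by_contra h
  have h1 := count_of_walk_ne_zero (left_ne_zero_of_mul h)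
  have h2 := count_of_walk_ne_zero (right_ne_zero_of_mul h)
  simp at h1 h2
  omega

theorem walk_mul_self (a : Bool) (l : List SignType) (b : Bool) :
    walk (stepWt (1 : R) 1 1) a l b * walk (stepWt (1 : R) 1 1) a l b =
      walk (stepWt (1 : R) 1 1) a l b := by
  rcases walk_eq_zero_or_one (R := R) a l b with h | h <;> simp [h]

/-- The central entry of a palindromic row whose first half leads to the state `s`. -/
def midSign (s : Bool) : SignType := bif s then -1 else 1

theorem ofFn_snoc {α : Type*} (f : Fin n → α) (c : α) :
    List.ofFn (Fin.snoc f c : Fin (n + 1) → α) = List.ofFn f ++ [c] := by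
  rw [List.ofFn_succ_last]; simp

/-- A palindromic sequence of odd length is alternating if its middle entry is the one determined by
the state after its first half. -/
theorem walk_palindrome (h : N = n + 1 + n) (r : Fin n → SignType) (c : SignType) :
    walk (stepWt (1 : R) 1 1) false (List.ofFn (glue h (Fin.snoc r c : Fin (n + 1) → SignType) r))
      true = ∑ s, if c = midSign s then walk (stepWt 1 1 1) false (List.ofFn r) s else 0 := by
  have h1 := walk_true_mul_walk_false (R := R) false (List.ofFn r)
  have h2 := walk_mul_self (R := R) false (List.ofFn r) true
  have h3 := walk_mul_self (R := R) false (List.ofFn r) false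
  rw [walk_glue, ofFn_snoc]
  simp only [walk_append, walk_singleton, Fintype.sum_bool, stepWt, midSign, cond_true, cond_false,
    Bool.not_true, Bool.not_false]
  have d1 : (0 : SignType) ≠ 1 := by decide
  have d2 : (0 : SignType) ≠ -1 := by decide
  have d3 : (1 : SignType) ≠ -1 := by decide
  rcases signType_cases c with rfl | rfl | rfl
  · simp only [d1, d2, if_true, if_false]
    linear_combination 2 * h1
  · simp only [d1.symm, d3, if_true, if_false]
    linear_combination h3
  · simp only [d2.symm, d3.symm, if_true, if_false]
    linear_combination h2

theorem colMat_snoc (w z : R) (y : Fin n → R) (A : Fin (n + 1) → List SignType)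
    (v' v : Fin n → Bool) (s' s : Bool) :
    colMat w (Fin.snoc y z : Fin (n + 1) → R) A (Fin.snoc v' s' : Fin (n + 1) → Bool)
      (Fin.snoc v s : Fin (n + 1) → Bool) =
      colMat w y (fun k => A k.castSucc) v' v * walk (colStep w z) s' (A (Fin.last n)) s := by
  simp [colMat, Fin.prod_univ_castSucc]

/-- The operator of the left half of a state of odd order as a sum over the common state `s` at the
centre and the entries `r` of the left half of the central row. -/
theorem colMat_mul_oddBase_mul (w p q : R) {y : Fin n → R}
    (hy : ∀ k : Fin n, (k : ℕ) ≠ 0 → y k = 1) (A : Fin (n + 1) → List SignType)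
    (C : Fin n → List SignType) :
    (colMat w (Fin.snoc y 1 : Fin (n + 1) → R) A * oddBase w p q 1 y * colMat w y C) bot top =
      ∑ s, (bif s then q else p) * walk (colStep w 1) false (A (Fin.last n)) s *
        ∑ r : Fin n → SignType, walk (stepWt 1 1 1) false (List.ofFn r) s *
          colMat w y (fun k => A k.castSucc ++ [r k] ++ C k) bot top := by
  have e : ∀ s, (colMat w y (fun k => A k.castSucc) * rowT w 1 y false s * colMat w y C) bot top =
      ∑ r : Fin n → SignType, walk (stepWt 1 1 1) false (List.ofFn r) s *
          colMat w y (fun k => A k.castSucc ++ [r k] ++ C k) bot top := by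
    intro s
    rw [rowT_eq_colMat w hy, Matrix.mul_sum, Matrix.sum_mul, Matrix.sum_apply]
    refine Finset.sum_congr rfl fun r _ => ?_
    rw [Matrix.mul_smul, Matrix.smul_mul, Matrix.smul_apply, colMat_mul, colMat_mul, smul_eq_mul]
  simp only [← e, Matrix.mul_assoc _ _ (colMat w y C)]
  rw [Matrix.mul_apply, sum_snoc, Finset.sum_comm]
  refine Finset.sum_congr rfl fun s _ => ?_
  rw [Matrix.mul_apply, Finset.mul_sum]
  refine Finset.sum_congr rfl fun v _ => ?_
  rw [bot_snoc, colMat_snoc, Matrix.mul_apply, Matrix.mul_apply, Finset.mul_sum, Finset.mul_sum,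
    Finset.mul_sum]
  refine Finset.sum_congr rfl fun u _ => ?_
  have : oddBase w p q 1 y (Fin.snoc v s : Fin (n + 1) → Bool) u =
      (bif s then q else p) * rowT w 1 y false s v u := by
    cases s <;> simp [oddBase]
  rw [this]
  ring

theorem htOdd_row (h : N = n + 1 + n) (U : Fin n → Fin (n + 1) → SignType)
    (D : Fin n → Fin n → SignType) (r : Fin n → SignType) (c : SignType) (i : Fin n) :
    (fun j => htOdd h U D r c (Fin.castLE (by omega) i.castSucc) j) = glue h (U i) (D i) := by
  ext j; rw [htOdd, Matrix.of_apply, glue_castLE, Fin.snoc_castSucc]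

theorem htOdd_row_last (h : N = n + 1 + n) (U : Fin n → Fin (n + 1) → SignType)
    (D : Fin n → Fin n → SignType) (r : Fin n → SignType) (c : SignType) :
    (fun j => htOdd h U D r c (Fin.castLE (by omega) (Fin.last n)) j) =
      glue h (Fin.snoc r c : Fin (n + 1) → SignType) r := by
  ext j; rw [htOdd, Matrix.of_apply, glue_castLE, Fin.snoc_last]

theorem htOdd_col (h : N = n + 1 + n) (U : Fin n → Fin (n + 1) → SignType)
    (D : Fin n → Fin n → SignType) (r : Fin n → SignType) (c : SignType) (k : Fin n) :
    (fun i => htOdd h U D r c i (Fin.castLE (by omega) k.castSucc)) =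
      glue h (Fin.snoc (fun i => U i k.castSucc) (r k) : Fin (n + 1) → SignType)
        (fun i => D i k) := by
  ext i
  rw [htOdd, Matrix.of_apply]
  refine (glue_comp (fun v : Fin N → SignType =>
    v (Fin.castLE (by omega) k.castSucc)) h _ _ i).trans
    ?_
  congr 1
  · ext i
    refine Fin.lastCases ?_ (fun i => ?_) i <;>
      simp only [Fin.snoc_last, Fin.snoc_castSucc, glue_castLE]
  · ext i
    exact glue_rev_castLE h (U i) (D i) k (by omega)

theorem htOdd_col_last (h : N = n + 1 + n) (U : Fin n → Fin (n + 1) → SignType)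
    (D : Fin n → Fin n → SignType) (r : Fin n → SignType) (c : SignType) :
    (fun i => htOdd h U D r c i (Fin.castLE (by omega) (Fin.last n))) =
      glue h (Fin.snoc (fun i => U i (Fin.last n)) c : Fin (n + 1) → SignType)
        (fun i => U i (Fin.last n)) := by
  ext i
  rw [htOdd, Matrix.of_apply]
  refine (glue_comp (fun v : Fin N → SignType => v (Fin.castLE (by omega) (Fin.last n))) h _ _
    i).trans ?_
  congr 1
  · ext i
    refine Fin.lastCases ?_ (fun i => ?_) i <;>
      simp only [Fin.snoc_last, Fin.snoc_castSucc, glue_castLE]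
  · ext i
    rw [Function.comp_apply, castLE_last_eq_rev h, glue_castLE]

theorem IsHT.negCount_odd {M : Matrix (Fin N) (Fin N) SignType} (hM : IsHT M) (h : N = n + 1 + n) :
    negCount M = 2 * ∑ k : Fin n,
      (List.ofFn fun i => M i (Fin.castLE (by omega) k.castSucc)).count (-1) +
      (List.ofFn fun i => M i (Fin.castLE (by omega) (Fin.last n))).count (-1) := by
  rw [negCount_eq_sum, sum_fin_glue h, Fin.sum_univ_castSucc]
  simp only [hM.count_rev, two_mul]
  rw [add_right_comm]; rfl

theorem negCount_htOdd (h : N = n + 1 + n) (U : Fin n → Fin (n + 1) → SignType)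
    (D : Fin n → Fin n → SignType) (r : Fin n → SignType) (s : Bool) :
    negCount (htOdd h U D r (midSign s)) = 2 * (∑ k : Fin n,
      (List.ofFn fun i => htOdd h U D r (midSign s) i (Fin.castLE (by omega) k.castSucc)).count (-1)
      + (List.ofFn fun i => U i (Fin.last n)).count (-1)) + s.toNat := by
  rw [(isHT_htOdd h U D r _).negCount_odd h, htOdd_col_last, ofFn_glue, ofFn_snoc]
  have : List.count (-1) [midSign s] = s.toNat := by cases s <;> decide
  simp only [List.count_append, List.count_reverse, this]
  ring

/-- The weight of the central entry: `a` for `1` and `b` for `-1`. -/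
def midWt (a b : R) (c : SignType) : R := if c = 1 then a else if c = -1 then b else 0

/-- The sum over the central entry `c` for which the central row and the central column are
alternating, as a sum over the common state `s` at the centre. -/
theorem sum_midWt (h : N = n + 1 + n) (a b : R) (r f : Fin n → SignType) (G : SignType → R) :
    open Classical in
    (∑ c, if IsAlternating (glue h (Fin.snoc r c : Fin (n + 1) → SignType) r) ∧
      IsAlternating (glue h (Fin.snoc f c : Fin (n + 1) → SignType) f) then
        midWt a b c * G c else 0) =
    ∑ s, (bif s then b else a) * walk (stepWt 1 1 1) false (List.ofFn r) s *
      walk (stepWt 1 1 1) false (List.ofFn f) s * G (midSign s) := by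
  classical
  have e (c : SignType) : (if IsAlternating (glue h (Fin.snoc r c : Fin (n + 1) → SignType) r) ∧
      IsAlternating (glue h (Fin.snoc f c : Fin (n + 1) → SignType) f) then
        midWt a b c * G c else 0) =
      (∑ s, if c = midSign s then walk (stepWt 1 1 1) false (List.ofFn r) s else 0) *
      (∑ s, if c = midSign s then walk (stepWt 1 1 1) false (List.ofFn f) s else 0) *
        (midWt a b c * G c) := by
    rw [← walk_palindrome h, ← walk_palindrome h, walk_eq_isAlternating, walk_eq_isAlternating]
    split_ifs <;> simp_all
  have d1 : (0 : SignType) ≠ 1 := by decide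
  have d2 : (0 : SignType) ≠ -1 := by decide
  have d3 : (1 : SignType) ≠ -1 := by decide
  simp only [e]
  simp only [sum_signType, Fintype.sum_bool, midSign, cond_true, cond_false, midWt, d1, d2, d3,
    d1.symm, d2.symm, d3.symm, if_true, if_false]
  ring

end HalfTurnOdd

/-! ### Half-turn symmetric alternating-sign matrices of odd order -/

section HalfTurnOddLink
variable {R : Type*} [CommRing R] {N n : ℕ}

theorem neg_one_notMem_oddCol (h : N = n + 1 + 1 + (n + 1))
    {U : Fin (n + 1) → Fin (n + 1 + 1) → SignType}
    {D : Fin (n + 1) → Fin (n + 1) → SignType} {r : Fin (n + 1) → SignType} {s : Bool}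
    (hrow : ∀ i : Fin (n + 1), IsAlternating (glue h (U i) (D i)))
    (hr : walk (stepWt (1 : R) 1 1) false (List.ofFn r) s ≠ 0) :
    -1 ∉ (List.ofFn fun i => U i 0) ++ [r 0] ++ (List.ofFn fun i => D i 0).reverse := by
  have hN : 0 < N := by omega
  simp only [List.mem_append, List.mem_singleton, List.mem_reverse, List.mem_ofFn, not_or,
    not_exists]
  refine ⟨⟨fun i hi => ?_, fun hi => ?_⟩, fun i hi => ?_⟩
  · refine ne_neg_one_of_walk_ne_zero hN ((isAlternating_iff_walk _).1 (hrow i)) ?_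
    rw [← hi]
    exact glue_castLE h (U i) (D i) 0 (by omega)
  · exact ne_neg_one_of_walk_ne_zero n.succ_pos hr hi.symm
  · refine ne_neg_one_of_walk_ne_zero hN ((isAlternating_iff_walk _).1
      (isAlternating_comp_rev.2 (hrow i))) ?_
    rw [← hi]
    exact glue_rev_castLE h (U i) (D i) 0 (by omega)

open Classical in
/-- The partition function of odd order at the homogeneous point, with `t` in the first column,
enumerates the half-turn symmetric alternating-sign matrices, with weights for the central entry.
The central column carries a factor `w` more in the state `false` than in the state `true`. -/
theorem Zodd_eq_sum (w t p q : R) (h : N = n + 1 + 1 + (n + 1)) (hN : 0 < N) :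
    w ^ (n + 1 + 1) * Zodd w p q 1 1 (List.replicate (n + 1) 1)
      (Fin.cons t fun _ => 1 : Fin (n + 1) → R) = w ^ ((n + 1) * (N + 1)) *
      ∑ M : Matrix (Fin N) (Fin N) SignType with IsHTASM M,
        midWt (w * p) q (M ⟨n + 1, by omega⟩ ⟨n + 1, by omega⟩) *
          (t ^ (List.ofFn fun i => M i ⟨0, hN⟩).idxOf 1 * w ^ (negCount M / 2)) := by
  have hy := cons_one_apply (n := n) t
  have hz : ∀ k : Fin (n + 1 + 1), (k : ℕ) ≠ 0 →
      (Fin.snoc (Fin.cons t fun _ => 1 : Fin (n + 1) → R) 1 : Fin (n + 1 + 1) → R) k = 1 := by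
    intro k
    refine Fin.lastCases (fun _ => by simp) (fun k hk => ?_) k
    rw [Fin.snoc_castSucc, hy k hk]
  have e : (∑ M : Matrix (Fin N) (Fin N) SignType with IsHTASM M,
        midWt (w * p) q (M ⟨n + 1, by omega⟩ ⟨n + 1, by omega⟩) *
          (t ^ (List.ofFn fun i => M i ⟨0, hN⟩).idxOf 1 * w ^ (negCount M / 2))) =
      ∑ M with IsHT M, if IsASM M then midWt (w * p) q (M ⟨n + 1, by omega⟩ ⟨n + 1, by omega⟩) *
          (t ^ (List.ofFn fun i => M i ⟨0, hN⟩).idxOf 1 * w ^ (negCount M / 2)) else 0 := by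
    rw [← Finset.sum_filter, Finset.filter_filter]
    refine Finset.sum_congr (Finset.ext fun M => by
      simp only [Finset.mem_filter, Finset.mem_univ, true_and]; exact and_comm) fun _ _ => rfl
  rw [e, sum_isHT_odd h, Zodd, nest_eq_sum w hz hy, Matrix.sum_apply, Finset.mul_sum,
    Finset.mul_sum]
  refine Finset.sum_congr rfl fun U _ => ?_
  rw [Matrix.sum_apply, Finset.mul_sum, Finset.mul_sum]
  refine Finset.sum_congr rfl fun D _ => ?_
  rw [Matrix.smul_apply, smul_eq_mul, colMat_mul_oddBase_mul w p q hy, Finset.mul_sum]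
  simp only [Finset.mul_sum]
  rw [Finset.sum_comm]
  refine Finset.sum_congr rfl fun r _ => ?_
  simp only [← walk_glue h]
  have hc (c : SignType) : htOdd h U D r c ⟨n + 1, by omega⟩ ⟨n + 1, by omega⟩ = c := by
    have := congrFun (htOdd_row_last h U D r c) (Fin.castLE (by omega) (Fin.last (n + 1)))
    rw [glue_castLE, Fin.snoc_last] at this
    exact this
  have hcol0 (c : SignType) : (fun i => htOdd h U D r c i ⟨0, hN⟩) =
      glue h (Fin.snoc (fun i => U i 0) (r 0) : Fin (n + 1 + 1) → SignType) (fun i => D i 0) :=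
    htOdd_col h U D r c 0
  have hcols (k : Fin (n + 1)) : (List.ofFn fun i => U i k.castSucc) ++ [r k] ++
      (List.ofFn fun i => D i k).reverse = List.ofFn (glue h
        (Fin.snoc (fun i => U i k.castSucc) (r k) : Fin (n + 1 + 1) → SignType)
        (fun i => D i k)) := by
    rw [ofFn_glue, ofFn_snoc]
  -- The weights of the columns in the left half, without the central one.
  have hmain (hrow : ∀ i : Fin (n + 1), IsAlternating (glue h (U i) (D i))) (s : Bool) :=
    show w ^ (n + 1) * (walk (stepWt 1 1 1) false (List.ofFn r) s *
        colMat w (Fin.cons t fun _ => 1 : Fin (n + 1) → R) (fun k => (List.ofFn fun i =>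
          U i k.castSucc) ++ [r k] ++ (List.ofFn fun i => D i k).reverse) bot top) =
      walk (stepWt 1 1 1) false (List.ofFn r) s *
        (t ^ (List.ofFn fun i => htOdd h U D r (midSign s) i ⟨0, hN⟩).idxOf 1 *
          w ^ ((n + 1) * N + ∑ k : Fin (n + 1), (List.ofFn fun i => htOdd h U D r (midSign s) i
            (Fin.castLE (by omega) k.castSucc)).count (-1)) *
          ∏ k : Fin (n + 1), if IsAlternating (glue h
            (Fin.snoc (fun i => U i k.castSucc) (r k) : Fin (n + 1 + 1) → SignType)
            (fun i => D i k)) then 1 else 0) by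
    by_cases hr : walk (stepWt (1 : R) 1 1) false (List.ofFn r) s = 0
    · rw [hr]; ring
    · have h0 := neg_one_notMem_oddCol h hrow hr
      rw [mul_left_comm, colMat, Matrix.of_apply, prod_walk_colStep w t N _ (by simp; omega) h0]
      simp only [hcols, htOdd_col, walk_eq_isAlternating, hcol0]
      rfl
  by_cases hrow : ∀ i : Fin (n + 1), IsAlternating (glue h (U i) (D i))
  · by_cases hcol : ∀ k : Fin (n + 1), IsAlternating (glue h
      (Fin.snoc (fun i => U i k.castSucc) (r k) : Fin (n + 1 + 1) → SignType) (fun i => D i k))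
    · have hasm (c : SignType) : IsASM (htOdd h U D r c) ↔
          IsAlternating (glue h (Fin.snoc r c : Fin (n + 1 + 1) → SignType) r) ∧
          IsAlternating (glue h (Fin.snoc (fun i => U i (Fin.last (n + 1))) c :
            Fin (n + 1 + 1) → SignType) fun i => U i (Fin.last (n + 1))) := by
        rw [IsASM, (isHT_htOdd h U D r c).forall_rows h (by omega),
          (isHT_htOdd h U D r c).forall_cols h (by omega)]
        simp only [Fin.forall_fin_succ' (n := n + 1), htOdd_row, htOdd_row_last, htOdd_col,
          htOdd_col_last]
        exact ⟨fun h => ⟨h.1.2, h.2.2⟩, fun h => ⟨⟨hrow, h.1⟩, hcol, h.2⟩⟩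
      simp only [hasm, hc, ← Finset.mul_sum]
      rw [sum_midWt h]
      simp only [Finset.mul_sum]
      refine Finset.sum_congr rfl fun s _ => ?_
      have h1 := hmain hrow s
      have h2 := walk_colStep_one w false s (List.ofFn fun i => U i (Fin.last (n + 1)))
      rw [negCount_htOdd]
      simp only [walk_eq_isAlternating, hrow, hcol, if_true, Finset.prod_const_one, one_mul,
        mul_one] at h1 ⊢
      have h3 (X : ℕ) : (2 * X + s.toNat) / 2 = X := by
        cases s
        · simp only [Bool.toNat_false]; omega
        · simp only [Bool.toNat_true]; omega
      simp only [h3, List.length_ofFn, Bool.toNat_false, add_zero] at h2 ⊢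
      generalize (∑ k : Fin (n + 1), (List.ofFn fun i => htOdd h U D r (midSign s) i
        (Fin.castLE _ k.castSucc)).count (-1)) = S at h1 ⊢
      generalize (List.ofFn fun i => U i (Fin.last (n + 1))) = f at h2 ⊢
      generalize t ^ (List.ofFn fun i => htOdd h U D r (midSign s) i ⟨0, hN⟩).idxOf 1 = T at h1 ⊢
      generalize walk (stepWt (1 : R) 1 1) false (List.ofFn r) s = g at h1 ⊢
      cases s
      · simp only [Bool.toNat_false, pow_zero, mul_one, cond_false] at h2 ⊢
        linear_combination w * p * walk (colStep w 1) false f false * h1 +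
          w * p * g * T * w ^ ((n + 1) * N + S) * h2
      · simp only [Bool.toNat_true, pow_one, cond_true] at h2 ⊢
        linear_combination w * q * walk (colStep w 1) false f true * h1 +
          q * g * T * w ^ ((n + 1) * N + S) * h2
    · trans 0
      · refine Finset.sum_eq_zero fun s _ => ?_
        have h1 := hmain hrow s
        rw [Finset.prod_ite_zero, if_neg (by simpa using hcol), mul_zero, mul_zero] at h1
        rw [pow_succ]
        linear_combination (w * (∏ x, walk (stepWt 1 1 1) false (List.ofFn (glue h (U x) (D x)))
          true) * (bif s then q else p) *
          walk (colStep w 1) false (List.ofFn fun i => U i (Fin.last (n + 1))) s) * h1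
      · rw [eq_comm]
        refine Finset.sum_eq_zero fun c _ => ?_
        rw [if_neg, mul_zero]
        intro h'
        refine hcol fun k => ?_
        have := h'.2 (Fin.castLE (by omega) k.castSucc)
        rwa [htOdd_col h] at this
  · have h0 : ∏ i : Fin (n + 1), walk (stepWt (1 : R) 1 1) false (List.ofFn (glue h (U i) (D i)))
        true = 0 := by
      simp only [walk_eq_isAlternating, Finset.prod_ite_zero, Finset.mem_univ, true_imp_iff]
      rw [if_neg hrow]
    trans 0
    · refine Finset.sum_eq_zero fun s _ => ?_
      rw [h0]; ring
    · rw [eq_comm]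
      refine Finset.sum_eq_zero fun c _ => ?_
      rw [if_neg, mul_zero]
      intro h'
      refine hrow fun i => ?_
      have := h'.1 (Fin.castLE (by omega) i.castSucc)
      rwa [htOdd_row h] at this

end HalfTurnOddLink

/-! ### Central entry, parity and orbits of the entries `-1` -/

section Center
variable {R : Type*} [CommRing R] {m : ℕ} {M : Matrix (Fin (2 * m + 1)) (Fin (2 * m + 1)) SignType}

theorem IsHT.count_centralCol (hM : IsHT M) (x : SignType) :
    ∃ K, (List.ofFn fun i => M i ⟨m, by omega⟩).count x =
      2 * K + if center M = x then 1 else 0 := by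
  have h : 2 * m + 1 = m + 1 + m := by omega
  have e (i : Fin (2 * m + 1)) : M i.rev ⟨m, by omega⟩ = M i ⟨m, by omega⟩ := by
    rw [← hM i]
    congr 1
    ext; simp [Fin.val_rev]; omega
  refine ⟨∑ k : Fin m, if M (Fin.castLE (by omega) k) ⟨m, by omega⟩ = x then 1 else 0, ?_⟩
  rw [count_ofFn, sum_fin_glue h, Fin.sum_univ_castSucc]
  simp only [e, two_mul]
  rw [add_right_comm]; rfl

theorem IsHT.exists_negCount_eq (hM : IsHT M) :
    ∃ K, negCount M = 2 * K + if center M = -1 then 1 else 0 := by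
  obtain ⟨K, hK⟩ := hM.count_centralCol (-1)
  refine ⟨K + ∑ k : Fin m, (List.ofFn fun i => M i (Fin.castLE (by omega) k.castSucc)).count (-1),
    (hM.negCount_odd (n := m) (by omega)).trans ?_⟩
  have : (List.ofFn fun i => M i (Fin.castLE (by omega) (Fin.last m))).count (-1) = _ := hK
  rw [this]; ring

/-- The entries of the central column sum to `1`, which is odd, and are symmetric about the centre.
-/
theorem center_ne_zero (hM : IsHTASM M) : center M ≠ 0 := by
  intro h0
  have h1 := count_of_walk_ne_zero ((isAlternating_iff_walk _).1 (hM.1.2 ⟨m, by omega⟩))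
  obtain ⟨K, hK⟩ := IsHT.count_centralCol hM.2 1
  obtain ⟨L, hL⟩ := IsHT.count_centralCol hM.2 (-1)
  have d1 : (0 : SignType) ≠ 1 := by decide
  have d2 : (0 : SignType) ≠ -1 := by decide
  rw [hK, hL, h0, if_neg d1, if_neg d2] at h1
  simp at h1
  omega

theorem halfTurn_eq_self {p : Fin (2 * m + 1) × Fin (2 * m + 1)} :
    halfTurn p = p ↔ p = (⟨m, by omega⟩, ⟨m, by omega⟩) := by
  simp only [halfTurn, Prod.ext_iff, Fin.ext_iff, Fin.val_rev]
  omega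

theorem halfTurn_halfTurn {N : ℕ} (p : Fin N × Fin N) : halfTurn (halfTurn p) = p := by
  simp [halfTurn]

/-- Only the centre is fixed by the half-turn; all other orbits have two elements. -/
theorem IsHT.two_mul_negOrbitCount (hM : IsHT M) :
    2 * negOrbitCount M = negCount M + if center M = -1 then 1 else 0 := by
  classical
  set φ := fun p : Fin (2 * m + 1) × Fin (2 * m + 1) => ({p, halfTurn p} : Finset _) with hφ
  set c : Fin (2 * m + 1) × Fin (2 * m + 1) := (⟨m, by omega⟩, ⟨m, by omega⟩) with hc
  have hneg (p) : halfTurn p ∈ negPos M ↔ p ∈ negPos M := by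
    simp only [negPos, Finset.mem_filter, Finset.mem_univ, true_and, halfTurn, hM p.1 p.2]
  have hcc : halfTurn c = c := halfTurn_eq_self.2 rfl
  have hcφ : φ c = {c} := by rw [hφ]; simp only [hcc, Finset.pair_eq_singleton]
  -- The fibre over an orbit of entries `-1` is the orbit itself.
  have hfib : negCount M = ∑ b ∈ (negPos M).image φ, b.card := by
    rw [negCount, Finset.card_eq_sum_card_image φ]
    refine Finset.sum_congr rfl fun b hb => ?_
    obtain ⟨p, hp, rfl⟩ := Finset.mem_image.1 hb
    congr 1
    ext q
    simp only [Finset.mem_filter, hφ, Finset.mem_insert, Finset.mem_singleton]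
    constructor
    · rintro ⟨-, hq⟩
      have : q ∈ ({p, halfTurn p} : Finset _) := hq ▸ Finset.mem_insert_self _ _
      simpa using this
    · rintro (rfl | rfl)
      · exact ⟨hp, rfl⟩
      · exact ⟨(hneg _).2 hp, by rw [halfTurn_halfTurn, Finset.pair_comm]⟩
  have hcard : ∀ b ∈ (negPos M).image φ, b.card + (if b = {c} then 1 else 0) = 2 := by
    intro b hb
    obtain ⟨p, hp, rfl⟩ := Finset.mem_image.1 hb
    by_cases hpc : p = c
    · rw [hpc, hcφ, if_pos rfl, Finset.card_singleton]
    · have hne : p ≠ halfTurn p := fun h => hpc (halfTurn_eq_self.1 h.symm)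
      have h2 : (φ p).card = 2 := Finset.card_pair hne
      rw [if_neg, h2]
      intro h
      rw [h, Finset.card_singleton] at h2
      omega
  have hmem : ({c} ∈ (negPos M).image φ) ↔ center M = -1 := by
    rw [Finset.mem_image]
    constructor
    · rintro ⟨p, hp, hpc⟩
      have : p ∈ ({c} : Finset _) := hpc ▸ Finset.mem_insert_self _ _
      rw [Finset.mem_singleton] at this
      subst this
      exact (Finset.mem_filter.1 hp).2
    · intro h
      exact ⟨c, Finset.mem_filter.2 ⟨Finset.mem_univ _, h⟩, hcφ⟩
  have := Finset.sum_congr rfl hcard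
  rw [Finset.sum_add_distrib, ← hfib, Finset.sum_ite_eq', Finset.sum_const, smul_eq_mul] at this
  simp only [hmem] at this
  rw [negOrbitCount, mul_comm, ← this]

open Classical in
theorem sum_midWt_center (a b t x : R) :
    ∑ M : Matrix (Fin (2 * m + 1)) (Fin (2 * m + 1)) SignType with IsHTASM M,
      midWt a b (center M) * (t ^ (List.ofFn fun i => M i ⟨0, by omega⟩).idxOf 1 *
        x ^ (negCount M / 2)) = a * AHTplus m t x + b * AHTminus m t x := by
  have hN : 0 < 2 * m + 1 := by omega
  have d3 : (-1 : SignType) ≠ 1 := by decide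
  have h1 : AHTplus m t x = ∑ M : Matrix (Fin (2 * m + 1)) (Fin (2 * m + 1)) SignType with
      IsHTASM M ∧ center M = 1, t ^ (List.ofFn fun i => M i ⟨0, hN⟩).idxOf 1 *
        x ^ (negCount M / 2) := by
    refine Eq.trans ?_ ((sum_firstCol hN (fun M => IsHTASM M ∧ center M = 1) (fun M h => h.1.1)
      (fun M => x ^ (negCount M / 2)) t).trans (Finset.sum_congr (by congr!) fun _ _ => rfl))
    refine Finset.sum_congr rfl fun r _ => ?_
    rw [htasms, Finset.filter_filter]
    congr 2
    ext M
    simp only [Finset.mem_filter]; tauto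
  have h2 : AHTminus m t x = ∑ M : Matrix (Fin (2 * m + 1)) (Fin (2 * m + 1)) SignType with
      IsHTASM M ∧ center M = -1, t ^ (List.ofFn fun i => M i ⟨0, hN⟩).idxOf 1 *
        x ^ (negCount M / 2) := by
    refine Eq.trans ?_ ((sum_firstCol hN (fun M => IsHTASM M ∧ center M = -1) (fun M h => h.1.1)
      (fun M => x ^ (negCount M / 2)) t).trans (Finset.sum_congr (by congr!) fun _ _ => rfl))
    refine Finset.sum_congr rfl fun r _ => ?_
    rw [htasms, Finset.filter_filter]
    congr 1
    refine Finset.sum_congr (Finset.ext fun M => ?_) fun M hM => ?_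
    · simp only [Finset.mem_filter]; tauto
    · simp only [Finset.mem_filter] at hM
      have hM := hM.2.1
      obtain ⟨K, hK⟩ := IsHT.exists_negCount_eq hM.1.2
      rw [hK, if_pos hM.2]
      congr 1; omega
  rw [h1, h2, Finset.mul_sum, Finset.mul_sum, ← Finset.filter_filter, ← Finset.filter_filter,
    Finset.sum_filter (p := fun M => center M = 1), Finset.sum_filter (p := fun M => center M = -1),
    ← Finset.sum_add_distrib]
  refine Finset.sum_congr rfl fun M _ => ?_
  rcases signType_cases (center M) with h | h | h <;> simp [midWt, h, d3, d3.symm]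

theorem AHT_odd_eq (t s : R) :
    AHT (2 * m + 1) t s = AHTplus m t (s ^ 2) + s * AHTminus m t (s ^ 2) := by
  classical
  have hN : 0 < 2 * m + 1 := by omega
  refine (sum_firstCol hN IsHTASM (fun _ h => h.1) _ t).trans ?_
  rw [← one_mul (AHTplus m t (s ^ 2)), ← sum_midWt_center]
  refine Finset.sum_congr (by congr!) fun M hM => ?_
  have hM : IsHTASM M := (Finset.mem_filter.1 hM).2
  obtain ⟨K, hK⟩ := IsHT.exists_negCount_eq hM.2
  have d3 : (-1 : SignType) ≠ 1 := by decide
  rcases signType_cases (center M) with h | h | h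
  · exact absurd h (center_ne_zero hM)
  · rw [h, if_neg d3.symm] at hK
    rw [hK, h, midWt, if_pos rfl, add_zero, Nat.mul_div_cancel_left _ two_pos, pow_mul, one_mul]
  · rw [h, if_pos rfl] at hK
    rw [hK, h, midWt, if_neg d3, if_pos rfl, show (2 * K + 1) / 2 = K by omega, pow_succ, pow_mul]
    ring

theorem AHTRobbins_odd_eq (t x : R) :
    AHTRobbins (2 * m + 1) t x = AHTplus m t x + x * AHTminus m t x := by
  classical
  have hN : 0 < 2 * m + 1 := by omega
  refine (sum_firstCol hN IsHTASM (fun _ h => h.1) _ t).trans ?_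
  rw [← one_mul (AHTplus m t x), ← sum_midWt_center]
  refine Finset.sum_congr (by congr!) fun M hM => ?_
  have hM : IsHTASM M := (Finset.mem_filter.1 hM).2
  obtain ⟨K, hK⟩ := IsHT.exists_negCount_eq hM.2
  have hO := IsHT.two_mul_negOrbitCount hM.2
  have d3 : (-1 : SignType) ≠ 1 := by decide
  rcases signType_cases (center M) with h | h | h
  · exact absurd h (center_ne_zero hM)
  · rw [h, if_neg d3.symm] at hK hO
    rw [show negOrbitCount M = negCount M / 2 by omega, h, midWt, if_pos rfl, one_mul]
  · rw [h, if_pos rfl] at hK hO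
    rw [show negOrbitCount M = negCount M / 2 + 1 by omega, h, midWt, if_neg d3, if_pos rfl,
      pow_succ]
    ring

theorem Zodd_eq_AHT (w t p q : R) (n : ℕ) :
    w ^ (n + 1 + 1) * Zodd w p q 1 1 (List.replicate (n + 1) 1)
      (Fin.cons t fun _ => 1 : Fin (n + 1) → R) = w ^ ((n + 1) * (2 * (n + 1) + 1 + 1)) *
      (w * p * AHTplus (n + 1) t w + q * AHTminus (n + 1) t w) := by
  rw [Zodd_eq_sum w t p q (N := 2 * (n + 1) + 1) (by omega) (by omega), ← sum_midWt_center]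
  rfl

end Center

/-! ### The two identities between the generating functions -/

section Identities

theorem A_map {R S : Type*} [CommRing R] [CommRing S] (φ : R →+* S) (n : ℕ) (t x : R) :
    φ (A n t x) = A n (φ t) (φ x) := by
  simp [A, map_sum]

theorem htGen_map {R S : Type*} [CommRing R] [CommRing S] (φ : R →+* S) (N : ℕ) (hN : 0 < N)
    (t x : R) : φ (htGen N hN t x) = htGen N hN (φ t) (φ x) := by
  simp [htGen, map_sum]

theorem isAlternating_single {n : ℕ} (i : Fin n) :
    IsAlternating fun j => if i = j then (1 : SignType) else 0 := by
  refine ⟨⟨i, by simp⟩, fun j hj _ => ?_, fun j hj _ => ?_, fun j k hjk hj hk _ => ?_⟩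
  · simp_all
  · simp_all
  · simp only [ne_eq, ite_eq_right_iff, Classical.not_imp] at hj hk
    exact absurd (hj.1.symm.trans hk.1) hjk.ne

/-- The identity matrix has no entry `-1`. -/
theorem A_one_zero_pos {n : ℕ} (hn : 0 < n) : 0 < A n (1 : ℚ) 0 := by
  classical
  have h0 : ∀ r : Fin n, 0 ≤ (∑ M ∈ asms n r, (0 : ℚ) ^ negCount M) * 1 ^ (r : ℕ) :=
    fun r => by positivity
  refine Finset.sum_pos' (fun r _ => h0 r) ⟨⟨0, hn⟩, Finset.mem_univ _, ?_⟩
  rw [one_pow, mul_one]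
  refine Finset.sum_pos' (fun _ _ => by positivity)
    ⟨Matrix.of fun i j => if i = j then 1 else 0, ?_, ?_⟩
  · refine Finset.mem_filter.2 ⟨Finset.mem_univ _, ⟨isAlternating_single, fun j => ?_⟩, by simp⟩
    simpa only [Matrix.of_apply, eq_comm] using isAlternating_single j
  · have : negCount (Matrix.of fun i j : Fin n => if i = j then (1 : SignType) else 0) = 0 := by
      rw [negCount, negPos, Finset.card_eq_zero, Finset.filter_eq_empty_iff]
      intro p _
      rw [Matrix.of_apply]
      split_ifs <;> decide
    rw [this, pow_zero]
    exact one_pos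

theorem cons_one_cons {R : Type*} [One R] (n : ℕ) (t : R) :
    (Fin.cons 1 (Fin.cons t fun _ => 1 : Fin (n + 1) → R) : Fin (n + 1 + 1) → R) =
      (Fin.cons t fun _ => 1 : Fin (n + 1 + 1) → R) ∘ Equiv.swap 0 1 := by
  ext i
  refine Fin.cases ?_ (fun i => ?_) i
  · simp [Function.comp_apply, Equiv.swap_apply_left]
  · refine Fin.cases ?_ (fun i => ?_) i
    · have : (Fin.succ 0 : Fin (n + 1 + 1)) = 1 := rfl
      rw [Function.comp_apply, this, Equiv.swap_apply_right, ← this]; simp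
    · rw [Function.comp_apply, Equiv.swap_apply_of_ne_of_ne (by simp [Fin.ext_iff])
        (by simp [Fin.ext_iff])]
      simp

/-- The two identities of odd order for alternating-sign matrices, with the central weights
`(1, 2w)` and `(2w, w ^ 3)`. -/
theorem A_mul_central {F : Type*} [Field F] [CharZero F] {w : F} (hw : w ≠ 0) (t : F) (n : ℕ) :
    A (n + 1) t w * (AHTplus (n + 1) t w + 2 * AHTminus (n + 1) t w) =
        A (n + 1 + 1) t w * htGen (2 * (n + 1)) (by omega) t w ∧
    A (n + 1 + 1) t w * (2 * AHTplus (n + 1) t w + w * AHTminus (n + 1) t w) =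
        A (n + 1) t w * htGen (2 * (n + 1 + 1)) (by omega) t w := by
  obtain ⟨e1, e2⟩ := homogeneous_identities hw (Fin.cons t fun _ => 1 : Fin (n + 1) → F)
  rw [cons_one_cons, Zdw_comp_perm] at e1 e2
  rw [Zht_comp_perm] at e2
  have a1 := Zdw_eq_A w t n
  have a2 := Zdw_eq_A w t (n + 1)
  have h1 := Zht_eq_htGen w t (n := n) (N := 2 * (n + 1)) (by omega) (by omega)
  have h2 := Zht_eq_htGen w t (n := n + 1) (N := 2 * (n + 1 + 1)) (by omega) (by omega)
  have o1 := Zodd_eq_AHT w t 1 (w + w) n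
  have o2 := Zodd_eq_AHT w t (w + w) (w * w * w) n
  constructor
  · refine mul_left_cancel₀
      (pow_ne_zero ((n + 1) * (n + 1) + (n + 1) * (2 * (n + 1) + 2) + 1) hw) ?_
    have l := congr($a1 * $o1)
    have r := congr($a2 * $h1)
    linear_combination w ^ (n + 1) * w ^ (n + 1 + 1) * e1 - l + r
  · refine mul_left_cancel₀
      (pow_ne_zero ((n + 1 + 1) * (n + 1 + 1) + (n + 1) * (2 * (n + 1) + 2) + 2) hw) ?_
    have l := congr($a2 * $o2)
    have r := congr($a1 * $h2)
    linear_combination w ^ (n + 1 + 1) * w ^ (n + 1 + 1) * e2 - l + w * r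

open MvPolynomial in
/-- The generating function of the half-turn symmetric matrices of order `2m` is divisible by that
of the alternating-sign matrices of order `m` in `ℚ[t, x]`: it is so up to powers of the prime `x`,
and `x` does not divide the latter, since there is a permutation matrix. -/
theorem exists_htGen_eq (n : ℕ) : ∃ B : MvPolynomial (Fin 2) ℚ,
    htGen (2 * (n + 1)) (by omega) (X 0) (X 1) = A (n + 1) (X 0) (X 1) * B := by
  set w : MvPolynomial (Fin 2) ℚ := X 1
  set t : MvPolynomial (Fin 2) ℚ := X 0
  have hw : Prime w := X_prime
  obtain ⟨Q, hQ⟩ := exists_Zht_eq hw.ne_zero (Fin.cons t fun _ => 1 : Fin (n + 1) → _)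
  have a1 := Zdw_eq_A w t n
  have h1 := Zht_eq_htGen w t (n := n) (N := 2 * (n + 1)) (by omega) (by omega)
  set c := (n + 1).choose 2
  have e : w ^ (c + (n + 1) * (n + 1)) * htGen (2 * (n + 1)) (by omega) t w =
      A (n + 1) t w * Q := by
    refine mul_left_cancel₀ (pow_ne_zero ((n + 1) * (n + 1)) hw.ne_zero) ?_
    linear_combination w ^ (n + 1) * hQ + Q * a1 - w ^ c * h1
  have hA : ¬ w ∣ A (n + 1) t w := by
    rintro ⟨D, hD⟩
    have := congrArg (eval ![1, 0]) hD
    rw [A_map, map_mul] at this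
    simp only [w, t, eval_X, Matrix.cons_val_zero, Matrix.cons_val_one, zero_mul] at this
    exact (A_one_zero_pos n.succ_pos).ne' this
  obtain ⟨B, rfl⟩ := hw.pow_dvd_of_dvd_mul_left _ hA (e ▸ dvd_mul_right _ _)
  refine ⟨B, mul_left_cancel₀ (pow_ne_zero (c + (n + 1) * (n + 1)) hw.ne_zero) ?_⟩
  linear_combination e

open MvPolynomial in
theorem algebraMap_ratField_ne_zero {P : MvPolynomial (Fin 2) ℚ} (v : Fin 2 → ℚ)
    (h : eval v P ≠ 0) : algebraMap (MvPolynomial (Fin 2) ℚ) RatField P ≠ 0 := by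
  rw [map_ne_zero_iff _ (IsFractionRing.injective _ _)]
  rintro rfl
  simp at h

open MvPolynomial in
theorem A_ne_zero {n : ℕ} (hn : 0 < n) : A n tVar xVar ≠ 0 := by
  have : A n tVar xVar = algebraMap (MvPolynomial (Fin 2) ℚ) RatField (A n (X 0) (X 1 ^ 2)) := by
    rw [A_map, map_pow]; rfl
  rw [this]
  refine algebraMap_ratField_ne_zero ![1, 0] ?_
  rw [A_map]
  simpa using (A_one_zero_pos hn).ne'

end Identities

end SixVertex
end HTASM

open HTASM in
theorem mainTheorem5 :
    -- `𝒜_HT⁽²⁾(2m; t, x)` is a genuine quotient and a polynomial in `t` and `x`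
    (∀ m : ℕ, 1 ≤ m → A m tVar xVar ≠ 0 ∧
      ∃ B : MvPolynomial (Fin 2) ℚ, AHT2 m tVar sqrtX = MvPolynomial.aeval ![tVar, xVar] B) ∧
    ∀ m : ℕ, 1 ≤ m →
      -- the whole enumeration
      AHT (2 * m + 1) tVar sqrtX =
        (sqrtX * A (m + 1) tVar xVar * AHT2 m tVar sqrtX +
          A m tVar xVar * AHT2 (m + 1) tVar sqrtX) / (sqrtX + 2) ∧
      -- its parts for the central entries `1` and `-1`
      AHT (2 * m + 1) tVar sqrtX = AHTplus m tVar xVar + sqrtX * AHTminus m tVar xVar ∧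
      AHTplus m tVar xVar =
        (-xVar * A (m + 1) tVar xVar * AHT2 m tVar sqrtX +
          2 * A m tVar xVar * AHT2 (m + 1) tVar sqrtX) / (4 - xVar) ∧
      AHTminus m tVar xVar =
        (2 * A (m + 1) tVar xVar * AHT2 m tVar sqrtX -
          A m tVar xVar * AHT2 (m + 1) tVar sqrtX) / (4 - xVar) ∧
      -- the enumeration by orbits of entries `-1`
      AHTRobbins (2 * m + 1) tVar xVar =
        AHTplus m tVar xVar + xVar * AHTminus m tVar xVar ∧
      AHTRobbins (2 * m + 1) tVar xVar =
        (xVar * A (m + 1) tVar xVar * AHT2 m tVar sqrtX +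
          (2 - xVar) * A m tVar xVar * AHT2 (m + 1) tVar sqrtX) / (4 - xVar) := by
  classical
  have hx : xVar ≠ 0 := by
    rw [xVar, sqrtX, ← map_pow]
    exact SixVertex.algebraMap_ratField_ne_zero ![0, 1] (by simp)
  have hs2 : sqrtX + 2 ≠ 0 := by
    have := SixVertex.algebraMap_ratField_ne_zero (P := MvPolynomial.X 1 + 2) ![0, 0] (by simp)
    rwa [map_add, map_ofNat] at this
  have hx4 : 4 - xVar ≠ 0 := by
    have := SixVertex.algebraMap_ratField_ne_zero (P := 4 - MvPolynomial.X 1 ^ 2) ![0, 0] (by simp)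
    rwa [map_sub, map_ofNat, map_pow] at this
  refine ⟨fun m hm => ⟨SixVertex.A_ne_zero hm, ?_⟩, fun m hm => ?_⟩
  · obtain ⟨n, rfl⟩ : ∃ n, m = n + 1 := ⟨m - 1, by omega⟩
    obtain ⟨B, hB⟩ := SixVertex.exists_htGen_eq n
    refine ⟨B, ?_⟩
    have h := congrArg (MvPolynomial.aeval ![tVar, xVar]).toRingHom hB
    rw [SixVertex.htGen_map, map_mul, SixVertex.A_map] at h
    simp only [AlgHom.toRingHom_eq_coe, RingHom.coe_coe, MvPolynomial.aeval_X,
      Matrix.cons_val_zero, Matrix.cons_val_one] at h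
    rw [AHT2, SixVertex.AHT_eq_htGen (by omega), ← xVar, h,
      mul_div_cancel_left₀ _ (SixVertex.A_ne_zero n.succ_pos)]
  · obtain ⟨n, rfl⟩ : ∃ n, m = n + 1 := ⟨m - 1, by omega⟩
    have hA := SixVertex.A_ne_zero n.succ_pos
    have hA' := SixVertex.A_ne_zero (n + 1).succ_pos
    obtain ⟨e1, e2⟩ := SixVertex.A_mul_central hx tVar n
    have h1 : A (n + 1 + 1) tVar xVar * AHT2 (n + 1) tVar sqrtX =
        AHTplus (n + 1) tVar xVar + 2 * AHTminus (n + 1) tVar xVar := by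
      rw [AHT2, SixVertex.AHT_eq_htGen (by omega), ← xVar, ← mul_div_assoc, ← e1,
        mul_div_cancel_left₀ _ hA]
    have h2 : A (n + 1) tVar xVar * AHT2 (n + 1 + 1) tVar sqrtX =
        2 * AHTplus (n + 1) tVar xVar + xVar * AHTminus (n + 1) tVar xVar := by
      rw [AHT2, SixVertex.AHT_eq_htGen (by omega), ← xVar, ← mul_div_assoc, ← e2,
        mul_div_cancel_left₀ _ hA']
    have h3 : AHT (2 * (n + 1) + 1) tVar sqrtX =
        AHTplus (n + 1) tVar xVar + sqrtX * AHTminus (n + 1) tVar xVar :=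
      SixVertex.AHT_odd_eq tVar sqrtX
    have h4 := SixVertex.AHTRobbins_odd_eq (m := n + 1) tVar xVar
    have hxs : xVar = sqrtX ^ 2 := rfl
    refine ⟨?_, h3, ?_, ?_, h4, ?_⟩
    · rw [h3, eq_div_iff hs2, mul_assoc, h1, h2, hxs]; ring
    · rw [eq_div_iff hx4, mul_assoc, mul_assoc, h1, h2]; ring
    · rw [eq_div_iff hx4, mul_assoc, h1, h2]; ring
    · rw [h4, eq_div_iff hx4, mul_assoc, mul_assoc, h1, h2]; ring
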